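/- Let $\lambda>0$, $\alpha>2$, $\sigma^2\ge 0$, $z\ge 0$, let $N_t\ge 1$, $m\ge 1$, $\delta\ge 0$ be integers and $N_r=mN_t+\delta$. The base stations (BSs) form a homogeneous Poisson point process of density $\lambda$ in $\mathbb{R}^2$; let $x_0,x_1,x_2,\dots$ be its points in the order of increasing distance from the origin, and put $r=\|x_0\|$ (the serving BS) and $R=\|x_{m-1}\|$ (the $(m-1)$-th nearest interfering BS, with $R=r$ if $m=1$). Let the channel vectors $h_{i,q}\in\mathbb{C}^{N_r}$ ($i\ge 0$, $1\le q\le N_t$) be i.i.d. $\mathcal{CN}(0,I_{N_r})$, independent of the point process. A partial zero-forcing receiver at the origin decodes the $\kappa$-th stream of $x_0$ with the unit vector $v$ in the direction of the projection of $h_{0,\kappa}$ on the orthogonal complement of the vectors $h_{0,q}$, $q\ne \kappa$, and $h_{i,q}$, $1\le i\le m-1$, $1\le q\le N_t$. Put $$\mathrm{SINR}=\frac{|v^\dagger h_{0,\kappa}|^2\,r^{-\alpha}}{N_t\sigma^2+I},\qquad I=\sum_{i\ge m}\|x_i\|^{-\alpha}\sum_{q=1}^{N_t}|v^\dagger h_{i,q}|^2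 .$$ Then $I<\infty$ almost surely, and for $s\ge 0$ its conditional Laplace transform is $\mathbb{E}[e^{-sI}\mid r,R]=\mathcal{L}_{R}(s)$ almost surely, where $$\mathcal{L}_{R}(s)=\exp\Big(-\lambda\pi R^2\Big({}_2F_1\big(N_t,-\tfrac{2}{\alpha};1-\tfrac{2}{\alpha};-R^{-\alpha}s\big)-1\Big)\Big)$$ and ${}_2F_1$ is the (analytically continued) Gauss hypergeometric function. For all $R>0$ and $s\ge 0$, the function $\mathcal{L}_{R}(s)e^{-sN_t\sigma^2}$ is $\delta$ times continuously differentiable near $s$. Let $$C(r,R)=\sum_{k=0}^{\delta}\frac{(-s)^k}{k!}\,\frac{d^k}{ds^k}\Big[\mathcal{L}_{R}(s)\,e^{-sN_t\sigma^2}\Big]\Big|_{s=zr^{\alpha}},\qquad f_r(r)=2\pi\lambda r\,e^{-\lambda\pi r^2},$$ and, for $m\ge 2$ and $R>r$, $$f_{R|r}(R\mid r)=\frac{2\pi\lambda R}{(m-2)!}\,e^{-\pi\lambda(R^2-r^2)}\big(\pi\lambda(R^2-r^2)\big)^{m-2}.$$ If $m\ge 2$, then $$\mathbb{P}[\mathrm{SINR}>z]=\int_0^\infty\int_r^\infty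 C(r,R)\,f_{R|r}(R\mid r)\,f_r(r)\,dR\,dr ,$$ with an integrand that is integrable over $\{0<r<R\}$. If $m=1$, then $\mathbb{P}[\mathrm{SINR}>z]=\int_0^\infty C(r,r)\,f_r(r)\,dr$, with an integrable integrand. -/

import Mathlib

open MeasureTheory ProbabilityTheory Set
open scoped ENNReal NNReal

noncomputable section

/-! ### Poisson point processes and fading -/

/-- The random set `Φ` is a Poisson point process with intensity measure `Λ`: the number of points
in a measurable set `B` of finite intensity is Poisson distributed with mean `Λ B`, and the numbers
of points in pairwise disjoint measurable sets are independent. -/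
structure IsPoissonPointProcess {Ω E : Type*} [MeasurableSpace Ω] [MeasurableSpace E]
    (Λ : Measure E) (Φ : Ω → Set E) (μ : Measure Ω) : Prop where
  measurable_count : ∀ B : Set E, MeasurableSet B → Measurable fun ω => (Φ ω ∩ B).encard
  law_count : ∀ B : Set E, MeasurableSet B → Λ B ≠ ∞ →
    HasLaw (fun ω => (Φ ω ∩ B).encard)
      ((poissonMeasure (Λ B).toNNReal).map (fun n : ℕ => (n : ℕ∞))) μ
  indep_count : ∀ (n : ℕ) (B : Fin n → Set E), (∀ i, MeasurableSet (B i)) →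
    Pairwise (fun i j => Disjoint (B i) (B j)) →
    iIndepFun (fun i ω => (Φ ω ∩ B i).encard) μ

/-- The sequence `x` lists every point of the set `S` exactly once, in the order of increasing
distance from the origin. -/
structure IsDistanceOrdering {E : Type*} [NormedAddCommGroup E] (S : Set E) (x : ℕ → E) :
    Prop where
  range_eq : range x = S
  injective : Function.Injective x
  monotone : Monotone fun i => ‖x i‖

/-- The circularly symmetric complex Gaussian law `CN(0, 1)`: independent real and imaginary parts
with law `N(0, 1/2)`. -/
def complexGaussian : Measure ℂ :=
  ((gaussianReal 0 (1 / 2)).prod (gaussianReal 0 (1 / 2))).map Complex.measurableEquivRealProd.symm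

/-- The circularly symmetric complex Gaussian law `CN(0, I)` on `ℂⁿ`. -/
def complexGaussianVector (n : ℕ) : Measure (EuclideanSpace ℂ (Fin n)) :=
  (Measure.pi fun _ : Fin n => complexGaussian).map (WithLp.toLp 2)

/-! ### The partial zero-forcing receiver

Here `x 0, x 1, …` are the base stations in the order of increasing distance, `x 0` is the serving
one, and `g i q` is the channel vector from antenna `q` of base station `x i`. -/

/-- The span of the cancelled channel vectors: those of the other streams of the serving base
station, and all those of the `m - 1` nearest interfering base stations. -/
def cancelledSpan {Nt Nr : ℕ} (m : ℕ) (k : Fin Nt) (g : ℕ → Fin Nt → EuclideanSpace ℂ (Fin Nr)) :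
    Submodule ℂ (EuclideanSpace ℂ (Fin Nr)) :=
  Submodule.span ℂ
    ({w | ∃ q, q ≠ k ∧ w = g 0 q} ∪ {w | ∃ i, 1 ≤ i ∧ i ≤ m - 1 ∧ ∃ q, w = g i q})

/-- The receive filter for stream `k`: the unit vector along the projection of the desired channel
vector on the orthogonal complement of the cancelled channel vectors. -/
def pzfFilter {Nt Nr : ℕ} (m : ℕ) (k : Fin Nt) (g : ℕ → Fin Nt → EuclideanSpace ℂ (Fin Nr)) :
    EuclideanSpace ℂ (Fin Nr) :=
  let p := (cancelledSpan m k g)ᗮ.starProjection (g 0 k)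
  ((‖p‖⁻¹ : ℝ) : ℂ) • p

/-- The residual interference `∑_{i ≥ m} ‖x i‖^{-α} ∑_q |v† g i q|²`. -/
def pzfInterference {Nt Nr : ℕ} (α : ℝ) (m : ℕ) (k : Fin Nt) (x : ℕ → EuclideanSpace ℝ (Fin 2))
    (g : ℕ → Fin Nt → EuclideanSpace ℂ (Fin Nr)) : ℝ≥0∞ :=
  ∑' j : ℕ, ENNReal.ofReal
    (‖x (m + j)‖ ^ (-α) * ∑ q, ‖inner ℂ (pzfFilter m k g) (g (m + j) q)‖ ^ 2)

/-- The post-processing signal-to-interference-noise ratio `S r^{-α} / (N_t σ² + I)` of stream `k`,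
with `S = |v† g 0 k|²`. -/
def pzfSINR {Nt Nr : ℕ} (α σ : ℝ) (m : ℕ) (k : Fin Nt) (x : ℕ → EuclideanSpace ℝ (Fin 2))
    (g : ℕ → Fin Nt → EuclideanSpace ℂ (Fin Nr)) : ℝ≥0∞ :=
  ENNReal.ofReal (‖inner ℂ (pzfFilter m k g) (g 0 k)‖ ^ 2 * ‖x 0‖ ^ (-α)) /
    (ENNReal.ofReal (Nt * σ ^ 2) + pzfInterference α m k x g)

/-! ### The hypergeometric function on `(-∞, 1)` -/

/-- `f` is the real-analytic continuation to `(-∞, 1)` of the hypergeometric series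
`∑ (a)_n (b)_n / (c)_n * x ^ n / n!`. -/
def IsHypergeometricContinuation (a b c : ℝ) (f : ℝ → ℝ) : Prop :=
  AnalyticOnNhd ℝ f (Iio 1) ∧ ∀ x : ℝ, |x| < 1 → f x = ordinaryHypergeometric a b c x

open Classical in
/-- The hypergeometric function `₂F₁(a, b; c; x)` for `x < 1`, by analytic continuation. -/
def hyp2F1 (a b c x : ℝ) : ℝ :=
  if h : ∃ f, IsHypergeometricContinuation a b c f then h.choose x else 0

/-- The continuation is unique. -/
theorem hyp2F1_eq {a b c : ℝ} {f : ℝ → ℝ} (hf : IsHypergeometricContinuation a b c f) {x : ℝ}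
    (hx : x < 1) : hyp2F1 a b c x = f x := by
  have h : ∃ f, IsHypergeometricContinuation a b c f := ⟨f, hf⟩
  unfold hyp2F1
  rw [dif_pos h]
  refine h.choose_spec.1.eqOn_of_preconnected_of_eventuallyEq hf.1
    (convex_Iio 1).isPreconnected (z₀ := 0) (by simp) ?_ hx
  filter_upwards [Metric.ball_mem_nhds (0 : ℝ) one_pos] with y hy
  have hy' : |y| < 1 := by simpa using hy
  rw [h.choose_spec.2 y hy', hf.2 y hy']

/-! ### The functions in the coverage formula -/

/-- `exp(-λ π R² (₂F₁(N_t, -2/α; (α-2)/α; -R^{-α} s) - 1))`. -/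
def interferenceLaplace (lam α : ℝ) (Nt : ℕ) (R s : ℝ) : ℝ :=
  Real.exp (-lam * Real.pi * R ^ 2 *
    (hyp2F1 Nt (-2 / α) ((α - 2) / α) (-(R ^ (-α)) * s) - 1))

/-- The Laplace transform of interference plus noise, `L_I(s) e^{-s N_t σ²}`. -/
def totalLaplace (lam α σ : ℝ) (Nt : ℕ) (R s : ℝ) : ℝ :=
  interferenceLaplace lam α Nt R s * Real.exp (-s * Nt * σ ^ 2)

/-- `∑_{k=0}^{δ} (-s)^k / k! * d^k/ds^k [L_I(s) e^{-s N_t σ²}]` at `s = z r^α`. -/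
def conditionalCoverage (lam α σ z : ℝ) (Nt δ : ℕ) (r R : ℝ) : ℝ :=
  ∑ k ∈ Finset.range (δ + 1), (-(z * r ^ α)) ^ k / (k.factorial : ℝ) *
    iteratedDeriv k (totalLaplace lam α σ Nt R) (z * r ^ α)

/-- The density of the distance to the nearest base station. -/
def nearestDensity (lam r : ℝ) : ℝ :=
  Real.exp (-lam * Real.pi * r ^ 2) * (2 * Real.pi * lam * r)

/-- The density at `R` of the distance to the `(m-1)`-th nearest interfering base station, given
the distance `r` to the nearest base station (for `m ≥ 2`). -/
def interfererDensity (lam : ℝ) (m : ℕ) (r R : ℝ) : ℝ :=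
  2 * Real.pi * lam * R / ((m - 2).factorial : ℝ) *
    Real.exp (-Real.pi * lam * (R ^ 2 - r ^ 2)) * (Real.pi * lam * (R ^ 2 - r ^ 2)) ^ (m - 2)

end

/-!
The proof separates the geometry of the base stations from the fading and joins the two through a
Laplace transform.

*Geometry.* The areas `a i = lam * π * ‖x i‖ ^ 2` are the arrival times of a Poisson process of unit
rate on the half-line (`IsPoissonPointProcess.isPoissonArrivals`). Its gaps are independent standard
exponential variables (`IsPoissonArrivals.hasLaw_gap`, `IsPoissonArrivals.indepFun_gap`), which is
the strong Markov property at the arrival times: it holds for times rounded up to a grid, by the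
independence of the counts in disjoint sets, and then in the limit of a fine grid. Hence `a 0` and
`a (m - 1) - a 0` are independent Erlang variables, and `r` and `R` have the stated densities.

*Interference.* A base station at distance `ρ` contributes the factor
`(1 + s * ρ ^ (-α)) ^ (-N)` to the Laplace transform (`fadingFactor`). Termwise integration of the
binomial series gives `₂F₁(N, -2/α; 1 - 2/α; x) - 1 = ∫_1^∞ (1 - (1 - x t^(-α/2))^(-N)) dt`
(`hyp2F1_sub_one`), where the integral is holomorphic for `re x < 1` and so is the continuation of
the series. Therefore `interferenceLaplace` is, as a function of the area `a = lam * π * R ^ 2`, the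
exponential of `-∫_a^∞ (1 - fadingFactor)`, and it solves the renewal equation
`L a = E[fadingFactor (a + e) * L (a + e)]` with `e` standard exponential
(`lintegral_fadingFactor_mul_tailLaplace`). So the product of the factors of the first `n`
interferers, times `L` at the last of them, has a conditional mean given `(r, R)` that does not
depend on `n`; since `L` tends to `1` at infinity, `n → ∞` identifies the Laplace transform of the
whole sum given `(r, R)` (`lintegral_exp_shotNoise`). Letting `s → 0` shows that the sum is almost
surely finite (`ae_shotNoise_ne_top`).

*Receiver.* The filter `v` is a function of the `m * N_t` channel vectors of the `m` nearest base
stations, and the Gram-Schmidt recursion makes it measurable. Independent Gaussian vectors are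
almost surely linearly independent, so the projection is on a space of dimension `δ + 1`, and the
signal power is a sum of `δ + 1` independent standard exponential variables. The channels of the
remaining interferers are independent of `v`, so by rotation invariance their outputs `v† h` are
independent `CN(0, 1)` variables, whatever `v` is, and are independent of the signal power
(`lintegral_pzf_outputs`).

*Coverage.* Given the interference, coverage has the probability
`erlangTail δ (z r^α (N_t σ² + I))`.
For a variable `J ≥ 0` with Laplace transform `φ` the mean of
`erlangTail δ (t * J) = ∑ k ≤ δ, (t J)^k / k! * exp (-t J)` is
`∑ k ≤ δ, (-t)^k / k! * φ⁽ᵏ⁾(t)` (`integral_erlangTail_mul`). Applied to the conditional law of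
`N_t σ² + I` given `(r, R)` this yields `conditionalCoverage`
(`HasReceiverLaw.exists_coverage`), and an average over the law of `(r, R)` gives the formula.
-/

open scoped Topology
open Filter

/-! ### The hypergeometric function as an integral -/

/-- The integral `∫_1^∞ (1 - (1 - x t^{-β})^{-N}) dt`. It is holomorphic on `re x < 1`, and
`1 + hypergeometricTail β N` continues the series `₂F₁(N, -1/β; 1 - 1/β; x)`. -/
noncomputable def hypergeometricTail (β : ℝ) (N : ℕ) (x : ℂ) : ℂ :=
  ∫ t in Ioi (1 : ℝ), (1 - ((1 - x * ((t ^ (-β) : ℝ) : ℂ))⁻¹) ^ N)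

lemma min_one_le_norm_one_sub_mul {x : ℂ} {ρ : ℝ} (hx : x.re ≤ 1 - ρ) {τ : ℝ}
    (h0 : 0 ≤ τ) (h1 : τ ≤ 1) : min 1 ρ ≤ ‖1 - x * (τ : ℂ)‖ := by
  refine le_trans ?_ (Complex.re_le_norm _)
  simp only [Complex.sub_re, Complex.one_re, Complex.mul_re, Complex.ofReal_re, Complex.ofReal_im,
    mul_zero, sub_zero]
  rcases le_total x.re 0 with h | h
  · exact (min_le_left _ _).trans (by nlinarith)
  · exact (min_le_right _ _).trans (by nlinarith)

lemma rpow_neg_mem_Icc {β t : ℝ} (hβ : 1 < β) (ht : t ∈ Ioi (1 : ℝ)) :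
    0 ≤ t ^ (-β) ∧ t ^ (-β) ≤ 1 :=
  ⟨Real.rpow_nonneg (zero_le_one.trans (le_of_lt ht)) _,
    Real.rpow_le_one_of_one_le_of_nonpos (le_of_lt ht) (by linarith)⟩

lemma norm_one_sub_inv_pow_le {w : ℂ} {c : ℝ} (hc : 0 < c) (h : c ≤ ‖1 - w‖) (N : ℕ) :
    ‖1 - ((1 - w)⁻¹) ^ N‖ ≤ (c⁻¹ * ∑ i ∈ Finset.range N, (c⁻¹) ^ i) * ‖w‖ := by
  have hne : (1 - w) ≠ 0 := by
    intro h0; rw [h0, norm_zero] at h; linarith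
  have hinv : ‖(1 - w)⁻¹‖ ≤ c⁻¹ := by
    rw [norm_inv]; exact inv_anti₀ hc h
  rw [← mul_neg_geom_sum]
  have h1 : (1 - (1 - w)⁻¹) = -(w * (1 - w)⁻¹) := by field_simp; ring
  rw [h1, norm_mul, norm_neg, norm_mul]
  have h2 : ‖∑ i ∈ Finset.range N, ((1 - w)⁻¹) ^ i‖ ≤ ∑ i ∈ Finset.range N, (c⁻¹) ^ i := by
    refine (norm_sum_le _ _).trans (Finset.sum_le_sum fun i _ => ?_)
    rw [norm_pow]
    gcongr
  have h3 : 0 ≤ ∑ i ∈ Finset.range N, (c⁻¹) ^ i := Finset.sum_nonneg fun i _ => by positivity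
  calc ‖w‖ * ‖(1 - w)⁻¹‖ * ‖∑ i ∈ Finset.range N, ((1 - w)⁻¹) ^ i‖
      ≤ ‖w‖ * c⁻¹ * ∑ i ∈ Finset.range N, (c⁻¹) ^ i := by gcongr
    _ = _ := by ring

lemma continuousOn_rpow_neg (β : ℝ) : ContinuousOn (fun t : ℝ => t ^ (-β)) (Ioi 1) :=
  fun _ ht => (Real.continuousAt_rpow_const _ _ (Or.inl (zero_lt_one.trans ht).ne')
    ).continuousWithinAt

lemma integrableOn_one_sub_inv_pow {β : ℝ} (hβ : 1 < β) (N : ℕ) {x : ℂ} (hx : x.re < 1) :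
    IntegrableOn (fun t : ℝ => 1 - ((1 - x * ((t ^ (-β) : ℝ) : ℂ))⁻¹) ^ N) (Ioi 1) := by
  set ρ := min 1 (1 - x.re)
  have hρ : 0 < ρ := lt_min one_pos (by linarith)
  have hlow : ∀ t ∈ Ioi (1 : ℝ), ρ ≤ ‖1 - x * ((t ^ (-β) : ℝ) : ℂ)‖ := fun t ht =>
    min_one_le_norm_one_sub_mul (by linarith) (rpow_neg_mem_Icc hβ ht).1 (rpow_neg_mem_Icc hβ ht).2
  have hint : IntegrableOn (fun t : ℝ => (ρ⁻¹ * ∑ i ∈ Finset.range N, (ρ⁻¹) ^ i) *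
      (‖x‖ * t ^ (-β))) (Ioi 1) :=
    ((integrableOn_Ioi_rpow_of_lt (by linarith) one_pos).const_mul _).const_mul _
  refine Integrable.mono' hint ?_ ?_
  · refine ContinuousOn.aestronglyMeasurable ?_ measurableSet_Ioi
    refine continuousOn_const.sub (ContinuousOn.pow (ContinuousOn.inv₀ ?_ ?_) N)
    · exact continuousOn_const.sub (continuousOn_const.mul
        (Complex.continuous_ofReal.comp_continuousOn (continuousOn_rpow_neg β)))
    · intro t ht h0
      have := hlow t ht
      rw [h0, norm_zero] at this
      linarith
  · refine (ae_restrict_iff' measurableSet_Ioi).2 (Eventually.of_forall fun t ht => ?_)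
    refine (norm_one_sub_inv_pow_le hρ (hlow t ht) N).trans (le_of_eq ?_)
    rw [norm_mul, Complex.norm_real, Real.norm_of_nonneg (rpow_neg_mem_Icc hβ ht).1]

lemma differentiableOn_hypergeometricTail {β : ℝ} (hβ : 1 < β) (N : ℕ) :
    DifferentiableOn ℂ (hypergeometricTail β N) {x | x.re < 1} := by
  intro x₀ hx₀
  have hx₀' : x₀.re < 1 := hx₀
  refine DifferentiableAt.differentiableWithinAt ?_
  set ε := (1 - x₀.re) / 2 with hε
  have hεpos : 0 < ε := by rw [hε]; linarith
  set ρ := min 1 ε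
  have hρ : 0 < ρ := lt_min one_pos hεpos
  have hball : ∀ x ∈ Metric.ball x₀ ε, x.re ≤ 1 - ε := by
    intro x hx
    rw [mem_ball_iff_norm] at hx
    have := (Complex.re_le_norm (x - x₀)).trans hx.le
    rw [Complex.sub_re] at this
    rw [hε] at *
    linarith
  have hlow : ∀ t ∈ Ioi (1 : ℝ), ∀ x ∈ Metric.ball x₀ ε, ρ ≤ ‖1 - x * ((t ^ (-β) : ℝ) : ℂ)‖ :=
    fun t ht x hx => min_one_le_norm_one_sub_mul (hball x hx) (rpow_neg_mem_Icc hβ ht).1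
      (rpow_neg_mem_Icc hβ ht).2
  have hne : ∀ t ∈ Ioi (1 : ℝ), ∀ x ∈ Metric.ball x₀ ε, 1 - x * ((t ^ (-β) : ℝ) : ℂ) ≠ 0 := by
    intro t ht x hx h0
    have := hlow t ht x hx
    rw [h0, norm_zero] at this
    linarith
  have key := hasDerivAt_integral_of_dominated_loc_of_deriv_le
    (μ := volume.restrict (Ioi (1 : ℝ))) (s := Metric.ball x₀ ε) (x₀ := x₀)
    (F := fun x t => 1 - ((1 - x * ((t ^ (-β) : ℝ) : ℂ))⁻¹) ^ N)
    (F' := fun x t => -(N * ((1 - x * ((t ^ (-β) : ℝ) : ℂ))⁻¹) ^ (N - 1) *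
      (((t ^ (-β) : ℝ) : ℂ) * ((1 - x * ((t ^ (-β) : ℝ) : ℂ))⁻¹) ^ 2)))
    (bound := fun t => N * (ρ⁻¹) ^ (N - 1) * (ρ⁻¹) ^ 2 * t ^ (-β))
    (Metric.ball_mem_nhds _ hεpos) ?_ (integrableOn_one_sub_inv_pow hβ N hx₀') ?_ ?_ ?_ ?_
  · exact key.2.differentiableAt
  · filter_upwards [Metric.ball_mem_nhds x₀ hεpos] with x hx
    exact (integrableOn_one_sub_inv_pow hβ N
      ((hball x hx).trans_lt (by linarith))).aestronglyMeasurable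
  · refine ContinuousOn.aestronglyMeasurable ?_ measurableSet_Ioi
    have hc : ContinuousOn (fun t : ℝ => ((t ^ (-β) : ℝ) : ℂ)) (Ioi 1) :=
      Complex.continuous_ofReal.comp_continuousOn (continuousOn_rpow_neg β)
    have hi : ContinuousOn (fun t : ℝ => (1 - x₀ * ((t ^ (-β) : ℝ) : ℂ))⁻¹) (Ioi 1) :=
      ContinuousOn.inv₀ (continuousOn_const.sub (continuousOn_const.mul hc))
        fun t ht => hne t ht x₀ (Metric.mem_ball_self hεpos)
    exact ((continuousOn_const.mul (hi.pow _)).mul (hc.mul (hi.pow 2))).neg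
  · refine (ae_restrict_iff' measurableSet_Ioi).2 (Eventually.of_forall fun t ht x hx => ?_)
    have hinv : ‖(1 - x * ((t ^ (-β) : ℝ) : ℂ))⁻¹‖ ≤ ρ⁻¹ := by
      rw [norm_inv]; exact inv_anti₀ hρ (hlow t ht x hx)
    rw [norm_neg, norm_mul, norm_mul, norm_mul, norm_pow, norm_pow, Complex.norm_natCast,
      Complex.norm_real, Real.norm_of_nonneg (rpow_neg_mem_Icc hβ ht).1]
    have h0 := (rpow_neg_mem_Icc hβ ht).1
    calc (N : ℝ) * ‖(1 - x * ((t ^ (-β) : ℝ) : ℂ))⁻¹‖ ^ (N - 1) *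
          (t ^ (-β) * ‖(1 - x * ((t ^ (-β) : ℝ) : ℂ))⁻¹‖ ^ 2)
        ≤ (N : ℝ) * (ρ⁻¹) ^ (N - 1) * (t ^ (-β) * (ρ⁻¹) ^ 2) := by gcongr
      _ = _ := by ring
  · exact (integrableOn_Ioi_rpow_of_lt (by linarith) one_pos).const_mul _
  · refine (ae_restrict_iff' measurableSet_Ioi).2 (Eventually.of_forall fun t ht x hx => ?_)
    have h1 : HasDerivAt (fun x : ℂ => 1 - x * ((t ^ (-β) : ℝ) : ℂ)) (-((t ^ (-β) : ℝ) : ℂ)) x := by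
      simpa using ((hasDerivAt_id x).mul_const ((t ^ (-β) : ℝ) : ℂ)).const_sub 1
    have h2 := ((h1.inv (hne t ht x hx)).pow N).const_sub 1
    convert! h2 using 1
    simp only [neg_neg, div_eq_mul_inv, inv_pow, Pi.inv_apply]

lemma hypergeometricTail_ofReal {β : ℝ} (N : ℕ) (x : ℝ) :
    hypergeometricTail β N x =
      ((∫ t in Ioi (1 : ℝ), (1 - ((1 - x * t ^ (-β))⁻¹) ^ N) : ℝ) : ℂ) := by
  rw [hypergeometricTail, ← integral_complex_ofReal]
  refine integral_congr_ae (Eventually.of_forall fun t => ?_)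
  push_cast
  rfl

lemma integrableOn_one_sub_inv_pow_real {β : ℝ} (hβ : 1 < β) (N : ℕ) {x : ℝ} (hx : x < 1) :
    IntegrableOn (fun t : ℝ => 1 - ((1 - x * t ^ (-β))⁻¹) ^ N) (Ioi 1) := by
  have h := (integrableOn_one_sub_inv_pow hβ N (x := (x : ℂ)) (by simpa using hx)).re
  refine h.congr (Eventually.of_forall fun t => ?_)
  have : (1 - ((1 - (x : ℂ) * ((t ^ (-β) : ℝ) : ℂ))⁻¹) ^ N) =
      ((1 - ((1 - x * t ^ (-β))⁻¹) ^ N : ℝ) : ℂ) := by push_cast; rfl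
  simp only [this]
  exact Complex.ofReal_re _

lemma analyticOnNhd_hypergeometricTail {β : ℝ} (hβ : 1 < β) (N : ℕ) :
    AnalyticOnNhd ℝ (fun x : ℝ => 1 + (hypergeometricTail β N x).re) (Iio 1) := by
  have hopen : IsOpen {x : ℂ | x.re < 1} := isOpen_lt Complex.continuous_re continuous_const
  have hC := (differentiableOn_hypergeometricTail hβ N).analyticOnNhd hopen
  intro x hx
  have h1 : AnalyticAt ℝ (hypergeometricTail β N) (x : ℂ) :=
    (hC (x : ℂ) (by simpa using hx)).restrictScalars
  have h2 : AnalyticAt ℝ (fun y : ℝ => (y : ℂ)) x := Complex.ofRealCLM.analyticAt x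
  have h3 : AnalyticAt ℝ (fun y : ℝ => hypergeometricTail β N (y : ℂ)) x := h1.fun_comp h2
  exact analyticAt_const.add ((Complex.reCLM.analyticAt _).fun_comp h3)

/-- Termwise integration of the binomial series. -/
lemma hasSum_hypergeometricTail {β : ℝ} (hβ : 1 < β) (k : ℕ) {x : ℝ} (hx : |x| < 1) :
    HasSum (fun n : ℕ => -(((n + 1 + k).choose k : ℝ) * x ^ (n + 1) / (β * (n + 1) - 1)))
      (∫ t in Ioi (1 : ℝ), (1 - ((1 - x * t ^ (-β))⁻¹) ^ (k + 1))) := by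
  have hpos : ∀ n : ℕ, 0 < β * (n + 1) - 1 := fun n => by
    have : (0 : ℝ) ≤ n := n.cast_nonneg
    nlinarith
  have hint : ∀ n : ℕ, ∫ t in Ioi (1 : ℝ), t ^ (-(β * (n + 1))) = 1 / (β * (n + 1) - 1) := by
    intro n
    rw [integral_Ioi_rpow_of_lt (by linarith [hpos n]) one_pos, Real.one_rpow, ← neg_div_neg_eq]
    congr 1 <;> ring
  have hI : ∀ n : ℕ, IntegrableOn (fun t : ℝ => t ^ (-(β * (n + 1)))) (Ioi 1) := fun n =>
    integrableOn_Ioi_rpow_of_lt (by linarith [hpos n]) one_pos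
  have hS : Summable fun n : ℕ => ((n + k).choose k : ℝ) * |x| ^ n :=
    summable_choose_mul_geometric_of_norm_lt_one k (by simpa using hx)
  have key := hasSum_integral_of_summable_integral_norm (μ := volume.restrict (Ioi (1 : ℝ)))
    (F := fun (n : ℕ) (t : ℝ) => -(((n + 1 + k).choose k : ℝ) * x ^ (n + 1)) *
      t ^ (-(β * (n + 1)))) (fun n => (hI n).const_mul _) ?_
  · convert! key using 1
    · ext n
      rw [integral_const_mul, hint]
      ring
    · refine setIntegral_congr_fun measurableSet_Ioi fun t ht => ?_
      obtain ⟨h0, h1⟩ := rpow_neg_mem_Icc hβ ht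
      have hw : ‖x * t ^ (-β)‖ < 1 := by
        rw [norm_mul, Real.norm_eq_abs, Real.norm_of_nonneg h0]
        nlinarith [abs_nonneg x]
      have h2 := hasSum_choose_mul_geometric_of_norm_lt_one k hw
      have h3 := ((hasSum_nat_add_iff' 1).2 h2).neg.tsum_eq
      simp only [Finset.range_one, Finset.sum_singleton, zero_add, Nat.choose_self, Nat.cast_one,
        pow_zero, mul_one, neg_sub] at h3
      simp only [inv_pow]
      rw [← one_div, ← h3]
      refine tsum_congr fun n => ?_
      have h4 : t ^ (-(β * ((n : ℝ) + 1))) = (t ^ (-β)) ^ (n + 1) := by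
        rw [← Real.rpow_natCast, ← Real.rpow_mul (zero_le_one.trans (le_of_lt ht))]
        push_cast
        ring_nf
      rw [h4, mul_pow]
      ring
  · have hS' : Summable fun n : ℕ => ((n + 1 + k).choose k : ℝ) * |x| ^ (n + 1) * (1 / (β - 1)) :=
      ((summable_nat_add_iff 1).2 hS).mul_right _
    refine Summable.of_nonneg_of_le (fun n => integral_nonneg fun t => norm_nonneg _)
      (fun n => ?_) hS'
    have h5 : ∫ t in Ioi (1 : ℝ), ‖-(((n + 1 + k).choose k : ℝ) * x ^ (n + 1)) *
        t ^ (-(β * (n + 1)))‖ =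
        ((n + 1 + k).choose k : ℝ) * |x| ^ (n + 1) * (1 / (β * (n + 1) - 1)) := by
      rw [← hint n, ← integral_const_mul]
      refine setIntegral_congr_fun measurableSet_Ioi fun t ht => ?_
      simp only [norm_mul, norm_neg, norm_pow, Real.norm_eq_abs, Nat.abs_cast]
      rw [abs_of_nonneg (Real.rpow_nonneg (zero_le_one.trans (le_of_lt ht)) _)]
    rw [h5]
    have : (0 : ℝ) ≤ n := n.cast_nonneg
    have h6 : β - 1 ≤ β * (n + 1) - 1 := by nlinarith
    exact mul_le_mul_of_nonneg_left (one_div_le_one_div_of_le (by linarith) h6) (by positivity)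

lemma ordinaryHypergeometric_eq_one_add_integral {β : ℝ} (hβ : 1 < β) {N : ℕ} (hN : 1 ≤ N) {x : ℝ}
    (hx : |x| < 1) : ordinaryHypergeometric (N : ℝ) (-1 / β) (1 - 1 / β) x =
      1 + ∫ t in Ioi (1 : ℝ), (1 - ((1 - x * t ^ (-β))⁻¹) ^ N) := by
  obtain ⟨k, rfl⟩ := Nat.exists_eq_add_of_le' hN
  rw [ordinaryHypergeometric_eq_tsum]
  have hβ0 : (0 : ℝ) < β := by linarith
  set b : ℝ := -1 / β with hb
  have hc : 1 - 1 / β = b + 1 := by rw [hb]; ring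
  have hcpos : 0 < b + 1 := by
    rw [← hc]
    have : 1 / β < 1 := by rw [div_lt_one hβ0]; exact hβ
    linarith
  rw [hc]
  have hratio : ∀ n : ℕ, (ascPochhammer ℝ n).eval b * (b + n) =
      b * (ascPochhammer ℝ n).eval (b + 1) := by
    intro n
    rw [← ascPochhammer_succ_eval, ascPochhammer_succ_left]
    simp
  have hterm : ∀ n : ℕ, (((n + 1).factorial : ℝ)⁻¹ *
      (ascPochhammer ℝ (n + 1)).eval (((k + 1 : ℕ) : ℝ)) *
      (ascPochhammer ℝ (n + 1)).eval b * ((ascPochhammer ℝ (n + 1)).eval (b + 1))⁻¹) • x ^ (n + 1) =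
      -(((n + 1 + k).choose k : ℝ) * x ^ (n + 1) / (β * (n + 1) - 1)) := by
    intro n
    have hP : 0 < (ascPochhammer ℝ (n + 1)).eval (b + 1) := ascPochhammer_pos _ _ hcpos
    have hn : (0 : ℝ) ≤ n := n.cast_nonneg
    have hd : 0 < β * (n + 1) - 1 := by nlinarith
    have h1 : (ascPochhammer ℝ (n + 1)).eval b * ((ascPochhammer ℝ (n + 1)).eval (b + 1))⁻¹ =
        -(1 / (β * (n + 1) - 1)) := by
      have hr := hratio (n + 1)
      have h2 : b + ((n + 1 : ℕ) : ℝ) = (β * (n + 1) - 1) / β := by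
        rw [hb]; push_cast; field_simp; ring
      rw [h2] at hr
      have h3 : (ascPochhammer ℝ (n + 1)).eval b = -(1 / (β * (n + 1) - 1)) *
          (ascPochhammer ℝ (n + 1)).eval (b + 1) := by
        rw [hb] at hr ⊢
        field_simp at hr ⊢
        linarith
      rw [h3, mul_inv_cancel_right₀ hP.ne']
    rw [ascPochhammer_nat_eq_natCast_ascFactorial, Nat.ascFactorial_eq_factorial_mul_choose,
      mul_assoc, h1, smul_eq_mul, Nat.add_comm k (n + 1), Nat.choose_symm_add]
    have : ((n + 1).factorial : ℝ) ≠ 0 := by positivity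
    push_cast
    field_simp
  have h := hasSum_hypergeometricTail hβ k hx
  have h' : HasSum (fun n : ℕ => (((n + 1).factorial : ℝ)⁻¹ *
      (ascPochhammer ℝ (n + 1)).eval (((k + 1 : ℕ) : ℝ)) *
      (ascPochhammer ℝ (n + 1)).eval b * ((ascPochhammer ℝ (n + 1)).eval (b + 1))⁻¹) • x ^ (n + 1))
      (∫ t in Ioi (1 : ℝ), (1 - ((1 - x * t ^ (-β))⁻¹) ^ (k + 1))) := by
    simpa only [hterm] using h
  have h'' := (hasSum_nat_add_iff (f := fun n : ℕ => ((n.factorial : ℝ)⁻¹ *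
      (ascPochhammer ℝ n).eval (((k + 1 : ℕ) : ℝ)) *
      (ascPochhammer ℝ n).eval b * ((ascPochhammer ℝ n).eval (b + 1))⁻¹) • x ^ n) 1).1 h'
  refine h''.tsum_eq.trans ?_
  simp [add_comm]

lemma isHypergeometricContinuation_integral {α : ℝ} (hα : 2 < α) {N : ℕ} (hN : 1 ≤ N) :
    IsHypergeometricContinuation N (-2 / α) ((α - 2) / α)
      (fun x : ℝ => 1 + (hypergeometricTail (α / 2) N x).re) := by
  refine ⟨analyticOnNhd_hypergeometricTail (by linarith) N, fun x hx => ?_⟩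
  have h1 : -2 / α = -1 / (α / 2) := by field_simp
  have h2 : (α - 2) / α = 1 - 1 / (α / 2) := by field_simp
  simp only [h1, h2, ordinaryHypergeometric_eq_one_add_integral (by linarith : 1 < α / 2) hN hx,
    hypergeometricTail_ofReal, Complex.ofReal_re]

/-- Euler-type integral for the hypergeometric function of the coverage formula. -/
lemma hyp2F1_sub_one {α : ℝ} (hα : 2 < α) {N : ℕ} (hN : 1 ≤ N) {x : ℝ} (hx : x < 1) :
    hyp2F1 N (-2 / α) ((α - 2) / α) x - 1 =
      ∫ t in Ioi (1 : ℝ), (1 - ((1 - x * t ^ (-(α / 2)))⁻¹) ^ N) := by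
  rw [hyp2F1_eq (isHypergeometricContinuation_integral hα hN) hx, hypergeometricTail_ofReal,
    Complex.ofReal_re]
  ring

lemma analyticOnNhd_hyp2F1 {α : ℝ} (hα : 2 < α) {N : ℕ} (hN : 1 ≤ N) :
    AnalyticOnNhd ℝ (hyp2F1 N (-2 / α) ((α - 2) / α)) (Iio 1) :=
  (isHypergeometricContinuation_integral hα hN).1.congr isOpen_Iio fun _ hx =>
    (hyp2F1_eq (isHypergeometricContinuation_integral hα hN) hx).symm

lemma analyticAt_interferenceLaplace (lam : ℝ) {α : ℝ} (hα : 2 < α) {N : ℕ} (hN : 1 ≤ N) {R s : ℝ}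
    (hR : 0 < R) (hs : 0 ≤ s) : AnalyticAt ℝ (interferenceLaplace lam α N R) s := by
  have h1 : AnalyticAt ℝ (hyp2F1 N (-2 / α) ((α - 2) / α)) (-(R ^ (-α)) * s) := by
    refine analyticOnNhd_hyp2F1 hα hN _ ?_
    have : 0 ≤ R ^ (-α) * s := mul_nonneg (Real.rpow_nonneg hR.le _) hs
    simp only [mem_Iio]
    linarith
  have h2 : AnalyticAt ℝ (fun s : ℝ => -(R ^ (-α)) * s) s := analyticAt_const.mul analyticAt_id
  have h3 : AnalyticAt ℝ (fun s : ℝ => hyp2F1 N (-2 / α) ((α - 2) / α) (-(R ^ (-α)) * s)) s :=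
    AnalyticAt.fun_comp (f := fun s : ℝ => -(R ^ (-α)) * s) h1 h2
  exact (analyticAt_const.mul (h3.sub analyticAt_const)).rexp

lemma analyticAt_totalLaplace (lam σ : ℝ) {α : ℝ} (hα : 2 < α) {N : ℕ} (hN : 1 ≤ N) {R s : ℝ}
    (hR : 0 < R) (hs : 0 ≤ s) : AnalyticAt ℝ (totalLaplace lam α σ N R) s :=
  (analyticAt_interferenceLaplace lam hα hN hR hs).mul
    (((analyticAt_id.neg.mul analyticAt_const).mul analyticAt_const).rexp)

/-! ### The interference functional in area coordinates -/

lemma lintegral_expMeasure_one {f : ℝ → ℝ≥0∞} (hf : Measurable f) :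
    ∫⁻ t, f t ∂(expMeasure 1) = ∫⁻ t in Ioi (0 : ℝ), ENNReal.ofReal (Real.exp (-t)) * f t := by
  have hm : Measurable (exponentialPDF 1) :=
    (measurable_exponentialPDFReal 1).ennreal_ofReal
  change ∫⁻ t, f t ∂(volume.withDensity (exponentialPDF 1)) = _
  rw [lintegral_withDensity_eq_lintegral_mul _ hm hf,
    ← lintegral_add_compl _ (measurableSet_Ioi (a := (0 : ℝ)))]
  have h2 : ∫⁻ t in (Ioi (0 : ℝ))ᶜ, (exponentialPDF 1 * f) t = 0 := by
    rw [compl_Ioi, setLIntegral_congr (Iio_ae_eq_Iic (a := (0 : ℝ))).symm,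
      setLIntegral_congr_fun (g := fun _ => 0) measurableSet_Iio, lintegral_zero]
    intro t ht
    simp [exponentialPDF_of_neg ht]
  rw [h2, add_zero]
  refine setLIntegral_congr_fun measurableSet_Ioi fun t ht => ?_
  simp [exponentialPDF_of_nonneg (le_of_lt ht)]

/-- The Laplace transform at `s` of the interference from a single base station, as a function of
the area `τ = lam * π * ‖x‖ ^ 2`. -/
noncomputable def fadingFactor (lam α : ℝ) (N : ℕ) (s τ : ℝ) : ℝ :=
  ((1 + s * (τ / (lam * Real.pi)) ^ (-(α / 2)))⁻¹) ^ N

/-- `interferenceLaplace` as a function of the area `a = lam * π * R ^ 2`. -/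
noncomputable def tailLaplace (lam α : ℝ) (N : ℕ) (s a : ℝ) : ℝ :=
  interferenceLaplace lam α N (Real.sqrt (a / (lam * Real.pi))) s

section
variable {lam α s : ℝ} {N : ℕ}

lemma fadingFactor_mem (hlam : 0 < lam) (hs : 0 ≤ s) {τ : ℝ} (hτ : 0 ≤ τ) :
    0 < fadingFactor lam α N s τ ∧ fadingFactor lam α N s τ ≤ 1 := by
  have h : 0 ≤ s * (τ / (lam * Real.pi)) ^ (-(α / 2)) :=
    mul_nonneg hs (Real.rpow_nonneg (by positivity) _)
  refine ⟨by unfold fadingFactor; positivity, pow_le_one₀ (by positivity) (inv_le_one_of_one_le₀ ?_)⟩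
  linarith

lemma measurable_fadingFactor : Measurable (fadingFactor lam α N s) := by
  unfold fadingFactor; fun_prop

lemma continuousAt_fadingFactor (hlam : 0 < lam) (hs : 0 ≤ s) {τ : ℝ} (hτ : 0 < τ) :
    ContinuousAt (fadingFactor lam α N s) τ := by
  have hc : 0 < lam * Real.pi := by positivity
  have h : 0 ≤ s * (τ / (lam * Real.pi)) ^ (-(α / 2)) :=
    mul_nonneg hs (Real.rpow_nonneg (by positivity) _)
  unfold fadingFactor
  refine ContinuousAt.pow (ContinuousAt.inv₀ ?_ (by positivity)) N
  refine continuousAt_const.add (continuousAt_const.mul ?_)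
  exact ContinuousAt.rpow_const (by fun_prop) (Or.inl (by positivity))

lemma fadingFactor_mul (hlam : 0 < lam) {a t : ℝ} (ha : 0 < a) (ht : 0 < t) :
    fadingFactor lam α N s (a * t) =
      ((1 - (-(Real.sqrt (a / (lam * Real.pi)) ^ (-α)) * s) * t ^ (-(α / 2)))⁻¹) ^ N := by
  have hc : 0 < lam * Real.pi := by positivity
  have h1 : (a * t / (lam * Real.pi)) ^ (-(α / 2)) =
      (Real.sqrt (a / (lam * Real.pi))) ^ (-α) * t ^ (-(α / 2)) := by
    rw [mul_div_right_comm, Real.mul_rpow (by positivity) ht.le, Real.sqrt_eq_rpow,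
      ← Real.rpow_mul (by positivity)]
    congr 2
    ring
  rw [fadingFactor, h1]
  congr 2
  ring

lemma integrableOn_one_sub_fadingFactor (hlam : 0 < lam) (hα : 2 < α) (hs : 0 ≤ s) {a : ℝ}
    (ha : 0 < a) : IntegrableOn (fun τ => 1 - fadingFactor lam α N s τ) (Ioi a) := by
  have hx : -(Real.sqrt (a / (lam * Real.pi)) ^ (-α)) * s < 1 := by
    have : 0 ≤ Real.sqrt (a / (lam * Real.pi)) ^ (-α) * s :=
      mul_nonneg (Real.rpow_nonneg (Real.sqrt_nonneg _) _) hs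
    linarith
  have h1 := integrableOn_one_sub_inv_pow_real (β := α / 2) (by linarith) N hx
  have h2 : IntegrableOn (fun t => 1 - fadingFactor lam α N s (a * t)) (Ioi 1) := by
    refine h1.congr_fun (fun t ht => ?_) measurableSet_Ioi
    rw [fadingFactor_mul hlam ha (zero_lt_one.trans ht)]
  have h3 := (integrableOn_Ioi_comp_mul_left_iff
    (fun τ => 1 - fadingFactor lam α N s τ) 1 ha).1 h2
  simpa using h3

/-- The Laplace functional of the points beyond `a`: a product of one factor per point of a
unit-rate Poisson process has the mean `exp (-∫ (1 - factor))`. -/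
lemma tailLaplace_eq_exp (hlam : 0 < lam) (hα : 2 < α) (hN : 1 ≤ N) (hs : 0 ≤ s) {a : ℝ}
    (ha : 0 < a) : tailLaplace lam α N s a =
      Real.exp (-∫ τ in Ioi a, (1 - fadingFactor lam α N s τ)) := by
  have hc : 0 < lam * Real.pi := by positivity
  have hx : -(Real.sqrt (a / (lam * Real.pi)) ^ (-α)) * s < 1 := by
    have : 0 ≤ Real.sqrt (a / (lam * Real.pi)) ^ (-α) * s :=
      mul_nonneg (Real.rpow_nonneg (Real.sqrt_nonneg _) _) hs
    linarith
  rw [tailLaplace, interferenceLaplace, hyp2F1_sub_one hα hN hx, Real.sq_sqrt (by positivity)]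
  have h1 : ∫ t in Ioi (1 : ℝ), (1 - ((1 - (-(Real.sqrt (a / (lam * Real.pi)) ^ (-α)) * s) *
      t ^ (-(α / 2)))⁻¹) ^ N) = ∫ t in Ioi (1 : ℝ), (1 - fadingFactor lam α N s (a * t)) := by
    refine setIntegral_congr_fun measurableSet_Ioi fun t ht => ?_
    rw [fadingFactor_mul hlam ha (zero_lt_one.trans ht)]
  rw [h1, integral_comp_mul_left_Ioi (fun τ => 1 - fadingFactor lam α N s τ) 1 ha, mul_one,
    smul_eq_mul]
  congr 1
  field_simp

lemma tailLaplace_mem (hlam : 0 < lam) (hα : 2 < α) (hN : 1 ≤ N) (hs : 0 ≤ s) {a : ℝ}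
    (ha : 0 < a) : 0 < tailLaplace lam α N s a ∧ tailLaplace lam α N s a ≤ 1 := by
  rw [tailLaplace_eq_exp hlam hα hN hs ha]
  refine ⟨Real.exp_pos _, Real.exp_le_one_iff.2 (neg_nonpos.2 ?_)⟩
  refine setIntegral_nonneg measurableSet_Ioi fun τ hτ => ?_
  linarith [(fadingFactor_mem (α := α) (N := N) hlam hs (ha.trans hτ).le).2]

/-- The infinitesimal form of the renewal equation. -/
lemma hasDerivAt_tailLaplace (hlam : 0 < lam) (hα : 2 < α) (hN : 1 ≤ N) (hs : 0 ≤ s) {a : ℝ}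
    (ha : 0 < a) : HasDerivAt (tailLaplace lam α N s)
      ((1 - fadingFactor lam α N s a) * tailLaplace lam α N s a) a := by
  have ha2 : 0 < a / 2 := by positivity
  have hI : IntervalIntegrable (fun τ => 1 - fadingFactor lam α N s τ) volume (a / 2) a :=
    (intervalIntegrable_iff_integrableOn_Ioc_of_le (by linarith)).2
      ((integrableOn_one_sub_fadingFactor hlam hα hs ha2).mono_set Ioc_subset_Ioi_self)
  have h1 : HasDerivAt (fun x => ∫ τ in (a / 2)..x, (1 - fadingFactor lam α N s τ))
      (1 - fadingFactor lam α N s a) a :=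
    intervalIntegral.integral_hasDerivAt_right hI
      ((measurable_const.sub measurable_fadingFactor).stronglyMeasurable.stronglyMeasurableAtFilter)
      (continuousAt_const.sub (continuousAt_fadingFactor hlam hs ha))
  have h2 : tailLaplace lam α N s =ᶠ[𝓝 a] fun x => Real.exp
      ((∫ τ in (a / 2)..x, (1 - fadingFactor lam α N s τ)) -
        ∫ τ in Ioi (a / 2), (1 - fadingFactor lam α N s τ)) := by
    filter_upwards [lt_mem_nhds (show a / 2 < a by linarith)] with x hx
    rw [tailLaplace_eq_exp hlam hα hN hs (ha2.trans hx),
      ← intervalIntegral.integral_Ioi_sub_Ioi (integrableOn_one_sub_fadingFactor hlam hα hs ha2)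
        hx.le]
    congr 1
    ring
  have h3 := ((h1.sub_const
    (∫ τ in Ioi (a / 2), (1 - fadingFactor lam α N s τ))).exp).congr_of_eventuallyEq h2
  rw [h2.eq_of_nhds]
  convert! h3 using 1
  ring

lemma measurable_tailLaplace (hlam : 0 < lam) (hα : 2 < α) (hN : 1 ≤ N) (hs : 0 ≤ s) :
    Measurable (tailLaplace lam α N s) := by
  classical
  have h1 : ContinuousOn (tailLaplace lam α N s) (Ioi 0) := fun a ha =>
    (hasDerivAt_tailLaplace hlam hα hN hs ha).continuousAt.continuousWithinAt
  have h2 := h1.measurable_piecewise (g := fun _ => 1) continuousOn_const measurableSet_Ioi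
  convert! h2 using 1
  ext a
  -- for `a ≤ 0` the square root vanishes, hence so does the exponent
  by_cases ha : a ∈ Ioi (0 : ℝ)
  · rw [piecewise_eq_of_mem _ _ _ ha]
  · have h0 : Real.sqrt (a / (lam * Real.pi)) = 0 :=
      Real.sqrt_eq_zero_of_nonpos (div_nonpos_of_nonpos_of_nonneg (not_lt.1 ha) (by positivity))
    rw [piecewise_eq_of_notMem _ _ _ ha, tailLaplace, h0, interferenceLaplace]
    simp

lemma tendsto_tailLaplace (hlam : 0 < lam) (hα : 2 < α) (hN : 1 ≤ N) (hs : 0 ≤ s) :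
    Tendsto (tailLaplace lam α N s) atTop (𝓝 1) := by
  have h1 := intervalIntegral_tendsto_integral_Ioi 1
    (integrableOn_one_sub_fadingFactor (N := N) hlam hα hs one_pos) tendsto_id
  have h2 : tailLaplace lam α N s =ᶠ[atTop] fun x => Real.exp
      ((∫ τ in (1 : ℝ)..x, (1 - fadingFactor lam α N s τ)) -
        ∫ τ in Ioi (1 : ℝ), (1 - fadingFactor lam α N s τ)) := by
    filter_upwards [eventually_ge_atTop 1] with x hx
    rw [tailLaplace_eq_exp hlam hα hN hs (one_pos.trans_le hx),
      ← intervalIntegral.integral_Ioi_sub_Ioi (integrableOn_one_sub_fadingFactor hlam hα hs one_pos)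
        hx]
    congr 1
    ring
  refine Tendsto.congr' h2.symm ?_
  have h3 := (h1.sub_const (∫ τ in Ioi (1 : ℝ), (1 - fadingFactor lam α N s τ))).rexp
  simpa using h3

lemma tailLaplace_zero_right (hlam : 0 < lam) (hα : 2 < α) (hN : 1 ≤ N) {a : ℝ} (ha : 0 < a) :
    tailLaplace lam α N 0 a = 1 := by
  rw [tailLaplace_eq_exp hlam hα hN le_rfl ha]
  simp [fadingFactor]

/-- The renewal equation: looking at the next point of a unit-rate Poisson process, at distance
`e` from the current position `a`, the Laplace functional picks up one fading factor. -/
lemma lintegral_fadingFactor_mul_tailLaplace (hlam : 0 < lam) (hα : 2 < α) (hN : 1 ≤ N)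
    (hs : 0 ≤ s) {a : ℝ} (ha : 0 < a) :
    ∫⁻ e, ENNReal.ofReal (fadingFactor lam α N s (a + e) * tailLaplace lam α N s (a + e))
      ∂(expMeasure 1) = ENNReal.ofReal (tailLaplace lam α N s a) := by
  have hderiv : ∀ e ∈ Ici (0 : ℝ), HasDerivAt
      (fun e => -(Real.exp (-e) * tailLaplace lam α N s (a + e)))
      (Real.exp (-e) * (fadingFactor lam α N s (a + e) * tailLaplace lam α N s (a + e))) e := by
    intro e he
    have hae : 0 < a + e := by have : (0 : ℝ) ≤ e := he; linarith
    have h1 := (hasDerivAt_tailLaplace hlam hα hN hs hae).comp_const_add a e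
    have h2 : HasDerivAt (fun e : ℝ => Real.exp (-e)) (-Real.exp (-e)) e := by
      simpa using (hasDerivAt_neg e).exp
    convert! (h2.mul h1).neg using 1
    ring
  have hnn : ∀ e ∈ Ioi (0 : ℝ), 0 ≤ Real.exp (-e) *
      (fadingFactor lam α N s (a + e) * tailLaplace lam α N s (a + e)) := by
    intro e he
    have hae : 0 < a + e := by have : (0 : ℝ) < e := he; linarith
    have := (fadingFactor_mem (α := α) (N := N) hlam hs hae.le).1.le
    have := (tailLaplace_mem hlam hα hN hs hae).1.le
    positivity
  have hlim : Tendsto (fun e => -(Real.exp (-e) * tailLaplace lam α N s (a + e))) atTop (𝓝 0) := by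
    have h1 : Tendsto (fun e => tailLaplace lam α N s (a + e)) atTop (𝓝 1) :=
      (tendsto_tailLaplace hlam hα hN hs).comp (tendsto_atTop_add_const_left _ a tendsto_id)
    simpa using ((Real.tendsto_exp_neg_atTop_nhds_zero).mul h1).neg
  have hint := integrableOn_Ioi_deriv_of_nonneg' hderiv hnn hlim
  have hval := integral_Ioi_of_hasDerivAt_of_tendsto' hderiv hint hlim
  rw [lintegral_expMeasure_one (by
    exact ((measurable_fadingFactor.comp (measurable_const_add a)).mul
      ((measurable_tailLaplace hlam hα hN hs).comp (measurable_const_add a))).ennreal_ofReal)]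
  have h3 : ∀ e : ℝ, ENNReal.ofReal (Real.exp (-e)) * ENNReal.ofReal
      (fadingFactor lam α N s (a + e) * tailLaplace lam α N s (a + e)) = ENNReal.ofReal
      (Real.exp (-e) * (fadingFactor lam α N s (a + e) * tailLaplace lam α N s (a + e))) :=
    fun e => (ENNReal.ofReal_mul (Real.exp_pos _).le).symm
  simp_rw [h3]
  rw [← ofReal_integral_eq_lintegral_ofReal hint
    ((ae_restrict_iff' measurableSet_Ioi).2 (Eventually.of_forall hnn)), hval]
  simp

end

/-! ### Arrival times of a unit-rate Poisson process -/

/-- `U 0 ≤ U 1 ≤ …` are the points, in increasing order, of a unit-rate Poisson process on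
`[0, ∞)`, and `C B` is the number of points in `B`. Only the consequences of the Poisson law of the
counts that determine the law of `U` are recorded. -/
structure IsPoissonArrivals {Ω : Type*} [MeasurableSpace Ω] (U : ℕ → Ω → ℝ)
    (C : Set ℝ → Ω → ℕ∞) (μ : Measure Ω) : Prop where
  measurable : ∀ i, Measurable (U i)
  nonneg : ∀ i ω, 0 ≤ U i ω
  monotone : ∀ᵐ ω ∂μ, Monotone fun i => U i ω
  measurable_count : ∀ B, MeasurableSet B → Measurable (C B)
  count_eq : ∀ᵐ ω ∂μ, ∀ B, C B ω = {i | U i ω ∈ B}.encard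
  count_Iic_eq_zero : ∀ t, 0 ≤ t → μ {ω | C (Iic t) ω = 0} = ENNReal.ofReal (Real.exp (-t))
  count_Ioc_eq_zero : ∀ a t, 0 ≤ a → 0 ≤ t →
    μ {ω | C (Ioc a (a + t)) ω = 0} = ENNReal.ofReal (Real.exp (-t))
  two_le_count_Ioc : ∀ a t, 0 ≤ a → 0 ≤ t →
    μ {ω | 2 ≤ C (Ioc a (a + t)) ω} ≤ ENNReal.ofReal (t ^ 2)
  count_Iic_ne_top : ∀ t, 0 ≤ t → ∀ᵐ ω ∂μ, C (Iic t) ω ≠ ⊤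
  indep_count : ∀ (n : ℕ) (B : Fin n → Set ℝ), (∀ i, MeasurableSet (B i)) →
    Pairwise (fun i j => Disjoint (B i) (B j)) → iIndepFun (fun i ω => C (B i) ω) μ

namespace IsPoissonArrivals

variable {Ω : Type*} [MeasurableSpace Ω] {U : ℕ → Ω → ℝ} {C : Set ℝ → Ω → ℕ∞} {μ : Measure Ω}

lemma indep_count_fintype (h : IsPoissonArrivals U C μ) {κ : Type*} [Fintype κ] (B : κ → Set ℝ)
    (hB : ∀ i, MeasurableSet (B i)) (hd : Pairwise (fun i j => Disjoint (B i) (B j))) :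
    iIndepFun (fun i ω => C (B i) ω) μ := by
  have e := Fintype.equivFin κ
  have h1 := (h.indep_count _ (fun j => B (e.symm j)) (fun j => hB _)
    (fun i j hij => hd (e.symm.injective.ne hij))).precomp e.injective
  simpa using h1

/-- The cells of the partition of `(-∞, s]` generated by the half-lines `(-∞, u i]`; they are
indexed by the sets of half-lines that contain them, so no sorting of the `u i` is needed. -/
def cell {n : ℕ} (u : Fin n → ℝ) (s : ℝ) (b : Finset (Fin n)) : Set ℝ :=
  {x | x ≤ s ∧ ∀ i, x ≤ u i ↔ i ∈ b}

lemma measurableSet_cell {n : ℕ} (u : Fin n → ℝ) (s : ℝ) (b : Finset (Fin n)) :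
    MeasurableSet (cell u s b) := by
  have : cell u s b = Iic s ∩ ⋂ i, {x | x ≤ u i ↔ i ∈ b} := by ext x; simp [cell]
  rw [this]
  refine measurableSet_Iic.inter (MeasurableSet.iInter fun i => ?_)
  by_cases hi : i ∈ b
  · have : {x : ℝ | x ≤ u i ↔ i ∈ b} = Iic (u i) := by ext x; simp [hi]
    exact this ▸ measurableSet_Iic
  · have : {x : ℝ | x ≤ u i ↔ i ∈ b} = Ioi (u i) := by ext x; simp [hi]
    exact this ▸ measurableSet_Ioi

lemma disjoint_cell {n : ℕ} (u : Fin n → ℝ) (s : ℝ) {b b' : Finset (Fin n)} (hb : b ≠ b') :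
    Disjoint (cell u s b) (cell u s b') := by
  refine Set.disjoint_left.2 fun x hx hx' => hb ?_
  ext i
  rw [← hx.2 i, hx'.2 i]

/-- A set cut out of `(-∞, s]` by conditions on the half-lines `(-∞, u i]` is a disjoint union of
cells, so the count in it is the sum of their counts. -/
lemma encard_inter_Iic_eq_sum_cell {n : ℕ} (u : Fin n → ℝ) (s : ℝ) (P : Finset (Fin n) → Prop)
    [DecidablePred P] (x : ℕ → ℝ) :
    {i | x i ≤ s ∧ P (Finset.univ.filter fun j => x i ≤ u j)}.encard =
      ∑ b, if P b then {i | x i ∈ cell u s b}.encard else 0 := by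
  have h1 : {i | x i ≤ s ∧ P (Finset.univ.filter fun j => x i ≤ u j)} =
      ⋃ b : Finset (Fin n), (if P b then {i | x i ∈ cell u s b} else ∅) := by
    ext i
    simp only [mem_ofPred_eq, mem_iUnion]
    constructor
    · rintro ⟨h1, h2⟩
      refine ⟨Finset.univ.filter fun j => x i ≤ u j, ?_⟩
      rw [if_pos h2]
      exact ⟨h1, fun j => by simp⟩
    · rintro ⟨b, hb⟩
      by_cases hP : P b
      · rw [if_pos hP] at hb
        refine ⟨hb.1, ?_⟩
        convert hP
        ext j
        simp [hb.2 j]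
      · simp [hP] at hb
  rw [h1, encard_iUnion_of_finite, finsum_eq_sum_of_fintype]
  · refine Finset.sum_congr rfl fun b _ => ?_
    split_ifs <;> simp
  · intro b b' hb
    simp only [Function.onFun]
    split_ifs
    · exact Set.disjoint_left.2 fun i hi hi' => Set.disjoint_left.1 (disjoint_cell u s hb) hi hi'
    all_goals simp

/-- The `i`-th point of a monotone sequence lies beyond `t` if and only if at most `i` points do
not. -/
lemma lt_iff_encard_le {x : ℕ → ℝ} (hx : Monotone x) (i : ℕ) (t : ℝ) :
    t < x i ↔ {j | x j ≤ t}.encard ≤ i := by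
  constructor
  · intro h
    have hsub : {j | x j ≤ t} ⊆ Iio i := fun j hj =>
      lt_of_not_ge fun hij => absurd ((hx hij).trans hj) (not_le.2 h)
    refine (encard_le_encard hsub).trans ?_
    rw [← Finset.coe_Iio, encard_coe_eq_coe_finsetCard]
    simp
  · intro h
    by_contra hle
    have hsub : Iic i ⊆ {j | x j ≤ t} := fun j hj => (hx hj).trans (not_lt.1 hle)
    have h2 := (encard_le_encard hsub).trans h
    rw [← Finset.coe_Iic, encard_coe_eq_coe_finsetCard] at h2
    rw [Nat.card_Iic] at h2
    norm_cast at h2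
    omega

/-- What happens up to `s` is independent of the number of points in `(s, s + t]`. -/
lemma measure_past_inter_future (h : IsPoissonArrivals U C μ) (n : ℕ) (u : Fin (n + 1) → ℝ)
    {s t : ℝ} (hs : 0 ≤ s) (ht : 0 ≤ t) :
    μ ({ω | (∀ i : Fin (n + 1), u i < U i ω) ∧ U n ω ≤ s} ∩
        {ω | ∀ i, U i ω ∉ Ioc s (s + t)}) =
      μ {ω | (∀ i : Fin (n + 1), u i < U i ω) ∧ U n ω ≤ s} * ENNReal.ofReal (Real.exp (-t)) := by
  classical
  let B : Option (Finset (Fin (n + 1))) → Set ℝ := fun o =>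
    o.elim (Ioc s (s + t)) (fun b => cell u s b)
  have hBm : ∀ o, MeasurableSet (B o) := by
    rintro (_ | b)
    · exact measurableSet_Ioc
    · exact measurableSet_cell u s b
  have hBd : Pairwise fun o o' => Disjoint (B o) (B o') := by
    rintro (_ | b) (_ | b') hne
    · exact absurd rfl hne
    · exact Set.disjoint_left.2 fun x hx hx' => absurd hx'.1 (not_le.2 hx.1)
    · exact Set.disjoint_left.2 fun x hx hx' => absurd hx.1 (not_le.2 hx'.1)
    · exact disjoint_cell u s fun hbb => hne (by rw [hbb])
  have hind := h.indep_count_fintype B hBm hBd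
  let S : Finset (Option (Finset (Fin (n + 1)))) := Finset.univ.erase none
  have hdisj : Disjoint S {none} := by simp [S]
  have hind2 := hind.indepFun_finset S {none} hdisj (fun o => h.measurable_count _ (hBm o))
  let ι' (b : Finset (Fin (n + 1))) : S := ⟨some b, by simp [S]⟩
  let past : Set (S → ℕ∞) := {c | (∀ i : Fin (n + 1),
      (∑ b, if i ∈ b then c (ι' b) else 0) ≤ (i : ℕ)) ∧ ((n + 1 : ℕ) : ℕ∞) ≤ ∑ b, c (ι' b)}
  let fut : Set ((({none} : Finset (Option (Finset (Fin (n + 1)))))) → ℕ∞) :=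
    {c | c ⟨none, by simp⟩ = 0}
  have hpast : MeasurableSet past := past.to_countable.measurableSet
  have hfut : MeasurableSet fut := fut.to_countable.measurableSet
  have hmul := hind2.measure_inter_preimage_eq_mul past fut hpast hfut
  have e1 : {ω | (∀ i : Fin (n + 1), u i < U i ω) ∧ U n ω ≤ s} =ᵐ[μ]
      (fun a (o : S) => C (B o) a) ⁻¹' past := by
    filter_upwards [h.monotone, h.count_eq] with ω hmono hC
    apply propext
    change ((∀ i : Fin (n + 1), u i < U i ω) ∧ U n ω ≤ s) ↔
      ((∀ i : Fin (n + 1), (∑ b, if i ∈ b then C (cell u s b) ω else 0) ≤ (i : ℕ)) ∧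
        ((n + 1 : ℕ) : ℕ∞) ≤ ∑ b, C (cell u s b) ω)
    simp only [hC]
    have key : ∀ i : Fin (n + 1), (∑ b, if i ∈ b then {j | U j ω ∈ cell u s b}.encard else 0) =
        {j | U j ω ≤ min s (u i)}.encard := by
      intro i
      rw [← encard_inter_Iic_eq_sum_cell u s (fun b => i ∈ b) (fun j => U j ω)]
      simp
    have key2 : (∑ b, {j | U j ω ∈ cell u s b}.encard) = {j | U j ω ≤ s}.encard := by
      have := encard_inter_Iic_eq_sum_cell u s (fun _ => True) (fun j => U j ω)
      simpa using this.symm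
    simp only [key, key2]
    have hn : U n ω ≤ s ↔ ((n + 1 : ℕ) : ℕ∞) ≤ {j | U j ω ≤ s}.encard := by
      rw [← not_lt, lt_iff_encard_le hmono n s, not_le, Nat.cast_add, Nat.cast_one,
        ENat.add_one_le_iff (ENat.natCast_ne_top n)]
    rw [← hn]
    refine and_congr_left fun hns => forall_congr' fun i => ?_
    rw [← lt_iff_encard_le hmono]
    have his : U i ω ≤ s := (hmono (Nat.lt_succ_iff.1 i.2)).trans hns
    exact ⟨fun hi => (min_le_right _ _).trans_lt hi, fun hi => by
      rcases min_lt_iff.1 hi with h1 | h1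
      · exact absurd his (not_le.2 h1)
      · exact h1⟩
  have e2 : {ω | ∀ i, U i ω ∉ Ioc s (s + t)} =ᵐ[μ]
      (fun a (o : ({none} : Finset (Option (Finset (Fin (n + 1)))))) => C (B o) a) ⁻¹' fut := by
    filter_upwards [h.count_eq] with ω hC
    apply propext
    change (∀ i, U i ω ∉ Ioc s (s + t)) ↔ C (Ioc s (s + t)) ω = 0
    rw [hC, encard_eq_zero, eq_empty_iff_forall_notMem]
    rfl
  have e3 : μ ((fun a (o : ({none} : Finset (Option (Finset (Fin (n + 1)))))) => C (B o) a) ⁻¹' fut)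
      = ENNReal.ofReal (Real.exp (-t)) := h.count_Ioc_eq_zero s t hs ht
  rw [measure_congr (e1.inter e2), hmul, measure_congr e1, e3]

lemma measurableSet_forall_lt (h : IsPoissonArrivals U C μ) {n : ℕ} (u : Fin n → ℝ) :
    MeasurableSet {ω | ∀ i : Fin n, u i < U i ω} := by
  have : {ω | ∀ i : Fin n, u i < U i ω} = ⋂ i : Fin n, {ω | u i < U i ω} := by ext; simp
  rw [this]
  exact MeasurableSet.iInter fun i => measurableSet_lt measurable_const (h.measurable _)

lemma ae_forall_pos [IsProbabilityMeasure μ] (h : IsPoissonArrivals U C μ) :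
    ∀ᵐ ω ∂μ, ∀ i, 0 < U i ω := by
  have h1 : ∀ᵐ ω ∂μ, C (Iic 0) ω = 0 := by
    rw [ae_iff_measure_eq (measurableSet_eq_fun (h.measurable_count _ measurableSet_Iic)
      measurable_const).nullMeasurableSet, h.count_Iic_eq_zero 0 le_rfl]
    simp
  filter_upwards [h1, h.count_eq] with ω h0 hC i
  rw [hC, encard_eq_zero] at h0
  by_contra hi
  exact (eq_empty_iff_forall_notMem.1 h0) i (not_lt.1 hi)

/-- No two points coincide: on a grid of mesh `ε`, two coinciding points before `T` fall into one
of `T / ε` cells, each of which holds two points with probability at most `ε ^ 2`. -/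
lemma ae_lt_succ [IsProbabilityMeasure μ] (h : IsPoissonArrivals U C μ) (n : ℕ) :
    ∀ᵐ ω ∂μ, U n ω < U (n + 1) ω := by
  have key : ∀ T : ℕ, ∀ᵐ ω ∂μ, ¬ (U n ω = U (n + 1) ω ∧ U n ω ≤ T) := by
    intro T
    have hle : ∀ K : ℕ, μ {ω | U n ω = U (n + 1) ω ∧ U n ω ≤ T} ≤
        ENNReal.ofReal (T / ((K : ℝ) + 1)) := by
      intro K
      have hK : (0 : ℝ) < (K : ℝ) + 1 := by positivity
      calc μ {ω | U n ω = U (n + 1) ω ∧ U n ω ≤ T}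
          ≤ μ (⋃ l ∈ Finset.range (T * (K + 1)), {ω | 2 ≤ C (Ioc ((l : ℝ) / ((K : ℝ) + 1))
              ((l : ℝ) / ((K : ℝ) + 1) + 1 / ((K : ℝ) + 1))) ω}) := by
            refine measure_mono_ae ?_
            filter_upwards [h.ae_forall_pos, h.count_eq] with ω hpos hC
            rintro ⟨heq, hT⟩
            have h1 : 0 < U n ω * ((K : ℝ) + 1) := mul_pos (hpos n) hK
            obtain ⟨l, hl⟩ := Nat.exists_eq_add_of_le' (Nat.ceil_pos.2 h1)
            have h2 : (l : ℝ) < U n ω * ((K : ℝ) + 1) := Nat.lt_ceil.1 (by omega)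
            have h3 : U n ω * ((K : ℝ) + 1) ≤ (l : ℝ) + 1 := by
              have := Nat.le_ceil (U n ω * ((K : ℝ) + 1))
              rw [hl] at this
              exact_mod_cast this
            have h4 : l < T * (K + 1) := by
              have : ⌈U n ω * ((K : ℝ) + 1)⌉₊ ≤ T * (K + 1) := by
                refine Nat.ceil_le.2 ?_
                push_cast
                gcongr
              omega
            refine mem_iUnion₂.2 ⟨l, Finset.mem_range.2 h4, ?_⟩
            have hmem : U n ω ∈ Ioc ((l : ℝ) / ((K : ℝ) + 1))
                ((l : ℝ) / ((K : ℝ) + 1) + 1 / ((K : ℝ) + 1)) := by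
              rw [← add_div]
              exact ⟨(div_lt_iff₀ hK).2 h2, (le_div_iff₀ hK).2 h3⟩
            change 2 ≤ C _ ω
            rw [hC, ← encard_pair (Nat.succ_ne_self n).symm]
            refine encard_le_encard ?_
            rintro i (rfl | rfl)
            · exact hmem
            · rw [heq] at hmem
              exact hmem
        _ ≤ ∑ l ∈ Finset.range (T * (K + 1)), μ {ω | 2 ≤ C (Ioc ((l : ℝ) / ((K : ℝ) + 1))
              ((l : ℝ) / ((K : ℝ) + 1) + 1 / ((K : ℝ) + 1))) ω} := measure_biUnion_finset_le _ _
        _ ≤ ∑ l ∈ Finset.range (T * (K + 1)), ENNReal.ofReal ((1 / ((K : ℝ) + 1)) ^ 2) :=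
            Finset.sum_le_sum fun l _ => h.two_le_count_Ioc _ _ (by positivity) (by positivity)
        _ = ENNReal.ofReal (T / ((K : ℝ) + 1)) := by
            rw [← ENNReal.ofReal_sum_of_nonneg (fun _ _ => by positivity), Finset.sum_const,
              Finset.card_range, nsmul_eq_mul]
            congr 1
            push_cast
            field_simp
    have hlim : Tendsto (fun K : ℕ => ENNReal.ofReal (T / ((K : ℝ) + 1))) atTop (𝓝 0) := by
      have h1 : Tendsto (fun K : ℕ => (T : ℝ) / ((K : ℝ) + 1)) atTop (𝓝 0) :=
        tendsto_const_nhds.div_atTop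
          (tendsto_atTop_add_const_right _ _ tendsto_natCast_atTop_atTop)
      simpa using ENNReal.tendsto_ofReal h1
    have h0 := le_antisymm (ge_of_tendsto' hlim hle) (zero_le)
    rw [ae_iff]
    simpa using h0
  filter_upwards [ae_all_iff.2 key, h.monotone] with ω hT hmono
  refine lt_of_le_of_ne (hmono n.le_succ) fun heq => ?_
  obtain ⟨T, hT'⟩ := exists_nat_ge (U n ω)
  exact hT T ⟨heq, hT'⟩

/-- After the time `U n`, rounded up to a grid of mesh `ε`, the process starts afresh. -/
lemma measure_inter_future_grid (h : IsPoissonArrivals U C μ) (n : ℕ) (u : Fin (n + 1) → ℝ)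
    {ε t : ℝ} (hε : 0 < ε) (ht : 0 ≤ t) :
    μ ({ω | ∀ i : Fin (n + 1), u i < U i ω} ∩
        {ω | ∀ i, U i ω ∉ Ioc (⌈U n ω / ε⌉₊ * ε) (⌈U n ω / ε⌉₊ * ε + t)}) =
      μ {ω | ∀ i : Fin (n + 1), u i < U i ω} * ENNReal.ofReal (Real.exp (-t)) := by
  set A := {ω | ∀ i : Fin (n + 1), u i < U i ω} with hA
  set E := {ω | ∀ i, U i ω ∉ Ioc (⌈U n ω / ε⌉₊ * ε) (⌈U n ω / ε⌉₊ * ε + t)} with hE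
  have hAm : MeasurableSet A := h.measurableSet_forall_lt u
  have hceil : Measurable fun ω => ⌈U n ω / ε⌉₊ :=
    Nat.measurable_ceil.comp ((h.measurable n).div_const ε)
  have hD : Measurable fun ω => (⌈U n ω / ε⌉₊ : ℝ) * ε :=
    ((measurable_of_countable (fun k : ℕ => (k : ℝ))).comp hceil).mul_const ε
  have hEm : MeasurableSet E := by
    have : E = ⋂ i, ({ω | ⌈U n ω / ε⌉₊ * ε < U i ω} ∩ {ω | U i ω ≤ ⌈U n ω / ε⌉₊ * ε + t})ᶜ := by
      ext; simp [hE]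
    rw [this]
    exact MeasurableSet.iInter fun i => ((measurableSet_lt hD (h.measurable i)).inter
      (measurableSet_le (h.measurable i) (hD.add_const t))).compl
  have hsplit : ∀ S : Set Ω, MeasurableSet S →
      μ S = ∑' l : ℕ, μ (S ∩ {ω | ⌈U n ω / ε⌉₊ = l}) := by
    intro S hS
    rw [← measure_iUnion]
    · congr 1
      ext ω
      simp
    · intro l l' hl
      refine Set.disjoint_left.2 fun ω hω hω' => hl (hω.2.symm.trans hω'.2)
    · exact fun l => hS.inter (hceil (measurableSet_singleton l))
  rw [hsplit _ (hAm.inter hEm), hsplit _ hAm, ← ENNReal.tsum_mul_right]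
  refine tsum_congr fun l => ?_
  -- On `⌈U n / ε⌉₊ = l` the last constraint is tightened to `(l - 1) * ε < U n ≤ l * ε`.
  let u' : Fin (n + 1) → ℝ := fun i => if i = Fin.last n then max (u i) ((l - 1) * ε) else u i
  have hcell : A ∩ {ω | ⌈U n ω / ε⌉₊ = l} =
      {ω | (∀ i : Fin (n + 1), u' i < U i ω) ∧ U n ω ≤ l * ε} := by
    ext ω
    have h0 := h.nonneg n ω
    have hl : ⌈U n ω / ε⌉₊ = l ↔ (l - 1) * ε < U n ω ∧ U n ω ≤ l * ε := by
      constructor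
      · rintro rfl
        constructor
        · have := Nat.ceil_lt_add_one (div_nonneg h0 hε.le)
          rw [← lt_div_iff₀ hε]
          linarith
        · have := Nat.le_ceil (U n ω / ε)
          rwa [div_le_iff₀ hε] at this
      · rintro ⟨h1, h2⟩
        refine le_antisymm (Nat.ceil_le.2 ((div_le_iff₀ hε).2 h2)) ?_
        by_contra hlt
        have h3 : ⌈U n ω / ε⌉₊ + 1 ≤ l := by omega
        have h4 : ((⌈U n ω / ε⌉₊ + 1 : ℕ) : ℝ) ≤ l := by exact_mod_cast h3
        push_cast at h4
        have h5 := Nat.le_ceil (U n ω / ε)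
        rw [div_le_iff₀ hε] at h5
        nlinarith
    simp only [hA, mem_inter_iff, mem_ofPred_eq, hl]
    constructor
    · rintro ⟨h1, h2, h3⟩
      refine ⟨fun i => ?_, h3⟩
      by_cases hi : i = Fin.last n
      · subst hi
        simp only [u', if_true]
        exact max_lt (h1 _) h2
      · simpa [u', hi] using h1 i
    · rintro ⟨h1, h3⟩
      refine ⟨fun i => ?_, ?_, h3⟩
      · have := h1 i
        by_cases hi : i = Fin.last n
        · simp only [u', hi, if_true] at this ⊢
          exact (le_max_left _ _).trans_lt this
        · simpa [u', hi] using this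
      · have := h1 (Fin.last n)
        simp only [u', if_true] at this
        exact (le_max_right _ _).trans_lt this
  have hcell2 : A ∩ E ∩ {ω | ⌈U n ω / ε⌉₊ = l} =
      {ω | (∀ i : Fin (n + 1), u' i < U i ω) ∧ U n ω ≤ l * ε} ∩
        {ω | ∀ i, U i ω ∉ Ioc (l * ε) (l * ε + t)} := by
    rw [← hcell, inter_right_comm]
    ext ω
    simp only [hE, mem_inter_iff, mem_ofPred_eq]
    refine and_congr_right fun hω => ?_
    rw [hω.2]
  rw [hcell2, hcell, h.measure_past_inter_future n u' (by positivity) ht]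

/-- The gap after `U n` is exponential and independent of the past, in terms of the events that
generate the two `σ`-algebras: the limit of a grid of mesh `ε → 0`, for which the grid point after
`U n` eventually lies before `U (n + 1)`. -/
lemma measure_inter_gap [IsProbabilityMeasure μ] (h : IsPoissonArrivals U C μ) (n : ℕ)
    (u : Fin (n + 1) → ℝ) {t : ℝ} (ht : 0 ≤ t) :
    μ ({ω | ∀ i : Fin (n + 1), u i < U i ω} ∩ {ω | t < U (n + 1) ω - U n ω}) =
      μ {ω | ∀ i : Fin (n + 1), u i < U i ω} * ENNReal.ofReal (Real.exp (-t)) := by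
  have hAm := h.measurableSet_forall_lt u
  let ε : ℕ → ℝ := fun K => 1 / ((K : ℝ) + 1)
  have hε : ∀ K, 0 < ε K := fun K => by positivity
  have hεlim : Tendsto ε atTop (𝓝 0) := tendsto_one_div_add_atTop_nhds_zero_nat
  have hD : ∀ K, Measurable fun ω => (⌈U n ω / ε K⌉₊ : ℝ) * ε K := fun K =>
    ((measurable_of_countable (fun k : ℕ => (k : ℝ))).comp
      (Nat.measurable_ceil.comp ((h.measurable n).div_const _))).mul_const _
  have hlim := tendsto_measure_of_ae_tendsto_indicator_of_isFiniteMeasure atTop (μ := μ)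
    (A := {ω | ∀ i : Fin (n + 1), u i < U i ω} ∩ {ω | t < U (n + 1) ω - U n ω})
    (As := fun K => {ω | ∀ i : Fin (n + 1), u i < U i ω} ∩
      {ω | ∀ i, U i ω ∉ Ioc (⌈U n ω / ε K⌉₊ * ε K) (⌈U n ω / ε K⌉₊ * ε K + t)})
    (hAm.inter (measurableSet_lt measurable_const ((h.measurable _).sub (h.measurable _))))
    (fun K => hAm.inter (by
      have : {ω | ∀ i, U i ω ∉ Ioc (⌈U n ω / ε K⌉₊ * ε K) (⌈U n ω / ε K⌉₊ * ε K + t)} =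
          ⋂ i, ({ω | ⌈U n ω / ε K⌉₊ * ε K < U i ω} ∩ {ω | U i ω ≤ ⌈U n ω / ε K⌉₊ * ε K + t})ᶜ := by
        ext; simp
      rw [this]
      exact MeasurableSet.iInter fun i => ((measurableSet_lt (hD K) (h.measurable i)).inter
        (measurableSet_le (h.measurable i) ((hD K).add_const t))).compl)) ?_
  · simp_rw [fun K => h.measure_inter_future_grid n u (hε K) ht] at hlim
    exact (tendsto_nhds_unique hlim tendsto_const_nhds)
  filter_upwards [h.monotone, h.ae_lt_succ n] with ω hmono hlt
  have hlow : ∀ K, U n ω ≤ ⌈U n ω / ε K⌉₊ * ε K := fun K =>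
    (div_le_iff₀ (hε K)).1 (Nat.le_ceil _)
  have hup : ∀ K, ⌈U n ω / ε K⌉₊ * ε K < U n ω + ε K := by
    intro K
    have := Nat.ceil_lt_add_one (div_nonneg (h.nonneg n ω) (hε K).le)
    have h2 := mul_lt_mul_of_pos_right this (hε K)
    rwa [add_mul, div_mul_cancel₀ _ (hε K).ne', one_mul] at h2
  rcases lt_or_ge t (U (n + 1) ω - U n ω) with hgt | hle
  · filter_upwards [hεlim.eventually_lt_const
      (show 0 < U (n + 1) ω - U n ω - t by linarith)] with K hK
    refine and_congr_right fun _ => iff_of_true (fun i hi => ?_) hgt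
    rcases Nat.lt_or_ge n i with hni | hni
    · have := hmono (Nat.succ_le_of_lt hni)
      have h2 := hi.2
      have h3 := hup K
      simp only [Nat.succ_eq_add_one] at this
      linarith
    · exact absurd hi.1 (not_lt.2 ((hmono hni).trans (hlow K)))
  · filter_upwards [hεlim.eventually_lt_const
      (show 0 < U (n + 1) ω - U n ω by linarith)] with K hK
    refine and_congr_right fun _ => iff_of_false (fun hall => hall (n + 1) ⟨?_, ?_⟩)
      (not_lt.2 hle)
    · linarith [hup K]
    · linarith [hlow K]

lemma measure_gap [IsProbabilityMeasure μ] (h : IsPoissonArrivals U C μ) (n : ℕ) {t : ℝ}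
    (ht : 0 ≤ t) : μ {ω | t < U (n + 1) ω - U n ω} = ENNReal.ofReal (Real.exp (-t)) := by
  have h1 : {ω | ∀ i : Fin (n + 1), (fun _ => (-1 : ℝ)) i < U i ω} = univ := by
    ext ω
    simp only [mem_ofPred_eq, mem_univ, iff_true]
    intro i
    linarith [h.nonneg i ω]
  have h2 := h.measure_inter_gap n (fun _ => -1) ht
  rwa [h1, univ_inter, measure_univ, one_mul] at h2

lemma eq_expMeasure_of_tail {ν : Measure ℝ} [IsProbabilityMeasure ν]
    (hν : ∀ t, 0 ≤ t → ν (Ioi t) = ENNReal.ofReal (Real.exp (-t))) : ν = expMeasure 1 := by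
  have := isProbabilityMeasure_expMeasure one_pos
  refine Measure.eq_of_cdf _ _ (StieltjesFunction.ext fun x => ?_)
  rw [cdf_expMeasure_eq one_pos, cdf_eq_real]
  have h1 : ∀ t, 0 ≤ t → ν.real (Iic t) = 1 - Real.exp (-t) := by
    intro t ht
    rw [← compl_Ioi, probReal_compl_eq_one_sub measurableSet_Ioi, measureReal_def, hν t ht,
      ENNReal.toReal_ofReal (Real.exp_pos _).le]
  split_ifs with hx
  · rw [h1 x hx, one_mul]
  · refine le_antisymm ?_ measureReal_nonneg
    calc ν.real (Iic x) ≤ ν.real (Iic 0) :=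
          measureReal_mono (Iic_subset_Iic.2 (not_le.1 hx).le)
      _ = 0 := by rw [h1 0 le_rfl]; simp

lemma hasLaw_zero [IsProbabilityMeasure μ] (h : IsPoissonArrivals U C μ) :
    HasLaw (U 0) (expMeasure 1) μ := by
  refine ⟨(h.measurable 0).aemeasurable, ?_⟩
  have := Measure.isProbabilityMeasure_map (μ := μ) (h.measurable 0).aemeasurable
  refine eq_expMeasure_of_tail fun t ht => ?_
  rw [Measure.map_apply (h.measurable 0) measurableSet_Ioi, ← h.count_Iic_eq_zero t ht]
  refine measure_congr ?_
  filter_upwards [h.monotone, h.count_eq] with ω hmono hC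
  apply propext
  change t < U 0 ω ↔ C (Iic t) ω = 0
  rw [lt_iff_encard_le hmono, hC]
  simp

lemma hasLaw_gap [IsProbabilityMeasure μ] (h : IsPoissonArrivals U C μ) (n : ℕ) :
    HasLaw (fun ω => U (n + 1) ω - U n ω) (expMeasure 1) μ := by
  have hm : Measurable fun ω => U (n + 1) ω - U n ω := (h.measurable _).sub (h.measurable _)
  refine ⟨hm.aemeasurable, ?_⟩
  have := Measure.isProbabilityMeasure_map (μ := μ) hm.aemeasurable
  refine eq_expMeasure_of_tail fun t ht => ?_
  rw [Measure.map_apply hm measurableSet_Ioi]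
  exact h.measure_gap n ht

/-- The gap after `U n` is independent of the points up to `U n`. The events
`{∀ i ≤ n, u i < U i}` and `{t < U (n + 1) - U n}` form generating `π`-systems. -/
lemma indepFun_gap [IsProbabilityMeasure μ] (h : IsPoissonArrivals U C μ) (n : ℕ) :
    IndepFun (fun ω (i : Fin (n + 1)) => U i ω) (fun ω => U (n + 1) ω - U n ω) μ := by
  have hm : Measurable fun ω => U (n + 1) ω - U n ω := (h.measurable _).sub (h.measurable _)
  have hV : Measurable fun ω (i : Fin (n + 1)) => U i ω :=
    measurable_pi_iff.2 fun i => h.measurable i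
  let p1 : Set (Set Ω) := range fun u : Fin (n + 1) → ℝ => {ω | ∀ i : Fin (n + 1), u i < U i ω}
  let p2 : Set (Set Ω) := range fun t : ℝ => {ω | t < U (n + 1) ω - U n ω}
  have hpi1 : IsPiSystem p1 := by
    rintro _ ⟨u, rfl⟩ _ ⟨v, rfl⟩ _
    refine ⟨fun i => max (u i) (v i), ?_⟩
    ext ω
    simp [forall_and]
  have hpi2 : IsPiSystem p2 := by
    rintro _ ⟨u, rfl⟩ _ ⟨v, rfl⟩ _
    refine ⟨max u v, ?_⟩
    ext ω
    simp
  have hg1 : MeasurableSpace.comap (fun ω (i : Fin (n + 1)) => U i ω) inferInstance =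
      MeasurableSpace.generateFrom p1 := by
    refine le_antisymm ?_ (MeasurableSpace.generateFrom_le ?_)
    · rw [← measurable_iff_comap_le, @measurable_pi_iff]
      intro i
      refine @measurable_of_Ioi _ _ _ _ _ (MeasurableSpace.generateFrom p1) _ _ _ _ fun a => ?_
      refine MeasurableSpace.measurableSet_generateFrom ⟨fun j => if j = i then a else -1, ?_⟩
      ext ω
      simp only [mem_ofPred_eq, mem_preimage, mem_Ioi]
      constructor
      · intro hj
        simpa using hj i
      · intro ha j
        split_ifs with hji
        · rw [hji]; exact ha
        · linarith [h.nonneg j ω]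
    · rintro _ ⟨u, rfl⟩
      refine ⟨{v | ∀ i, u i < v i}, ?_, rfl⟩
      have : {v : Fin (n + 1) → ℝ | ∀ i, u i < v i} = ⋂ i, {v | u i < v i} := by ext; simp
      rw [this]
      exact MeasurableSet.iInter fun i => measurableSet_lt measurable_const (measurable_pi_apply i)
  have hg2 : MeasurableSpace.comap (fun ω => U (n + 1) ω - U n ω) inferInstance =
      MeasurableSpace.generateFrom p2 := by
    rw [show (inferInstance : MeasurableSpace ℝ) = borel ℝ from BorelSpace.measurable_eq,
      borel_eq_generateFrom_Ioi, MeasurableSpace.comap_generateFrom]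
    congr 1
    ext s
    constructor
    · rintro ⟨_, ⟨t, rfl⟩, rfl⟩
      exact ⟨t, rfl⟩
    · rintro ⟨t, rfl⟩
      exact ⟨_, ⟨t, rfl⟩, rfl⟩
  refine (IndepFun_iff_Indep _ _ _).2
    (IndepSets.indep hV.comap_le hm.comap_le hpi1 hpi2 hg1 hg2 ?_)
  rw [IndepSets_iff]
  rintro _ _ ⟨u, rfl⟩ ⟨t, rfl⟩
  rcases le_or_gt 0 t with ht | ht
  · rw [h.measure_gap n ht]
    exact h.measure_inter_gap n u ht
  · have h1 : {ω | t < U (n + 1) ω - U n ω} =ᵐ[μ] univ := by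
      filter_upwards [h.ae_lt_succ n] with ω hω
      exact propext ⟨fun _ => trivial, fun _ => by
        change t < U (n + 1) ω - U n ω
        linarith⟩
    have h2 := (ae_eq_refl {ω | ∀ i : Fin (n + 1), u i < U i ω} (μ := μ)).inter h1
    rw [measure_congr h2, measure_congr h1, inter_univ, measure_univ, mul_one]

lemma ae_tendsto_atTop (h : IsPoissonArrivals U C μ) :
    ∀ᵐ ω ∂μ, Tendsto (fun i => U i ω) atTop atTop := by
  filter_upwards [ae_all_iff.2 fun T : ℕ => h.count_Iic_ne_top T T.cast_nonneg, h.count_eq,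
    h.monotone] with ω hfin hC hmono
  refine tendsto_atTop_atTop_of_monotone hmono fun b => ?_
  obtain ⟨T, hT⟩ := exists_nat_ge b
  by_contra! hlt
  refine hfin T ?_
  rw [hC, encard_eq_top_iff]
  refine infinite_univ.mono fun i _ => ?_
  exact (hlt i).le.trans hT

end IsPoissonArrivals

/-! ### The areas swept by the base stations -/

lemma volume_areaPreimage_Iic {lam : ℝ} (hlam : 0 < lam) {t : ℝ} (ht : 0 ≤ t) :
    (ENNReal.ofReal lam • (volume : Measure (EuclideanSpace ℝ (Fin 2))))
      ((fun x => lam * Real.pi * ‖x‖ ^ 2) ⁻¹' Iic t) = ENNReal.ofReal t := by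
  have hc : 0 < lam * Real.pi := by positivity
  have h1 : (fun x : EuclideanSpace ℝ (Fin 2) => lam * Real.pi * ‖x‖ ^ 2) ⁻¹' Iic t =
      Metric.closedBall 0 (Real.sqrt (t / (lam * Real.pi))) := by
    ext x
    rw [mem_preimage, mem_Iic, mem_closedBall_zero_iff, Real.le_sqrt (norm_nonneg _) (by positivity),
      le_div_iff₀ hc, mul_comm]
  rw [h1, Measure.smul_apply, EuclideanSpace.volume_closedBall_fin_two, smul_eq_mul,
    ← ENNReal.ofReal_pow (Real.sqrt_nonneg _), Real.sq_sqrt (by positivity)]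
  rw [← ENNReal.ofReal_mul (by positivity), ← ENNReal.ofReal_mul hlam.le]
  congr 1
  field_simp

lemma volume_areaPreimage_Ioc {lam : ℝ} (hlam : 0 < lam) {a t : ℝ} (ha : 0 ≤ a) (ht : 0 ≤ t) :
    (ENNReal.ofReal lam • (volume : Measure (EuclideanSpace ℝ (Fin 2))))
      ((fun x => lam * Real.pi * ‖x‖ ^ 2) ⁻¹' Ioc a (a + t)) = ENNReal.ofReal t := by
  have hm : Measurable fun x : EuclideanSpace ℝ (Fin 2) => lam * Real.pi * ‖x‖ ^ 2 := by fun_prop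
  rw [← Iic_sdiff_Iic, preimage_sdiff, measure_sdiff
    (preimage_mono (Iic_subset_Iic.2 (by linarith))) (hm measurableSet_Iic).nullMeasurableSet,
    volume_areaPreimage_Iic hlam ha, volume_areaPreimage_Iic hlam (by positivity),
    ← ENNReal.ofReal_sub _ ha]
  · simp
  · rw [volume_areaPreimage_Iic hlam ha]
    exact ENNReal.ofReal_ne_top

section
variable {Ω : Type*} [MeasurableSpace Ω] {μ : Measure Ω} {N : Ω → ℕ∞} {r : ℝ≥0}

lemma measure_eq_of_hasLaw_poisson
    (hN : HasLaw N ((poissonMeasure r).map (fun n : ℕ => (n : ℕ∞))) μ) (hm : Measurable N)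
    (S : Set ℕ∞) : μ {ω | N ω ∈ S} = poissonMeasure r {n | (n : ℕ∞) ∈ S} := by
  have h1 := hN.map_eq
  have h2 : μ {ω | N ω ∈ S} = (μ.map N) S := (Measure.map_apply hm (by trivial)).symm
  rw [h2, h1, Measure.map_apply (measurable_of_countable _) (by trivial)]
  rfl

lemma measure_eq_zero_of_hasLaw_poisson
    (hN : HasLaw N ((poissonMeasure r).map (fun n : ℕ => (n : ℕ∞))) μ) (hm : Measurable N) :
    μ {ω | N ω = 0} = ENNReal.ofReal (Real.exp (-r)) := by
  have h := measure_eq_of_hasLaw_poisson hN hm {0}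
  have h1 : {n : ℕ | (n : ℕ∞) ∈ ({0} : Set ℕ∞)} = {0} := by ext; simp
  rw [h1, poissonMeasure_singleton] at h
  simpa using h

/-- `1 - exp (-r) - r * exp (-r) ≤ r ^ 2`. -/
lemma measure_two_le_of_hasLaw_poisson
    (hN : HasLaw N ((poissonMeasure r).map (fun n : ℕ => (n : ℕ∞))) μ) (hm : Measurable N) :
    μ {ω | 2 ≤ N ω} ≤ ENNReal.ofReal ((r : ℝ) ^ 2) := by
  have h := measure_eq_of_hasLaw_poisson hN hm {n | 2 ≤ n}
  have h1 : {n : ℕ | (n : ℕ∞) ∈ {n : ℕ∞ | 2 ≤ n}} = ({0} ∪ {1} : Set ℕ)ᶜ := by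
    ext n
    simp only [mem_ofPred_eq, mem_compl_iff, mem_union, mem_singleton_iff]
    norm_cast
    omega
  rw [h1, prob_compl_eq_one_sub (by trivial), measure_union (by simp) (by trivial),
    poissonMeasure_singleton, poissonMeasure_singleton] at h
  refine h.le.trans ?_
  rw [← ENNReal.ofReal_add (by positivity) (by positivity), ← ENNReal.ofReal_one,
    ← ENNReal.ofReal_sub _ (by positivity)]
  refine ENNReal.ofReal_le_ofReal ?_
  have h2 := Real.add_one_le_exp (-(r : ℝ))
  have h3 : (0 : ℝ) ≤ r := r.2
  simp only [pow_zero, mul_one, Nat.factorial_zero, Nat.cast_one, div_one, pow_one,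
    Nat.factorial_one]
  nlinarith

lemma ae_ne_top_of_hasLaw_poisson
    (hN : HasLaw N ((poissonMeasure r).map (fun n : ℕ => (n : ℕ∞))) μ) (hm : Measurable N) :
    ∀ᵐ ω ∂μ, N ω ≠ ⊤ := by
  have h := measure_eq_of_hasLaw_poisson hN hm {⊤}
  have h1 : {n : ℕ | (n : ℕ∞) ∈ ({⊤} : Set ℕ∞)} = ∅ := by ext; simp
  rw [h1, measure_empty] at h
  rw [ae_iff]
  simpa using h

end

/-- The areas `lam * π * ‖x i‖ ^ 2` of the discs out to the points of a planar Poisson process of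
density `lam` are the arrival times of a unit-rate Poisson process. -/
lemma IsPoissonPointProcess.isPoissonArrivals {Ω : Type*} [MeasurableSpace Ω] {μ : Measure Ω}
    {lam : ℝ} (hlam : 0 < lam) {Φ : Ω → Set (EuclideanSpace ℝ (Fin 2))}
    (hΦ : IsPoissonPointProcess (ENNReal.ofReal lam • volume) Φ μ)
    {X : ℕ → Ω → EuclideanSpace ℝ (Fin 2)} (hX : ∀ i, Measurable (X i))
    (hXΦ : ∀ᵐ ω ∂μ, IsDistanceOrdering (Φ ω) fun i => X i ω) :
    IsPoissonArrivals (fun i ω => lam * Real.pi * ‖X i ω‖ ^ 2)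
      (fun B ω => (Φ ω ∩ (fun x => lam * Real.pi * ‖x‖ ^ 2) ⁻¹' B).encard) μ := by
  have hc : 0 < lam * Real.pi := by positivity
  have hm : Measurable fun x : EuclideanSpace ℝ (Fin 2) => lam * Real.pi * ‖x‖ ^ 2 := by fun_prop
  have hlaw : ∀ B : Set ℝ, MeasurableSet B → ∀ t : ℝ, 0 ≤ t →
      (ENNReal.ofReal lam • (volume : Measure (EuclideanSpace ℝ (Fin 2))))
        ((fun x => lam * Real.pi * ‖x‖ ^ 2) ⁻¹' B) = ENNReal.ofReal t →
      HasLaw (fun ω => (Φ ω ∩ (fun x => lam * Real.pi * ‖x‖ ^ 2) ⁻¹' B).encard)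
        ((poissonMeasure t.toNNReal).map (fun n : ℕ => (n : ℕ∞))) μ := by
    intro B hB t ht hBt
    have h1 := hΦ.law_count _ (hm hB) (by rw [hBt]; exact ENNReal.ofReal_ne_top)
    rw [hBt, ENNReal.ofReal, ENNReal.toNNReal_coe] at h1
    exact h1
  have hcm : ∀ B : Set ℝ, MeasurableSet B → Measurable fun ω =>
      (Φ ω ∩ (fun x => lam * Real.pi * ‖x‖ ^ 2) ⁻¹' B).encard := fun B hB =>
    hΦ.measurable_count _ (hm hB)
  refine ⟨fun i => hm.comp (hX i), fun i ω => by positivity, ?_, hcm, ?_, ?_, ?_, ?_, ?_, ?_⟩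
  · filter_upwards [hXΦ] with ω hω i j hij
    have : ‖X i ω‖ ≤ ‖X j ω‖ := hω.monotone hij
    simp only
    gcongr
  · filter_upwards [hXΦ] with ω hω B
    rw [← hω.injective.encard_image]
    congr 1
    ext x
    simp only [← hω.range_eq, mem_inter_iff, mem_range, mem_preimage, mem_image, mem_ofPred_eq]
    constructor
    · rintro ⟨⟨i, rfl⟩, hi⟩
      exact ⟨i, hi, rfl⟩
    · rintro ⟨i, hi, rfl⟩
      exact ⟨⟨i, rfl⟩, hi⟩
  · intro t ht
    have h := measure_eq_zero_of_hasLaw_poisson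
      (hlaw _ measurableSet_Iic t ht (volume_areaPreimage_Iic hlam ht)) (hcm _ measurableSet_Iic)
    rwa [Real.coe_toNNReal t ht] at h
  · intro a t ha ht
    have h := measure_eq_zero_of_hasLaw_poisson
      (hlaw _ measurableSet_Ioc t ht (volume_areaPreimage_Ioc hlam ha ht)) (hcm _ measurableSet_Ioc)
    rwa [Real.coe_toNNReal t ht] at h
  · intro a t ha ht
    have h := measure_two_le_of_hasLaw_poisson
      (hlaw _ measurableSet_Ioc t ht (volume_areaPreimage_Ioc hlam ha ht)) (hcm _ measurableSet_Ioc)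
    rwa [Real.coe_toNNReal t ht] at h
  · intro t ht
    exact ae_ne_top_of_hasLaw_poisson
      (hlaw _ measurableSet_Iic t ht (volume_areaPreimage_Iic hlam ht)) (hcm _ measurableSet_Iic)
  · intro n B hB hd
    exact hΦ.indep_count n _ (fun i => hm (hB i)) fun i j hij => (hd hij).preimage _

/-! ### Sums of exponential variables -/

/-- The law of the sum of `n + 1` independent standard exponential variables. -/
noncomputable def erlangMeasure (n : ℕ) : Measure ℝ :=
  (volume.restrict (Ioi 0)).withDensity fun x => ENNReal.ofReal (x ^ n / n.factorial * Real.exp (-x))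

lemma measurable_erlangDensity (n : ℕ) :
    Measurable fun x : ℝ => ENNReal.ofReal (x ^ n / n.factorial * Real.exp (-x)) := by fun_prop

lemma lintegral_erlangMeasure (n : ℕ) {f : ℝ → ℝ≥0∞} (hf : Measurable f) :
    ∫⁻ x, f x ∂(erlangMeasure n) =
      ∫⁻ x in Ioi (0 : ℝ), ENNReal.ofReal (x ^ n / n.factorial * Real.exp (-x)) * f x := by
  rw [erlangMeasure, lintegral_withDensity_eq_lintegral_mul _ (measurable_erlangDensity n) hf]
  rfl

lemma expMeasure_one_eq_erlangMeasure_zero : expMeasure 1 = erlangMeasure 0 := by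
  refine Measure.ext_of_lintegral _ fun f hf => ?_
  rw [lintegral_expMeasure_one hf, lintegral_erlangMeasure 0 hf]
  simp

lemma lintegral_Ioi_comp_add {f : ℝ → ℝ≥0∞} (a : ℝ) :
    ∫⁻ e in Ioi (0 : ℝ), f (a + e) = ∫⁻ y in Ioi a, f y := by
  rw [← lintegral_indicator measurableSet_Ioi, ← lintegral_indicator measurableSet_Ioi,
    ← lintegral_add_left_eq_self ((Ioi a).indicator f) a]
  refine lintegral_congr fun e => ?_
  simp [indicator]

lemma lintegral_Ioo_pow_div_factorial (n : ℕ) {y : ℝ} (hy : 0 ≤ y) :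
    ∫⁻ x in Ioo 0 y, ENNReal.ofReal (x ^ n / n.factorial) =
      ENNReal.ofReal (y ^ (n + 1) / (n + 1).factorial) := by
  have h2 : IntervalIntegrable (fun x : ℝ => x ^ n / n.factorial) volume 0 y :=
    Continuous.intervalIntegrable (by fun_prop) _ _
  rw [setLIntegral_congr Ioo_ae_eq_Ioc, ← ofReal_integral_eq_lintegral_ofReal
    ((intervalIntegrable_iff_integrableOn_Ioc_of_le hy).1 h2)
    ((ae_restrict_iff' measurableSet_Ioc).2 (Eventually.of_forall fun x hx => by
      have := hx.1
      positivity)),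
    ← intervalIntegral.integral_of_le hy, intervalIntegral.integral_div, integral_pow]
  congr 1
  rw [Nat.factorial_succ]
  push_cast
  field_simp
  simp

/-- Adding one more exponential variable. -/
lemma lintegral_erlangMeasure_succ (n : ℕ) {f : ℝ → ℝ≥0∞} (hf : Measurable f) :
    ∫⁻ x, ∫⁻ e, f (x + e) ∂(expMeasure 1) ∂(erlangMeasure n) =
      ∫⁻ x, f x ∂(erlangMeasure (n + 1)) := by
  have h0 : Measurable fun x : ℝ => ∫⁻ e, f (x + e) ∂(expMeasure 1) := by
    have := isProbabilityMeasure_expMeasure one_pos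
    exact Measurable.lintegral_prod_right' (f := fun p : ℝ × ℝ => f (p.1 + p.2)) (by fun_prop)
  rw [lintegral_erlangMeasure n h0, lintegral_erlangMeasure _ hf]
  have h1 : ∀ x : ℝ, ∫⁻ e, f (x + e) ∂(expMeasure 1) =
      ∫⁻ y, ENNReal.ofReal (Real.exp (x - y)) * (Ioi x).indicator f y := by
    intro x
    have h2 := lintegral_Ioi_comp_add (f := fun y => ENNReal.ofReal (Real.exp (x - y)) * f y) x
    rw [lintegral_expMeasure_one (f := fun e => f (x + e)) (by fun_prop)]
    refine Eq.trans (lintegral_congr fun e => ?_) (h2.trans ?_)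
    · congr 3
      ring
    · rw [← lintegral_indicator measurableSet_Ioi]
      refine lintegral_congr fun y => ?_
      by_cases hy : y ∈ Ioi x <;> simp [hy]
  have h3 : ∀ y : ℝ, (Ioi (0 : ℝ)).indicator (fun y => ENNReal.ofReal
      (y ^ (n + 1) / (n + 1).factorial * Real.exp (-y)) * f y) y =
      ∫⁻ x in Ioi (0 : ℝ), ENNReal.ofReal (x ^ n / n.factorial * Real.exp (-x)) *
        (ENNReal.ofReal (Real.exp (x - y)) * (Ioi x).indicator f y) := by
    intro y
    have h4 : ∀ x ∈ Ioi (0 : ℝ), ENNReal.ofReal (x ^ n / n.factorial * Real.exp (-x)) *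
        (ENNReal.ofReal (Real.exp (x - y)) * (Ioi x).indicator f y) =
        (Iio y).indicator (fun x => ENNReal.ofReal (x ^ n / n.factorial)) x *
          (ENNReal.ofReal (Real.exp (-y)) * f y) := by
      intro x hx
      have hx0 : (0 : ℝ) < x := hx
      by_cases hxy : x < y
      · rw [indicator_of_mem (show y ∈ Ioi x from hxy), indicator_of_mem (show x ∈ Iio y from hxy),
          ← mul_assoc, ← mul_assoc, ← ENNReal.ofReal_mul (by positivity),
          ← ENNReal.ofReal_mul (by positivity), mul_assoc (x ^ n / _), ← Real.exp_add]
        congr 4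
        ring
      · rw [indicator_of_notMem (show y ∉ Ioi x from hxy),
          indicator_of_notMem (show x ∉ Iio y from hxy)]
        simp
    rw [setLIntegral_congr_fun measurableSet_Ioi h4, lintegral_mul_const _
      ((by fun_prop : Measurable fun x : ℝ => ENNReal.ofReal (x ^ n / n.factorial)).indicator
        measurableSet_Iio), setLIntegral_indicator measurableSet_Iio, Iio_inter_Ioi]
    by_cases hy : 0 < y
    · rw [indicator_of_mem (show y ∈ Ioi (0 : ℝ) from hy),
        lintegral_Ioo_pow_div_factorial n hy.le, ← mul_assoc, ENNReal.ofReal_mul (by positivity)]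
    · rw [indicator_of_notMem (show y ∉ Ioi (0 : ℝ) from hy), Ioo_eq_empty hy]
      simp
  simp_rw [h1]
  rw [← lintegral_indicator (s := Ioi (0 : ℝ)) measurableSet_Ioi (fun y => ENNReal.ofReal
      (y ^ (n + 1) / (n + 1).factorial * Real.exp (-y)) * f y)]
  simp_rw [h3]
  rw [lintegral_lintegral_swap]
  · refine setLIntegral_congr_fun measurableSet_Ioi fun x _ => ?_
    rw [lintegral_const_mul]
    refine Measurable.mul (by fun_prop) (hf.indicator measurableSet_Ioi)
  · refine Measurable.aemeasurable ?_
    have h5 : MeasurableSet {p : ℝ × ℝ | p.2 < p.1} := measurableSet_lt measurable_snd measurable_fst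
    have h6 : Measurable ({p : ℝ × ℝ | p.2 < p.1}.indicator fun p => f p.1) :=
      (hf.comp measurable_fst).indicator h5
    have h7 : Measurable fun p : ℝ × ℝ => ENNReal.ofReal (p.2 ^ n / n.factorial * Real.exp (-p.2)) *
        (ENNReal.ofReal (Real.exp (p.2 - p.1)) *
          ({p : ℝ × ℝ | p.2 < p.1}.indicator fun p => f p.1) p) := by
      fun_prop
    exact h7

/-- The substitution `y = c * x ^ 2`. -/
lemma lintegral_Ioi_comp_mul_sq {c a : ℝ} (hc : 0 < c) (ha : 0 ≤ a) (f : ℝ → ℝ≥0∞) :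
    ∫⁻ y in Ioi (c * a ^ 2), f y =
      ∫⁻ x in Ioi a, ENNReal.ofReal (2 * c * x) * f (c * x ^ 2) := by
  have himg : (fun x => c * x ^ 2) '' Ioi a = Ioi (c * a ^ 2) := by
    ext y
    constructor
    · rintro ⟨x, hx, rfl⟩
      have hx' : a < x := hx
      have : a ^ 2 < x ^ 2 := by gcongr
      exact (mul_lt_mul_iff_right₀ hc).2 this
    · intro hy
      have hy' : c * a ^ 2 < y := hy
      have hy0 : 0 ≤ y := (by positivity : 0 ≤ c * a ^ 2).trans hy'.le
      refine ⟨Real.sqrt (y / c), ?_, ?_⟩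
      · refine (Real.lt_sqrt ha).2 ((lt_div_iff₀ hc).2 ?_)
        rwa [mul_comm]
      · simp only
        rw [Real.sq_sqrt (by positivity)]
        field_simp
  have hinj : InjOn (fun x => c * x ^ 2) (Ioi a) := by
    intro x hx y hy hxy
    have hx' : a < x := hx
    have hy' : a < y := hy
    have : x ^ 2 = y ^ 2 := mul_left_cancel₀ hc.ne' hxy
    exact (pow_left_inj₀ (ha.trans hx'.le) (ha.trans hy'.le) two_ne_zero).1 this
  have hder : ∀ x ∈ Ioi a, HasDerivWithinAt (fun x => c * x ^ 2) (2 * c * x) (Ioi a) x := by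
    intro x _
    have := ((hasDerivAt_pow 2 x).const_mul c).hasDerivWithinAt (s := Ioi a)
    convert! this using 1
    push_cast
    ring
  rw [← himg, lintegral_image_eq_lintegral_abs_deriv_mul measurableSet_Ioi hder hinj]
  refine setLIntegral_congr_fun measurableSet_Ioi fun x hx => ?_
  have hx' : a < x := hx
  have : 0 ≤ x := ha.trans hx'.le
  rw [abs_of_nonneg (by positivity)]

/-- The tail of a sum of `n + 1` standard exponential variables is the probability of at most `n`
arrivals. -/
lemma erlangMeasure_Ioi (n : ℕ) {t : ℝ} (ht : 0 ≤ t) : erlangMeasure n (Ioi t) =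
    ENNReal.ofReal (∑ k ∈ Finset.range (n + 1), t ^ k / k.factorial * Real.exp (-t)) := by
  have hderiv : ∀ x ∈ Ici t, HasDerivAt
      (fun x => -∑ k ∈ Finset.range (n + 1), x ^ k / k.factorial * Real.exp (-x))
      (x ^ n / n.factorial * Real.exp (-x)) x := by
    intro x _
    have hexp : HasDerivAt (fun x : ℝ => Real.exp (-x)) (-Real.exp (-x)) x := by
      simpa using (hasDerivAt_neg x).exp
    induction n with
    | zero => simpa using hexp.fun_neg
    | succ n ih =>
      simp_rw [Finset.sum_range_succ _ (n + 1), neg_add]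
      have h1 : HasDerivAt (fun x : ℝ => x ^ (n + 1) / ((n + 1).factorial : ℝ))
          (x ^ n / n.factorial) x := by
        have := (hasDerivAt_pow (n + 1) x).div_const ((n + 1).factorial : ℝ)
        convert! this using 1
        rw [Nat.factorial_succ]
        push_cast
        field_simp
      have h2 := ih.add (h1.mul hexp).neg
      convert! h2 using 1
      ring
  have hlim : Tendsto (fun x => -∑ k ∈ Finset.range (n + 1), x ^ k / k.factorial * Real.exp (-x))
      atTop (𝓝 0) := by
    have h1 : Tendsto (fun x : ℝ => ∑ k ∈ Finset.range (n + 1),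
        x ^ k / k.factorial * Real.exp (-x)) atTop (𝓝 (∑ k ∈ Finset.range (n + 1), 0)) := by
      refine tendsto_finsetSum _ fun k _ => ?_
      have := (Real.tendsto_pow_mul_exp_neg_atTop_nhds_zero k).div_const (k.factorial : ℝ)
      rw [zero_div] at this
      refine this.congr fun x => ?_
      ring
    simpa using h1.neg
  have hnn : ∀ x ∈ Ioi t, 0 ≤ x ^ n / n.factorial * Real.exp (-x) := by
    intro x hx
    have hx' : t < x := hx
    have : 0 < x := ht.trans_lt hx'
    positivity
  have hint := integrableOn_Ioi_deriv_of_nonneg' hderiv hnn hlim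
  have hval := integral_Ioi_of_hasDerivAt_of_tendsto' hderiv hint hlim
  rw [erlangMeasure, withDensity_apply _ measurableSet_Ioi,
    Measure.restrict_restrict measurableSet_Ioi, Ioi_inter_Ioi, max_eq_left ht,
    ← ofReal_integral_eq_lintegral_ofReal hint
      ((ae_restrict_iff' measurableSet_Ioi).2 (Eventually.of_forall hnn)), hval]
  simp

instance (n : ℕ) : IsProbabilityMeasure (erlangMeasure n) := by
  constructor
  have h1 : erlangMeasure n (Iic 0) = 0 := by
    rw [erlangMeasure, withDensity_apply _ measurableSet_Iic,
      Measure.restrict_restrict measurableSet_Iic, Iic_inter_Ioi, Ioc_self]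
    simp
  rw [← Iic_union_Ioi (a := (0 : ℝ)), measure_union (by
    exact Set.disjoint_left.2 fun x hx hx' => not_le.2 (mem_Ioi.1 hx') (mem_Iic.1 hx))
      measurableSet_Ioi, h1,
    erlangMeasure_Ioi n le_rfl, Finset.sum_range_succ']
  simp

/-! ### The Markov property of the arrival times -/

lemma MeasureTheory.lintegral_prodMk_eq_of_indepFun {Ω A B : Type*} [MeasurableSpace Ω]
    [MeasurableSpace A] [MeasurableSpace B] {μ : Measure Ω} [IsProbabilityMeasure μ]
    {X : Ω → A} {Y : Ω → B}
    (h : IndepFun X Y μ) (hX : Measurable X) (hY : Measurable Y) {f : A → B → ℝ≥0∞}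
    (hf : Measurable (Function.uncurry f)) :
    ∫⁻ ω, f (X ω) (Y ω) ∂μ = ∫⁻ ω, ∫⁻ b, f (X ω) b ∂(μ.map Y) ∂μ := by
  have := Measure.isProbabilityMeasure_map (μ := μ) hY.aemeasurable
  have h1 := (indepFun_iff_map_prod_eq_prod_map_map hX.aemeasurable hY.aemeasurable).1 h
  calc ∫⁻ ω, f (X ω) (Y ω) ∂μ
      = ∫⁻ p, Function.uncurry f p ∂(μ.map fun ω => (X ω, Y ω)) :=
        (lintegral_map hf (hX.prodMk hY)).symm
    _ = ∫⁻ a, ∫⁻ b, f a b ∂(μ.map Y) ∂(μ.map X) := by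
        rw [h1, lintegral_prod _ hf.aemeasurable]
        rfl
    _ = _ := lintegral_map hf.lintegral_prod_right' hX

namespace IsPoissonArrivals

variable {Ω : Type*} [MeasurableSpace Ω] {U : ℕ → Ω → ℝ} {C : Set ℝ → Ω → ℕ∞} {μ : Measure Ω}
  [IsProbabilityMeasure μ]

/-- Given the points up to `U n`, the next one is `U n` plus a standard exponential variable. -/
lemma lintegral_succ (h : IsPoissonArrivals U C μ) (n : ℕ) {f : (Fin (n + 1) → ℝ) → ℝ → ℝ≥0∞}
    (hf : Measurable (Function.uncurry f)) :
    ∫⁻ ω, f (fun i => U i ω) (U (n + 1) ω) ∂μ =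
      ∫⁻ ω, ∫⁻ e, f (fun i => U i ω) (U n ω + e) ∂(expMeasure 1) ∂μ := by
  have hV : Measurable fun ω (i : Fin (n + 1)) => U i ω :=
    measurable_pi_iff.2 fun i => h.measurable i
  have hm : Measurable fun ω => U (n + 1) ω - U n ω := (h.measurable _).sub (h.measurable _)
  have h1 := lintegral_prodMk_eq_of_indepFun (h.indepFun_gap n) hV hm
    (f := fun v e => f v (v (Fin.last n) + e)) (by
      change Measurable fun p : (Fin (n + 1) → ℝ) × ℝ =>
        Function.uncurry f (p.1, p.1 (Fin.last n) + p.2)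
      fun_prop)
  rw [(h.hasLaw_gap n).map_eq] at h1
  simpa using h1

/-- The law of `(U 0, U (p + 1))`: the increment is a sum of `p + 1` independent gaps. -/
lemma lintegral_zero_succ (h : IsPoissonArrivals U C μ) (p : ℕ) {G : ℝ → ℝ → ℝ≥0∞}
    (hG : Measurable (Function.uncurry G)) :
    ∫⁻ ω, G (U 0 ω) (U (p + 1) ω) ∂μ =
      ∫⁻ a, ∫⁻ e, G a (a + e) ∂(erlangMeasure p) ∂(expMeasure 1) := by
  have hexp := isProbabilityMeasure_expMeasure one_pos
  induction p generalizing G with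
  | zero =>
    have h1 := h.lintegral_succ 0 (f := fun v b => G (v 0) b) (by
      change Measurable fun p : (Fin 1 → ℝ) × ℝ => Function.uncurry G (p.1 0, p.2)
      fun_prop)
    simp only [Fin.val_zero, zero_add] at h1 ⊢
    rw [h1, ← expMeasure_one_eq_erlangMeasure_zero, ← h.hasLaw_zero.map_eq,
      lintegral_map _ (h.measurable 0)]
    rw [h.hasLaw_zero.map_eq]
    refine Measurable.lintegral_prod_right'
      (f := fun p : ℝ × ℝ => Function.uncurry G (p.1, p.1 + p.2)) ?_
    fun_prop
  | succ p ih =>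
    have h1 := h.lintegral_succ (p + 1) (f := fun v b => G (v 0) b) (by
      change Measurable fun q : (Fin (p + 2) → ℝ) × ℝ => Function.uncurry G (q.1 0, q.2)
      fun_prop)
    simp only [Fin.val_zero] at h1
    rw [h1, ih (G := fun a b => ∫⁻ e, G a (b + e) ∂(expMeasure 1))]
    · refine lintegral_congr fun a => ?_
      have hGa : Measurable fun y => G a (a + y) :=
        hG.comp (measurable_const.prodMk (measurable_const_add a))
      rw [← lintegral_erlangMeasure_succ p hGa]
      simp_rw [add_assoc]
    · refine Measurable.lintegral_prod_right'
        (f := fun q : (ℝ × ℝ) × ℝ => Function.uncurry G (q.1.1, q.1.2 + q.2)) ?_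
      fun_prop

/-- The product of the fading factors of the next `n` points, completed by the Laplace functional
of the points beyond them, is a martingale in `n`. -/
lemma lintegral_mul_prod_fadingFactor (h : IsPoissonArrivals U C μ) {lam α s : ℝ} {N : ℕ}
    (hlam : 0 < lam) (hα : 2 < α) (hN : 1 ≤ N) (hs : 0 ≤ s) {Ψ : ℝ → ℝ → ℝ≥0∞}
    (hΨ : Measurable (Function.uncurry Ψ)) (p n : ℕ) :
    ∫⁻ ω, Ψ (U 0 ω) (U p ω) *
        ((∏ j : Fin n, ENNReal.ofReal (fadingFactor lam α N s (U (p + 1 + j) ω))) *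
        ENNReal.ofReal (tailLaplace lam α N s (U (p + n) ω))) ∂μ =
      ∫⁻ ω, Ψ (U 0 ω) (U p ω) * ENNReal.ofReal (tailLaplace lam α N s (U p ω)) ∂μ := by
  have htm := measurable_tailLaplace hlam hα hN hs
  have hfm := measurable_fadingFactor (lam := lam) (α := α) (N := N) (s := s)
  induction n with
  | zero => simp
  | succ n ih =>
    rw [← ih]
    have h1 := h.lintegral_succ (p + n) (f := fun v b =>
      (Ψ (v 0) (v ⟨p, by omega⟩) *
        (∏ j : Fin n, ENNReal.ofReal (fadingFactor lam α N s (v ⟨p + 1 + j, by omega⟩)))) *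
        ENNReal.ofReal (fadingFactor lam α N s b * tailLaplace lam α N s b)) (by
      refine Measurable.mul (Measurable.mul ?_ ?_) ?_
      · exact hΨ.comp (f := fun q : (Fin (p + n + 1) → ℝ) × ℝ => (q.1 0, q.1 ⟨p, by omega⟩))
          (by fun_prop)
      · refine Finset.measurable_prod _ fun j _ => ?_
        exact (hfm.comp ((measurable_pi_apply _).comp measurable_fst)).ennreal_ofReal
      · exact ((hfm.comp measurable_snd).mul (htm.comp measurable_snd)).ennreal_ofReal)
    simp only [Fin.val_zero] at h1
    calc _ = ∫⁻ ω, (Ψ (U 0 ω) (U p ω) *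
          (∏ j : Fin n, ENNReal.ofReal (fadingFactor lam α N s (U (p + 1 + j) ω)))) *
          ENNReal.ofReal (fadingFactor lam α N s (U (p + n + 1) ω) *
            tailLaplace lam α N s (U (p + n + 1) ω)) ∂μ := by
          refine lintegral_congr fun ω => ?_
          rw [Fin.prod_univ_castSucc,
            ENNReal.ofReal_mul (fadingFactor_mem hlam hs (h.nonneg _ ω)).1.le]
          simp only [Fin.val_castSucc, Fin.val_last, mul_assoc]
          rw [show p + 1 + n = p + n + 1 by ring, show p + (n + 1) = p + n + 1 by ring]
      _ = _ := by
          rw [h1]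
          refine lintegral_congr_ae ?_
          filter_upwards [h.ae_forall_pos] with ω hpos
          rw [lintegral_const_mul, lintegral_fadingFactor_mul_tailLaplace hlam hα hN hs (hpos _),
            mul_assoc]
          exact ((hfm.comp (measurable_const_add _)).mul
            (htm.comp (measurable_const_add _))).ennreal_ofReal

end IsPoissonArrivals

/-! ### The joint density of the two distances -/

section
variable {Ω : Type*} [MeasurableSpace Ω] {C : Set ℝ → Ω → ℕ∞} {μ : Measure Ω}
  [IsProbabilityMeasure μ] {ρ : ℕ → Ω → ℝ} {lam : ℝ}

/-- The area out to the nearest base station is exponential; substitute `a = lam * π * r ^ 2`. -/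
lemma lintegral_nearest (hlam : 0 < lam) (hρ : ∀ i ω, 0 ≤ ρ i ω)
    (h : IsPoissonArrivals (fun i ω => lam * Real.pi * ρ i ω ^ 2) C μ) {F : ℝ → ℝ≥0∞}
    (hF : Measurable F) :
    ∫⁻ ω, F (ρ 0 ω) ∂μ = ∫⁻ r in Ioi (0 : ℝ), ENNReal.ofReal (nearestDensity lam r) * F r := by
  have hc : 0 < lam * Real.pi := by positivity
  have hroot : ∀ x : ℝ, 0 ≤ x → Real.sqrt (lam * Real.pi * x ^ 2 / (lam * Real.pi)) = x := by
    intro x hx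
    rw [mul_div_cancel_left₀ _ hc.ne', Real.sqrt_sq hx]
  have hG : Measurable fun a : ℝ => F (Real.sqrt (a / (lam * Real.pi))) := by fun_prop
  have h1 := lintegral_map (μ := μ) hG (h.measurable 0)
  rw [h.hasLaw_zero.map_eq, lintegral_expMeasure_one hG] at h1
  simp only [hroot _ (hρ 0 _)] at h1
  have h2 := lintegral_Ioi_comp_mul_sq hc le_rfl (fun a => ENNReal.ofReal (Real.exp (-a)) *
    F (Real.sqrt (a / (lam * Real.pi))))
  rw [← h1]
  simp only [ne_eq, OfNat.ofNat_ne_zero, not_false_eq_true, zero_pow, mul_zero] at h2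
  rw [h2]
  refine setLIntegral_congr_fun measurableSet_Ioi fun r hr => ?_
  have hr' : (0 : ℝ) < r := hr
  rw [hroot r hr'.le, ← mul_assoc, ← ENNReal.ofReal_mul (by positivity)]
  congr 2
  rw [nearestDensity, mul_comm]
  congr 1
  · congr 1; ring
  · ring

/-- The area out to the nearest base station and its increment up to the `(m - 1)`-th interferer
are independent, exponential and Erlang; substitute `a = lam * π * r ^ 2` in both. -/
lemma lintegral_nearest_interferer (hlam : 0 < lam) (hρ : ∀ i ω, 0 ≤ ρ i ω)
    (h : IsPoissonArrivals (fun i ω => lam * Real.pi * ρ i ω ^ 2) C μ) {m : ℕ} (hm : 2 ≤ m)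
    {F : ℝ → ℝ → ℝ≥0∞} (hF : Measurable (Function.uncurry F)) :
    ∫⁻ ω, F (ρ 0 ω) (ρ (m - 1) ω) ∂μ = ∫⁻ r in Ioi (0 : ℝ), ∫⁻ R in Ioi r,
      ENNReal.ofReal (interfererDensity lam m r R * nearestDensity lam r) * F r R := by
  obtain ⟨p, rfl⟩ := Nat.exists_eq_add_of_le' hm
  have hc : 0 < lam * Real.pi := by positivity
  have hroot : ∀ x : ℝ, 0 ≤ x → Real.sqrt (lam * Real.pi * x ^ 2 / (lam * Real.pi)) = x := by
    intro x hx
    rw [mul_div_cancel_left₀ _ hc.ne', Real.sqrt_sq hx]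
  have hexp := isProbabilityMeasure_expMeasure one_pos
  set G : ℝ → ℝ → ℝ≥0∞ := fun a b =>
    F (Real.sqrt (a / (lam * Real.pi))) (Real.sqrt (b / (lam * Real.pi))) with hGdef
  have hG : Measurable (Function.uncurry G) :=
    hF.comp (f := fun q : ℝ × ℝ =>
      (Real.sqrt (q.1 / (lam * Real.pi)), Real.sqrt (q.2 / (lam * Real.pi)))) (by fun_prop)
  have h1 := h.lintegral_zero_succ p hG
  simp only [hGdef, hroot _ (hρ _ _)] at h1
  rw [show p + 2 - 1 = p + 1 by omega, h1, lintegral_expMeasure_one (by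
    exact Measurable.lintegral_prod_right'
      (f := fun q : ℝ × ℝ => Function.uncurry G (q.1, q.1 + q.2)) (by fun_prop))]
  have h2 := lintegral_Ioi_comp_mul_sq hc le_rfl (fun a => ENNReal.ofReal (Real.exp (-a)) *
    ∫⁻ e, G a (a + e) ∂(erlangMeasure p))
  simp only [ne_eq, OfNat.ofNat_ne_zero, not_false_eq_true, zero_pow, mul_zero] at h2
  refine h2.trans (setLIntegral_congr_fun measurableSet_Ioi fun r hr => ?_)
  have hr' : (0 : ℝ) < r := hr
  have hGa : ∀ a, Measurable fun b => G a b := fun a => hG.comp measurable_prodMk_left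
  have h3 : ∫⁻ e, G (lam * Real.pi * r ^ 2) (lam * Real.pi * r ^ 2 + e) ∂(erlangMeasure p) =
      ∫⁻ R in Ioi r, ENNReal.ofReal (2 * (lam * Real.pi) * R) *
        (ENNReal.ofReal ((lam * Real.pi * R ^ 2 - lam * Real.pi * r ^ 2) ^ p / p.factorial *
          Real.exp (-(lam * Real.pi * R ^ 2 - lam * Real.pi * r ^ 2))) * F r R) := by
    rw [lintegral_erlangMeasure p (by
      exact (hGa (lam * Real.pi * r ^ 2)).comp (measurable_const_add _))]
    have h4 := lintegral_Ioi_comp_add (f := fun b => ENNReal.ofReal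
      ((b - lam * Real.pi * r ^ 2) ^ p / p.factorial *
        Real.exp (-(b - lam * Real.pi * r ^ 2))) * G (lam * Real.pi * r ^ 2) b)
      (lam * Real.pi * r ^ 2)
    simp only [add_sub_cancel_left] at h4
    rw [h4, lintegral_Ioi_comp_mul_sq hc hr'.le]
    refine setLIntegral_congr_fun measurableSet_Ioi fun R hR => ?_
    have hR' : r < R := hR
    simp only [hGdef]
    rw [hroot r hr'.le, hroot R (hr'.trans hR').le]
  rw [h3, ← mul_assoc, ← lintegral_const_mul']
  · refine setLIntegral_congr_fun measurableSet_Ioi fun R hR => ?_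
    have hR' : r < R := hR
    have hR0 : 0 < R := hr'.trans hR'
    have hsq : 0 ≤ lam * Real.pi * R ^ 2 - lam * Real.pi * r ^ 2 := by
      rw [← mul_sub]
      have : r ^ 2 ≤ R ^ 2 := by gcongr
      exact mul_nonneg hc.le (by linarith)
    rw [← mul_assoc, ← mul_assoc, ← ENNReal.ofReal_mul (by positivity),
      ← ENNReal.ofReal_mul (by positivity), ← ENNReal.ofReal_mul (by positivity)]
    congr 2
    rw [interfererDensity, nearestDensity]
    have e1 : Real.pi * lam * (R ^ 2 - r ^ 2) = lam * Real.pi * R ^ 2 - lam * Real.pi * r ^ 2 := by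
      ring
    have e2 : -Real.pi * lam * (R ^ 2 - r ^ 2) =
        -(lam * Real.pi * R ^ 2 - lam * Real.pi * r ^ 2) := by ring
    have e3 : -lam * Real.pi * r ^ 2 = -(lam * Real.pi * r ^ 2) := by ring
    rw [e1, e2, e3, Nat.add_sub_cancel]
    ring
  · exact ENNReal.mul_ne_top ENNReal.ofReal_ne_top ENNReal.ofReal_ne_top

end

/-! ### Complex Gaussian vectors -/

instance : IsProbabilityMeasure complexGaussian :=
  Measure.isProbabilityMeasure_map Complex.measurableEquivRealProd.symm.measurable.aemeasurable

instance (n : ℕ) : IsProbabilityMeasure (complexGaussianVector n) :=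
  Measure.isProbabilityMeasure_map (by fun_prop)

/-- The squared modulus of a standard complex Gaussian variable is exponential. -/
lemma lintegral_complexGaussian_norm_sq {F : ℝ → ℝ≥0∞} (hF : Measurable F) :
    ∫⁻ z, F (‖z‖ ^ 2) ∂complexGaussian = ∫⁻ u, F u ∂(expMeasure 1) := by
  have hpdf : Measurable fun p : ℝ × ℝ => gaussianPDF 0 (1 / 2) p.1 * gaussianPDF 0 (1 / 2) p.2 :=
    ((measurable_gaussianPDF _ _).comp measurable_fst).mul
      ((measurable_gaussianPDF _ _).comp measurable_snd)
  have hF2 : Measurable fun p : ℝ × ℝ => F (p.1 ^ 2 + p.2 ^ 2) := by fun_prop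
  have hhalf : (1 / 2 : ℝ≥0) ≠ 0 := by norm_num
  have hprod : (gaussianReal 0 (1 / 2)).prod (gaussianReal 0 (1 / 2)) =
      ((volume : Measure (ℝ × ℝ))).withDensity
        (fun p => gaussianPDF 0 (1 / 2) p.1 * gaussianPDF 0 (1 / 2) p.2) := by
    rw [gaussianReal_of_var_ne_zero _ hhalf,
      prod_withDensity (measurable_gaussianPDF _ _) (measurable_gaussianPDF _ _)]
    rfl
  have hpdfval : ∀ x y : ℝ, gaussianPDF 0 (1 / 2) x * gaussianPDF 0 (1 / 2) y =
      ENNReal.ofReal (Real.pi⁻¹ * Real.exp (-(x ^ 2 + y ^ 2))) := by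
    intro x y
    rw [gaussianPDF, gaussianPDF, ← ENNReal.ofReal_mul (gaussianPDFReal_nonneg _ _ _)]
    congr 1
    simp only [gaussianPDFReal]
    have h1 : (((1 / 2 : ℝ≥0)) : ℝ) = 1 / 2 := by norm_num
    rw [h1, mul_mul_mul_comm, ← Real.exp_add, ← mul_inv, Real.mul_self_sqrt (by positivity)]
    congr 2
    · ring
    · ring
  calc ∫⁻ z, F (‖z‖ ^ 2) ∂complexGaussian
      = ∫⁻ p : ℝ × ℝ, F (p.1 ^ 2 + p.2 ^ 2)
          ∂((gaussianReal 0 (1 / 2)).prod (gaussianReal 0 (1 / 2))) := by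
        rw [complexGaussian, lintegral_map (by fun_prop) (MeasurableEquiv.measurable _)]
        refine lintegral_congr fun p => ?_
        congr 1
        rw [Complex.sq_norm, Complex.normSq_apply]
        change p.1 * p.1 + p.2 * p.2 = _
        ring
    _ = ∫⁻ p : ℝ × ℝ, ENNReal.ofReal (Real.pi⁻¹ * Real.exp (-(p.1 ^ 2 + p.2 ^ 2))) *
          F (p.1 ^ 2 + p.2 ^ 2) := by
        rw [hprod, lintegral_withDensity_eq_lintegral_mul _ hpdf hF2]
        refine lintegral_congr fun p => ?_
        simp only [Pi.mul_apply, hpdfval]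
    _ = ∫⁻ p in Ioi (0 : ℝ) ×ˢ Ioo (-Real.pi) Real.pi, ENNReal.ofReal p.1 *
          (ENNReal.ofReal (Real.pi⁻¹ * Real.exp (-(p.1 ^ 2))) * F (p.1 ^ 2)) := by
        rw [← lintegral_comp_polarCoord_symm]
        have htarget : polarCoord.target = Ioi (0 : ℝ) ×ˢ Ioo (-Real.pi) Real.pi := rfl
        rw [htarget]
        refine lintegral_congr fun p => ?_
        have hsq : (p.1 * Real.cos p.2) ^ 2 + (p.1 * Real.sin p.2) ^ 2 = p.1 ^ 2 := by
          have := Real.sin_sq_add_cos_sq p.2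
          linear_combination p.1 ^ 2 * this
        simp only [polarCoord_symm_apply, hsq, smul_eq_mul]
    _ = ∫⁻ r in Ioi (0 : ℝ), ENNReal.ofReal (2 * 1 * r) *
          (ENNReal.ofReal (Real.exp (-(1 * r ^ 2))) * F (1 * r ^ 2)) := by
        rw [Measure.volume_eq_prod, ← Measure.prod_restrict, lintegral_prod _ (by fun_prop)]
        refine setLIntegral_congr_fun measurableSet_Ioi fun r hr => ?_
        have hr' : (0 : ℝ) < r := hr
        simp only [lintegral_const, Measure.restrict_apply MeasurableSet.univ, univ_inter,
          Real.volume_Ioo, one_mul, mul_one]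
        rw [show Real.pi - -Real.pi = 2 * Real.pi by ring, mul_comm, ← mul_assoc, ← mul_assoc,
          ← mul_assoc, ← ENNReal.ofReal_mul (by positivity),
          ← ENNReal.ofReal_mul (by positivity), ← ENNReal.ofReal_mul (by positivity)]
        congr 2
        field_simp
    _ = _ := by
        have h := lintegral_Ioi_comp_mul_sq one_pos le_rfl
          (fun u => ENNReal.ofReal (Real.exp (-u)) * F u)
        simp only [ne_eq, OfNat.ofNat_ne_zero, not_false_eq_true, zero_pow, mul_zero] at h
        rw [lintegral_expMeasure_one hF, h]

/-- The squared norm of a standard complex Gaussian vector in `ℂⁿ⁺¹` is a sum of `n + 1`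
independent standard exponential variables. -/
lemma lintegral_pi_complexGaussian_sum_norm_sq (n : ℕ) {F : ℝ → ℝ≥0∞} (hF : Measurable F) :
    ∫⁻ z, F (∑ i, ‖z i‖ ^ 2) ∂(Measure.pi fun _ : Fin (n + 1) => complexGaussian) =
      ∫⁻ u, F u ∂(erlangMeasure n) := by
  have hexp := isProbabilityMeasure_expMeasure one_pos
  induction n generalizing F with
  | zero =>
    have h1 := (measurePreserving_eval (fun _ : Fin 1 => complexGaussian) 0).lintegral_comp
      (f := fun z => F (‖z‖ ^ 2)) (by fun_prop)
    rw [lintegral_complexGaussian_norm_sq hF, expMeasure_one_eq_erlangMeasure_zero] at h1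
    simpa using h1
  | succ n ih =>
    have h1 := (measurePreserving_piFinSuccAbove
      (fun _ : Fin (n + 2) => complexGaussian) 0).lintegral_comp
      (f := fun p : ℂ × (Fin (n + 1) → ℂ) => F (‖p.1‖ ^ 2 + ∑ i, ‖p.2 i‖ ^ 2)) (by fun_prop)
    have h2 : ∫⁻ z, F (∑ i, ‖z i‖ ^ 2) ∂(Measure.pi fun _ : Fin (n + 2) => complexGaussian) =
        ∫⁻ p : ℂ × (Fin (n + 1) → ℂ), F (‖p.1‖ ^ 2 + ∑ i, ‖p.2 i‖ ^ 2)
          ∂(complexGaussian.prod (Measure.pi fun _ : Fin (n + 1) => complexGaussian)) := by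
      rw [← h1]
      refine lintegral_congr fun z => ?_
      rw [Fin.sum_univ_succ]
      rfl
    rw [h2, lintegral_prod_symm' _ (by fun_prop)]
    have h3 : ∀ w : Fin (n + 1) → ℂ, ∫⁻ z, F (‖z‖ ^ 2 + ∑ i, ‖w i‖ ^ 2) ∂complexGaussian =
        ∫⁻ e, F ((∑ i, ‖w i‖ ^ 2) + e) ∂(expMeasure 1) := by
      intro w
      rw [lintegral_complexGaussian_norm_sq (F := fun u => F (u + ∑ i, ‖w i‖ ^ 2)) (by fun_prop)]
      simp_rw [add_comm]
    simp_rw [h3]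
    rw [ih (F := fun x => ∫⁻ e, F (x + e) ∂(expMeasure 1)) (by
        exact Measurable.lintegral_prod_right' (f := fun p : ℝ × ℝ => F (p.1 + p.2)) (by fun_prop)),
      lintegral_erlangMeasure_succ n hF]

lemma charFun_complexGaussian (w : ℂ) :
    charFun complexGaussian w = Complex.exp (-((‖w‖ ^ 2 / 4 : ℝ) : ℂ)) := by
  rw [charFun_apply, complexGaussian, integral_map (MeasurableEquiv.measurable _).aemeasurable
    (Measurable.aestronglyMeasurable (by fun_prop))]
  have h1 : ∀ p : ℝ × ℝ, Complex.exp (((inner ℝ (Complex.measurableEquivRealProd.symm p) w : ℝ) : ℂ) *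
      Complex.I) = Complex.exp (((inner ℝ p.1 w.re : ℝ) : ℂ) * Complex.I) *
        Complex.exp (((inner ℝ p.2 w.im : ℝ) : ℂ) * Complex.I) := by
    intro p
    rw [← Complex.exp_add, ← add_mul, ← Complex.ofReal_add]
    congr 3
    rw [Complex.inner]
    simp only [Complex.mul_re, Complex.conj_re, Complex.conj_im, Real.inner_apply]
    change w.re * p.1 - w.im * -p.2 = _
    ring
  simp_rw [h1]
  rw [integral_prod_mul (fun x : ℝ => Complex.exp (((inner ℝ x w.re : ℝ) : ℂ) * Complex.I))
    (fun y : ℝ => Complex.exp (((inner ℝ y w.im : ℝ) : ℂ) * Complex.I)), ← charFun_apply,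
    ← charFun_apply, charFun_gaussianReal, charFun_gaussianReal, ← Complex.exp_add]
  congr 1
  rw [Complex.sq_norm, Complex.normSq_apply]
  push_cast
  ring

lemma charFun_complexGaussianVector {n : ℕ} (t : EuclideanSpace ℂ (Fin n)) :
    charFun (complexGaussianVector n) t = Complex.exp (-((‖t‖ ^ 2 / 4 : ℝ) : ℂ)) := by
  rw [complexGaussianVector]
  have h := charFun_pi (μ := fun _ : Fin n => complexGaussian) t
  refine h.trans ?_
  simp_rw [charFun_complexGaussian]
  rw [← Complex.exp_sum, EuclideanSpace.norm_sq_eq, Finset.sum_neg_distrib, ← Complex.ofReal_sum,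
    Finset.sum_div]

lemma EuclideanSpace.real_inner_eq_re {n : ℕ} (x y : EuclideanSpace ℂ (Fin n)) :
    inner ℝ x y = (inner ℂ x y : ℂ).re := by
  rw [PiLp.inner_apply, PiLp.inner_apply, Complex.re_sum]
  refine Finset.sum_congr rfl fun i _ => ?_
  rw [Complex.inner]
  simp [mul_comm]

/-- The coordinates of a standard complex Gaussian vector along an orthonormal family are again
standard complex Gaussian. -/
lemma map_inner_complexGaussianVector {n d : ℕ} {u : Fin d → EuclideanSpace ℂ (Fin n)}
    (hu : Orthonormal ℂ u) :
    (complexGaussianVector n).map (fun h => fun i => inner ℂ (u i) h) =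
      Measure.pi fun _ : Fin d => complexGaussian := by
  have hm : Measurable fun h : EuclideanSpace ℂ (Fin n) =>
      (WithLp.toLp 2 fun i => inner ℂ (u i) h : EuclideanSpace ℂ (Fin d)) := by fun_prop
  have hm' : Measurable fun h : EuclideanSpace ℂ (Fin n) => fun i => inner ℂ (u i) h := by fun_prop
  have key : (complexGaussianVector n).map (fun h =>
      (WithLp.toLp 2 fun i => inner ℂ (u i) h : EuclideanSpace ℂ (Fin d))) =
      complexGaussianVector d := by
    have := Measure.isProbabilityMeasure_map (μ := complexGaussianVector n) hm.aemeasurable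
    refine Measure.ext_of_charFun (funext fun t => ?_)
    rw [charFun_complexGaussianVector, charFun_apply, integral_map hm.aemeasurable
      (Measurable.aestronglyMeasurable (by fun_prop))]
    have h1 : ∀ h : EuclideanSpace ℂ (Fin n),
        inner ℝ (WithLp.toLp 2 fun i => inner ℂ (u i) h : EuclideanSpace ℂ (Fin d)) t =
          inner ℝ h (∑ i, t i • u i) := by
      intro h
      rw [EuclideanSpace.real_inner_eq_re, EuclideanSpace.real_inner_eq_re, inner_sum,
        PiLp.inner_apply]
      congr 1
      refine Finset.sum_congr rfl fun i _ => ?_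
      rw [inner_smul_right, ← inner_conj_symm h (u i)]
      simp
    simp_rw [h1]
    rw [← charFun_apply, charFun_complexGaussianVector]
    congr 4
    have h2 : ((‖∑ i, t i • u i‖ ^ 2 : ℝ) : ℂ) = ((‖t‖ ^ 2 : ℝ) : ℂ) := by
      have h3 := inner_self_eq_norm_sq_to_K (𝕜 := ℂ) (∑ i, t i • u i)
      rw [hu.inner_sum] at h3
      rw [EuclideanSpace.norm_sq_eq t]
      push_cast
      refine h3.symm.trans (Finset.sum_congr rfl fun i _ => ?_)
      rw [mul_comm, Complex.mul_conj']
    exact_mod_cast h2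
  have h4 : (complexGaussianVector n).map (fun h => fun i => inner ℂ (u i) h) =
      ((complexGaussianVector n).map (fun h =>
        (WithLp.toLp 2 fun i => inner ℂ (u i) h : EuclideanSpace ℂ (Fin d)))).map WithLp.ofLp := by
    rw [Measure.map_map (by fun_prop) hm]
    rfl
  rw [h4, key, complexGaussianVector, Measure.map_map (by fun_prop) (by fun_prop)]
  exact Measure.map_id

lemma map_inner_unit_complexGaussianVector {n : ℕ} {v : EuclideanSpace ℂ (Fin n)} (hv : ‖v‖ = 1) :
    (complexGaussianVector n).map (fun h => inner ℂ v h) = complexGaussian := by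
  have hu : Orthonormal ℂ (fun _ : Fin 1 => v) :=
    ⟨fun _ => hv, fun i j hij => absurd (Subsingleton.elim i j) hij⟩
  have h1 := (measurePreserving_eval (fun _ : Fin 1 => complexGaussian) 0).map_eq
  rw [← map_inner_complexGaussianVector hu, Measure.map_map (by fun_prop) (by fun_prop)] at h1
  exact h1

/-- The squared norm of the projection of a standard complex Gaussian vector on a subspace of
dimension `d + 1` is a sum of `d + 1` standard exponential variables. -/
lemma lintegral_norm_sq_starProjection {n d : ℕ} {W : Submodule ℂ (EuclideanSpace ℂ (Fin n))}
    (hW : Module.finrank ℂ W = d + 1) {F : ℝ → ℝ≥0∞} (hF : Measurable F) :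
    ∫⁻ h, F (‖W.starProjection h‖ ^ 2) ∂(complexGaussianVector n) =
      ∫⁻ u, F u ∂(erlangMeasure d) := by
  let b : OrthonormalBasis (Fin (d + 1)) ℂ W := (stdOrthonormalBasis ℂ W).reindex (finCongr hW)
  have hu : Orthonormal ℂ (fun i => (b i : EuclideanSpace ℂ (Fin n))) :=
    b.orthonormal.comp_linearIsometry W.subtypeₗᵢ
  have hnorm : ∀ h : EuclideanSpace ℂ (Fin n), ‖W.starProjection h‖ ^ 2 =
      ∑ i, ‖inner ℂ (b i : EuclideanSpace ℂ (Fin n)) h‖ ^ 2 := by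
    intro h
    rw [Submodule.starProjection_apply]
    change ‖W.orthogonalProjectionOnto h‖ ^ 2 = _
    rw [← b.sum_sq_norm_inner_right]
    refine Finset.sum_congr rfl fun i _ => ?_
    rw [Submodule.inner_orthogonalProjectionOnto_eq_of_mem_left]
  simp_rw [hnorm]
  rw [← lintegral_pi_complexGaussian_sum_norm_sq d hF, ← map_inner_complexGaussianVector hu,
    lintegral_map (by fun_prop) (by fun_prop)]

/-! ### Orthogonal projection by the Gram-Schmidt process -/

section LinearAlgebra

variable {ι E : Type*} [NormedAddCommGroup E] [InnerProductSpace ℂ E]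
  [FiniteDimensional ℂ E]

/-- The component of the vector `g a` orthogonal to the span of the vectors `g b`, `b ∈ s`. -/
noncomputable def zeroForcingResidual (s : Finset ι) (a : ι) (g : ι → E) : E :=
  (Submodule.span ℂ (g '' s))ᗮ.starProjection (g a)

/-- The residual is characterized by the orthogonal decomposition of `g a`. -/
lemma zeroForcingResidual_eq {s : Finset ι} {a : ι} {g : ι → E} {V : Submodule ℂ E} {u : E}
    (hV : Submodule.span ℂ (g '' s) = V) (hu : u ∈ Vᗮ) (hgu : g a - u ∈ V) :
    zeroForcingResidual s a g = u := by
  subst hV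
  exact Submodule.eq_starProjection_of_mem_orthogonal hu
    (by rwa [Submodule.orthogonal_orthogonal])

lemma zeroForcingResidual_mem (s : Finset ι) (a : ι) (g : ι → E) :
    zeroForcingResidual s a g ∈ (Submodule.span ℂ (g '' s))ᗮ :=
  Submodule.starProjection_apply_mem _ _

lemma sub_zeroForcingResidual_mem (s : Finset ι) (a : ι) (g : ι → E) :
    g a - zeroForcingResidual s a g ∈ Submodule.span ℂ (g '' s) := by
  have := Submodule.sub_starProjection_mem_orthogonal
    (K := (Submodule.span ℂ (g '' s))ᗮ) (g a)
  rwa [Submodule.orthogonal_orthogonal] at this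

lemma inner_zeroForcingResidual_self (s : Finset ι) (a : ι) (g : ι → E) :
    inner ℂ (zeroForcingResidual s a g) (g a) = ((‖zeroForcingResidual s a g‖ ^ 2 : ℝ) : ℂ) := by
  have h := Submodule.inner_left_of_mem_orthogonal (sub_zeroForcingResidual_mem s a g)
    (zeroForcingResidual_mem s a g)
  rw [inner_sub_right, sub_eq_zero, inner_self_eq_norm_sq_to_K] at h
  rw [h]
  push_cast
  rfl

lemma zeroForcingResidual_empty (a : ι) (g : ι → E) : zeroForcingResidual ∅ a g = g a :=
  zeroForcingResidual_eq (V := ⊥) (by simp) (by simp) (by simp)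

variable [DecidableEq ι]

lemma zeroForcingResidual_congr {s : Finset ι} {a : ι} {g g' : ι → E}
    (hs : ∀ b ∈ insert a s, g b = g' b) :
    zeroForcingResidual s a g = zeroForcingResidual s a g' := by
  have h1 : g '' s = g' '' s :=
    image_congr fun b hb => hs b (Finset.mem_insert_of_mem (Finset.mem_coe.1 hb))
  refine zeroForcingResidual_eq (by rw [h1]) (zeroForcingResidual_mem s a g') ?_
  rw [hs a (Finset.mem_insert_self a s)]
  exact sub_zeroForcingResidual_mem s a g'

/-- One step of the Gram-Schmidt process. If `g b` lies in the span of `s` already, its residual is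
`0` and so is the correction. Through this recursion the residual is a measurable function of the
vectors, without any measurability of projections in terms of the subspace. -/
lemma zeroForcingResidual_insert (s : Finset ι) (a b : ι) (g : ι → E) :
    zeroForcingResidual (insert b s) a g = zeroForcingResidual s a g -
      (inner ℂ (zeroForcingResidual s b g) (zeroForcingResidual s a g) /
        ((‖zeroForcingResidual s b g‖ ^ 2 : ℝ) : ℂ)) • zeroForcingResidual s b g := by
  have hspan : Submodule.span ℂ (g '' (insert b s : Finset ι)) =
      Submodule.span ℂ {g b} ⊔ Submodule.span ℂ (g '' s) := by
    rw [Finset.coe_insert, image_insert_eq, Submodule.span_insert]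
  have huV := zeroForcingResidual_mem s a g
  have hwV := zeroForcingResidual_mem s b g
  have hgu := sub_zeroForcingResidual_mem s a g
  have hgw := sub_zeroForcingResidual_mem s b g
  set V := Submodule.span ℂ (g '' s)
  set u := zeroForcingResidual s a g
  set w := zeroForcingResidual s b g
  set c := inner ℂ w u / ((‖w‖ ^ 2 : ℝ) : ℂ) with hc
  have hr : u - c • w ∈ Vᗮ := Submodule.sub_mem _ huV (Submodule.smul_mem _ _ hwV)
  have hwr : inner ℂ w (u - c • w) = 0 := by
    rw [inner_sub_right, inner_smul_right, inner_self_eq_norm_sq_to_K, hc]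
    by_cases h0 : w = 0
    · simp [h0]
    · have : ((‖w‖ : ℂ)) ≠ 0 := by simpa using h0
      push_cast
      exact sub_eq_zero.2 (div_mul_cancel₀ _ (pow_ne_zero 2 this)).symm
  refine zeroForcingResidual_eq hspan ?_ ?_
  · rw [← Submodule.inf_orthogonal, Submodule.mem_inf]
    refine ⟨?_, hr⟩
    rw [Submodule.mem_orthogonal_singleton_iff_inner_right]
    have h1 := Submodule.inner_right_of_mem_orthogonal hgw hr
    rwa [inner_sub_left, hwr, sub_zero] at h1
  · have hVle : V ≤ Submodule.span ℂ {g b} ⊔ V := le_sup_right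
    have hb : g b ∈ Submodule.span ℂ {g b} ⊔ V :=
      Submodule.mem_sup_left (Submodule.mem_span_singleton_self _)
    have hw : w ∈ Submodule.span ℂ {g b} ⊔ V := by
      simpa using Submodule.sub_mem _ hb (hVle hgw)
    have h2 := Submodule.add_mem _ (hVle hgu) (Submodule.smul_mem _ c hw)
    convert! h2 using 1
    abel

lemma finrank_span_image_insert {s : Finset ι} {a : ι} {g : ι → E}
    (h : zeroForcingResidual s a g ≠ 0) :
    Module.finrank ℂ (Submodule.span ℂ (g '' (insert a s : Finset ι))) =
      Module.finrank ℂ (Submodule.span ℂ (g '' s)) + 1 := by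
  have ha : g a ∉ Submodule.span ℂ (g '' s) := fun ha =>
    h (zeroForcingResidual_eq rfl (Submodule.zero_mem _) (by simpa using ha))
  rw [Finset.coe_insert, image_insert_eq, Submodule.span_insert, sup_comm,
    Submodule.finrank_sup_span_singleton ha]

end LinearAlgebra

/-! ### Zero-forcing of Gaussian vectors -/

section ZeroForcing

variable {ι : Type*} [DecidableEq ι] {n : ℕ}

lemma measurable_zeroForcingResidual (s : Finset ι) (a : ι) :
    Measurable (zeroForcingResidual (E := EuclideanSpace ℂ (Fin n)) s a) := by
  induction s using Finset.induction_on generalizing a with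
  | empty =>
    have : zeroForcingResidual (E := EuclideanSpace ℂ (Fin n)) ∅ a = fun g => g a :=
      funext fun g => zeroForcingResidual_empty a g
    rw [this]
    exact measurable_pi_apply a
  | insert b s hb ih =>
    have : zeroForcingResidual (E := EuclideanSpace ℂ (Fin n)) (insert b s) a = _ :=
      funext fun g => zeroForcingResidual_insert s a b g
    rw [this]
    have h1 := ih a
    have h2 := ih b
    fun_prop

variable {Ω : Type*} [MeasurableSpace Ω] {μ : Measure Ω} [IsProbabilityMeasure μ]
  {g : ι → Ω → EuclideanSpace ℂ (Fin n)}

/-- The squared norm of a Gaussian vector after zero-forcing of `s.card = n - (d + 1)` independent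
Gaussian vectors is a sum of `d + 1` standard exponential variables. -/
lemma lintegral_norm_sq_zeroForcingResidual (hg : ∀ i, Measurable (g i))
    (hlaw : ∀ i, HasLaw (g i) (complexGaussianVector n) μ) (hind : iIndepFun g μ) {s : Finset ι}
    {a : ι} (ha : a ∉ s) {d : ℕ} (hd : s.card + d + 1 = n)
    (hrank : ∀ᵐ ω ∂μ, Module.finrank ℂ (Submodule.span ℂ ((fun i => g i ω) '' s)) = s.card)
    {F : ℝ → ℝ≥0∞} (hF : Measurable F) :
    ∫⁻ ω, F (‖zeroForcingResidual s a (fun i => g i ω)‖ ^ 2) ∂μ =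
      ∫⁻ u, F u ∂(erlangMeasure d) := by
  -- the residual depends on the vectors indexed by `insert a s` only; `ext` fills in the others
  let ext : (s → EuclideanSpace ℂ (Fin n)) → EuclideanSpace ℂ (Fin n) →
      ι → EuclideanSpace ℂ (Fin n) := fun x w i => if hi : i ∈ s then x ⟨i, hi⟩ else w
  have hext : Measurable (Function.uncurry ext) := by
    refine measurable_pi_iff.2 fun i => ?_
    by_cases hi : i ∈ s
    · simp only [Function.uncurry_def, ext, hi, dite_true]
      fun_prop
    · simp only [Function.uncurry_def, ext, hi, dite_false]
      fun_prop
  let f : (s → EuclideanSpace ℂ (Fin n)) → EuclideanSpace ℂ (Fin n) → ℝ≥0∞ := fun x w =>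
    F (‖zeroForcingResidual s a (ext x w)‖ ^ 2)
  have hf : Measurable (Function.uncurry f) :=
    hF.comp (((measurable_zeroForcingResidual s a).comp hext).norm.pow_const 2)
  have hi : IndepFun (fun ω (i : s) => g i ω) (g a) μ := by
    have h1 := hind.indepFun_finset s {a} (by simp [ha]) hg
    exact h1.comp (φ := id) (ψ := fun x : ({a} : Finset ι) → _ => x ⟨a, by simp⟩)
      measurable_id (measurable_pi_apply _)
  have h1 := lintegral_prodMk_eq_of_indepFun hi (measurable_pi_lambda _ fun i => hg i) (hg a) hf
  have h2 : ∀ ω, f (fun i => g i ω) (g a ω) =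
      F (‖zeroForcingResidual s a (fun i => g i ω)‖ ^ 2) := by
    intro ω
    simp only [f]
    rw [zeroForcingResidual_congr (g' := fun i => g i ω)]
    intro b hb
    rcases Finset.mem_insert.1 hb with rfl | hb
    · simp [ext, ha]
    · simp [ext, hb]
  simp_rw [h2] at h1
  rw [h1, (hlaw a).map_eq]
  have h3 : ∀ᵐ ω ∂μ, ∫⁻ w, f (fun i => g i ω) w ∂(complexGaussianVector n) =
      ∫⁻ u, F u ∂(erlangMeasure d) := by
    filter_upwards [hrank] with ω hω
    set V := Submodule.span ℂ ((fun i => g i ω) '' s) with hV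
    have hfin : Module.finrank ℂ Vᗮ = d + 1 := by
      have := V.finrank_add_finrank_orthogonal
      rw [finrank_euclideanSpace_fin] at this
      omega
    rw [← lintegral_norm_sq_starProjection hfin hF]
    refine lintegral_congr fun w => ?_
    simp only [f]
    congr 3
    have hext' : Submodule.span ℂ (ext (fun i => g i ω) w '' s) = V := by
      rw [hV]
      congr 1
      refine image_congr fun b hb => ?_
      simp [ext, Finset.mem_coe.1 hb]
    refine zeroForcingResidual_eq hext' (Submodule.starProjection_apply_mem _ _) ?_
    simp [ext, ha]
  rw [lintegral_congr_ae h3]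
  simp

/-- An Erlang variable is almost surely not `0`. -/
lemma ae_zeroForcingResidual_ne_zero (hg : ∀ i, Measurable (g i))
    (hlaw : ∀ i, HasLaw (g i) (complexGaussianVector n) μ) (hind : iIndepFun g μ) {s : Finset ι}
    {a : ι} (ha : a ∉ s) (hd : s.card < n)
    (hrank : ∀ᵐ ω ∂μ, Module.finrank ℂ (Submodule.span ℂ ((fun i => g i ω) '' s)) = s.card) :
    ∀ᵐ ω ∂μ, zeroForcingResidual s a (fun i => g i ω) ≠ 0 := by
  obtain ⟨d, hd'⟩ := Nat.exists_eq_add_of_lt hd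
  have h1 := lintegral_norm_sq_zeroForcingResidual hg hlaw hind ha hd'.symm hrank
    (F := ({0} : Set ℝ).indicator 1) (measurable_one.indicator (measurableSet_singleton _))
  have h2 : ∫⁻ u, ({0} : Set ℝ).indicator 1 u ∂(erlangMeasure d) = 0 := by
    rw [lintegral_indicator_one (measurableSet_singleton _)]
    exact withDensity_absolutelyContinuous _ _ (by simp)
  rw [h2] at h1
  have hm : Measurable fun ω => ({0} : Set ℝ).indicator (1 : ℝ → ℝ≥0∞)
      (‖zeroForcingResidual s a (fun i => g i ω)‖ ^ 2) :=
    (measurable_one.indicator (measurableSet_singleton _)).comp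
      (((measurable_zeroForcingResidual s a).comp
        (measurable_pi_lambda _ fun i => hg i)).norm.pow_const 2)
  filter_upwards [(lintegral_eq_zero_iff hm).1 h1] with ω hω h0
  simp [h0] at hω

/-- At most `n` independent Gaussian vectors in `ℂⁿ` are almost surely linearly independent. -/
lemma ae_finrank_span_eq_card (hg : ∀ i, Measurable (g i))
    (hlaw : ∀ i, HasLaw (g i) (complexGaussianVector n) μ) (hind : iIndepFun g μ) (s : Finset ι)
    (hs : s.card ≤ n) :
    ∀ᵐ ω ∂μ, Module.finrank ℂ (Submodule.span ℂ ((fun i => g i ω) '' s)) = s.card := by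
  induction s using Finset.induction_on with
  | empty => simp
  | insert a s ha ih =>
    rw [Finset.card_insert_of_notMem ha] at hs
    have h1 := ih (by omega)
    filter_upwards [h1, ae_zeroForcingResidual_ne_zero hg hlaw hind ha (by omega) h1]
      with ω hω h0
    rw [finrank_span_image_insert h0, hω, Finset.card_insert_of_notMem ha]

end ZeroForcing

/-! ### Independence of disjoint blocks of variables -/

lemma MeasurableSpace.comap_pi_le_iSup {Ω ι κ : Type*} {A : ι → Type*}
    [∀ i, MeasurableSpace (A i)] (f : ∀ i, Ω → A i) (S : κ → ι) :
    MeasurableSpace.comap (fun ω i => f (S i) ω) MeasurableSpace.pi ≤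
      ⨆ i ∈ range S, MeasurableSpace.comap (f i) inferInstance := by
  refine measurable_iff_comap_le.1 (@measurable_pi_lambda _ _ _ (_) _ _ fun i => ?_)
  refine measurable_iff_comap_le.2 ?_
  exact le_iSup₂ (f := fun i (_ : i ∈ range S) => MeasurableSpace.comap (f i) inferInstance)
    (S i) (mem_range_self i)

lemma ProbabilityTheory.iIndepFun.indepFun_comp_of_disjoint {Ω ι κ κ' : Type*} {A : ι → Type*}
    [MeasurableSpace Ω] [∀ i, MeasurableSpace (A i)] {μ : Measure Ω} {f : ∀ i, Ω → A i}
    (hind : iIndepFun f μ) (hf : ∀ i, Measurable (f i)) {S : κ → ι} {T : κ' → ι}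
    (hST : Disjoint (range S) (range T)) :
    IndepFun (fun ω i => f (S i) ω) (fun ω j => f (T j) ω) μ := by
  have h1 := indep_iSup_of_disjoint (fun i => (hf i).comap_le) hind hST
  exact indep_of_indep_of_le_left
    (indep_of_indep_of_le_right h1 (MeasurableSpace.comap_pi_le_iSup f T))
    (MeasurableSpace.comap_pi_le_iSup f S)

/-! ### The law of the receiver outputs -/

section Receiver

variable {Nt Nr m : ℕ}

lemma cancelledSpan_eq_span_image (hm : 1 ≤ m) (k : Fin Nt)
    (g : ℕ → Fin Nt → EuclideanSpace ℂ (Fin Nr)) :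
    cancelledSpan m k g = Submodule.span ℂ ((fun p : ℕ × Fin Nt => g p.1 p.2) ''
      ((Finset.range m ×ˢ Finset.univ).erase (0, k) : Finset (ℕ × Fin Nt))) := by
  rw [cancelledSpan]
  congr 1
  ext w
  simp only [mem_union, mem_ofPred_eq, Finset.coe_erase, Finset.coe_product, Finset.coe_range,
    Finset.coe_univ, mem_image, Set.mem_sdiff, mem_prod, mem_Iio, mem_univ, and_true,
    mem_singleton_iff, Prod.exists, Prod.mk.injEq, not_and]
  constructor
  · rintro (⟨q, hq, rfl⟩ | ⟨i, hi, him, q, rfl⟩)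
    · exact ⟨0, q, ⟨by omega, fun _ => hq⟩, rfl⟩
    · exact ⟨i, q, ⟨by omega, fun h => by omega⟩, rfl⟩
  · rintro ⟨i, q, ⟨hi, hq⟩, rfl⟩
    rcases Nat.eq_zero_or_pos i with rfl | h0
    · exact Or.inl ⟨q, hq rfl, rfl⟩
    · exact Or.inr ⟨i, h0, by omega, q, rfl⟩

/-- The filter normalizes the residual of the desired channel against the `m * Nt - 1` other
channels of the `m` nearest base stations. -/
lemma pzfFilter_eq (hm : 1 ≤ m) (k : Fin Nt) (g : ℕ → Fin Nt → EuclideanSpace ℂ (Fin Nr)) :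
    pzfFilter m k g =
      ((‖zeroForcingResidual ((Finset.range m ×ˢ Finset.univ).erase (0, k)) (0, k)
        (fun p : ℕ × Fin Nt => g p.1 p.2)‖⁻¹ : ℝ) : ℂ) •
        zeroForcingResidual ((Finset.range m ×ˢ Finset.univ).erase (0, k)) (0, k)
          (fun p : ℕ × Fin Nt => g p.1 p.2) := by
  have h : zeroForcingResidual ((Finset.range m ×ˢ Finset.univ).erase (0, k)) (0, k)
      (fun p : ℕ × Fin Nt => g p.1 p.2) = (cancelledSpan m k g)ᗮ.starProjection (g 0 k) := by
    refine zeroForcingResidual_eq (cancelledSpan_eq_span_image hm k g).symm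
      (Submodule.starProjection_apply_mem _ _) ?_
    have := Submodule.sub_starProjection_mem_orthogonal (K := (cancelledSpan m k g)ᗮ) (g 0 k)
    rwa [Submodule.orthogonal_orthogonal] at this
  rw [h, pzfFilter]

variable {Ω A : Type*} [MeasurableSpace Ω] [MeasurableSpace A] {μ : Measure Ω}
  [IsProbabilityMeasure μ]

/-- The signal power, the receiver outputs of the interferers that are not cancelled, and anything
independent of the channels (the base stations) are independent; the signal power has an Erlang
law, and the outputs are independent standard complex Gaussian variables. -/
lemma lintegral_pzf_outputs {δ : ℕ} (hm : 1 ≤ m) (hNr : Nr = m * Nt + δ) (k : Fin Nt)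
    {X : Ω → A} (hX : Measurable X)
    {h : ℕ → Fin Nt → Ω → EuclideanSpace ℂ (Fin Nr)} (hh : ∀ i q, Measurable (h i q))
    (hlaw : ∀ i q, HasLaw (h i q) (complexGaussianVector Nr) μ)
    (hindep : iIndepFun (fun p : ℕ × Fin Nt => h p.1 p.2) μ)
    (hXh : IndepFun X (fun ω (i : ℕ) (q : Fin Nt) => h i q ω) μ)
    {f : A → ℝ → (ℕ × Fin Nt → ℂ) → ℝ≥0∞}
    (hf : Measurable fun p : A × ℝ × (ℕ × Fin Nt → ℂ) => f p.1 p.2.1 p.2.2) :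
    ∫⁻ ω, f (X ω) (‖inner ℂ (pzfFilter m k fun i q => h i q ω) (h 0 k ω)‖ ^ 2)
        (fun p => inner ℂ (pzfFilter m k fun i q => h i q ω) (h (m + p.1) p.2 ω)) ∂μ =
      ∫⁻ ω, ∫⁻ w, ∫⁻ u, f (X ω) u w ∂(erlangMeasure δ)
        ∂(Measure.infinitePi fun _ : ℕ × Fin Nt => complexGaussian) ∂μ := by
  set B : Finset (ℕ × Fin Nt) := Finset.range m ×ˢ Finset.univ with hB
  set a : ℕ × Fin Nt := (0, k) with ha
  have haB : a ∈ B := by simp [hB, ha]; omega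
  let g : ℕ × Fin Nt → Ω → EuclideanSpace ℂ (Fin Nr) := fun p => h p.1 p.2
  have hg : ∀ p, Measurable (g p) := fun p => hh _ _
  -- the filter is a function of the channels indexed by `B`, those of the `m` nearest base stations
  let ext : (B → EuclideanSpace ℂ (Fin Nr)) → ℕ × Fin Nt → EuclideanSpace ℂ (Fin Nr) :=
    fun x p => if hp : p ∈ B then x ⟨p, hp⟩ else 0
  have hext : Measurable ext := by
    refine measurable_pi_iff.2 fun p => ?_
    by_cases hp : p ∈ B
    · simp only [ext, hp, dite_true]
      fun_prop
    · simp only [ext, hp, dite_false]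
      fun_prop
  let P : (B → EuclideanSpace ℂ (Fin Nr)) → EuclideanSpace ℂ (Fin Nr) :=
    fun x => zeroForcingResidual (B.erase a) a (ext x)
  have hP : Measurable P := (measurable_zeroForcingResidual _ _).comp hext
  let V : (B → EuclideanSpace ℂ (Fin Nr)) → EuclideanSpace ℂ (Fin Nr) :=
    fun x => ((‖P x‖⁻¹ : ℝ) : ℂ) • P x
  have hV : Measurable V := by fun_prop
  let N : Ω → B → EuclideanSpace ℂ (Fin Nr) := fun ω p => g p ω
  have hN : Measurable N := measurable_pi_lambda _ fun p => hg _
  let R : Ω → ℕ × Fin Nt → EuclideanSpace ℂ (Fin Nr) := fun ω p => g (m + p.1, p.2) ω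
  have hR : Measurable R := measurable_pi_lambda _ fun p => hg _
  have hPN : ∀ ω, P (N ω) = zeroForcingResidual (B.erase a) a (fun p => g p ω) := by
    intro ω
    refine zeroForcingResidual_congr fun b hb => ?_
    rw [Finset.insert_erase haB] at hb
    simp [ext, hb, N]
  have hVN : ∀ ω, pzfFilter m k (fun i q => h i q ω) = V (N ω) := by
    intro ω
    rw [pzfFilter_eq hm k]
    simp only [V, hPN]
    rfl
  have hS : ∀ ω, ‖inner ℂ (pzfFilter m k fun i q => h i q ω) (h 0 k ω)‖ ^ 2 = ‖P (N ω)‖ ^ 2 := by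
    intro ω
    have h1 : inner ℂ (P (N ω)) (h 0 k ω) = ((‖P (N ω)‖ ^ 2 : ℝ) : ℂ) := by
      rw [hPN]
      exact inner_zeroForcingResidual_self _ _ _
    rw [hVN, inner_smul_left, h1, Complex.conj_ofReal, ← Complex.ofReal_mul, Complex.norm_real,
      Real.norm_eq_abs, sq_abs]
    by_cases h0 : ‖P (N ω)‖ = 0
    · simp [h0]
    · field_simp
  -- the law of the channels of the interferers that are not cancelled
  have hinj : Function.Injective fun p : ℕ × Fin Nt => (m + p.1, p.2) := by
    rintro ⟨i, q⟩ ⟨j, r⟩ hij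
    simpa using hij
  have hRlaw : μ.map R = Measure.infinitePi fun _ => complexGaussianVector Nr :=
    ((hindep.precomp hinj).hasLaw_infinitePi (fun p => hlaw _ _) hR.aemeasurable).map_eq
  have hNR : IndepFun N R μ := by
    refine hindep.indepFun_comp_of_disjoint hg (S := fun p : B => (p : ℕ × Fin Nt))
      (T := fun p : ℕ × Fin Nt => (m + p.1, p.2)) ?_
    rw [Set.disjoint_left]
    rintro _ ⟨⟨p, hp⟩, rfl⟩ ⟨q, hq⟩
    have h1 : p.1 < m := by simpa [hB] using hp
    have h2 : m + q.1 = p.1 := congrArg Prod.fst hq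
    omega
  have hXNR : IndepFun X (fun ω => (N ω, R ω)) μ := by
    have h1 : Measurable fun (y : ℕ → Fin Nt → EuclideanSpace ℂ (Fin Nr)) =>
        ((fun p : B => y (p : ℕ × Fin Nt).1 (p : ℕ × Fin Nt).2),
          fun p : ℕ × Fin Nt => y (m + p.1) p.2) := by fun_prop
    exact hXh.comp measurable_id h1
  -- the law of the signal power
  have hcard : (B.erase a).card + δ + 1 = Nr := by
    rw [Finset.card_erase_of_mem haB, hB, Finset.card_product, Finset.card_range,
      Finset.card_univ, Fintype.card_fin, hNr]
    have : 0 < m * Nt := Nat.mul_pos hm k.pos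
    omega
  have hrank := ae_finrank_span_eq_card hg (fun p => hlaw _ _) hindep (B.erase a) (by omega)
  have hSlaw : ∀ F : ℝ → ℝ≥0∞, Measurable F →
      ∫⁻ x, F (‖P x‖ ^ 2) ∂(μ.map N) = ∫⁻ u, F u ∂(erlangMeasure δ) := by
    intro F hF
    rw [lintegral_map (by fun_prop) hN, ← lintegral_norm_sq_zeroForcingResidual hg
      (fun p => hlaw _ _) hindep (Finset.notMem_erase a B) hcard hrank hF]
    simp_rw [hPN]
  have hunit : ∀ᵐ x ∂(μ.map N), ‖V x‖ = 1 := by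
    rw [ae_map_iff hN.aemeasurable (measurableSet_eq_fun (by fun_prop) (by fun_prop))]
    filter_upwards [ae_zeroForcingResidual_ne_zero hg (fun p => hlaw _ _) hindep
      (Finset.notMem_erase a B) (by omega) hrank] with ω hω
    rw [← hPN] at hω
    have : ‖P (N ω)‖ ≠ 0 := by simpa using hω
    simp only [V, norm_smul, Complex.norm_real, norm_inv, norm_norm]
    field_simp
  have hpN := Measure.isProbabilityMeasure_map (μ := μ) hN.aemeasurable
  have hf1 : Measurable (Function.uncurry fun (x : A)
      (y : (B → EuclideanSpace ℂ (Fin Nr)) × (ℕ × Fin Nt → EuclideanSpace ℂ (Fin Nr))) =>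
      f x (‖P y.1‖ ^ 2) (fun p => inner ℂ (V y.1) (y.2 p))) :=
    hf.comp (g := fun p : A × ℝ × (ℕ × Fin Nt → ℂ) => f p.1 p.2.1 p.2.2)
      (f := fun q : A × (B → EuclideanSpace ℂ (Fin Nr)) × (ℕ × Fin Nt → EuclideanSpace ℂ (Fin Nr)) =>
        (q.1, ‖P q.2.1‖ ^ 2, fun p => inner ℂ (V q.2.1) (q.2.2 p))) (by fun_prop)
  have h1 := lintegral_prodMk_eq_of_indepFun hXNR hX (hN.prodMk hR) hf1
  simp_rw [hS, hVN]
  refine h1.trans (lintegral_congr fun ω => ?_)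
  have hf4 : Measurable fun y : (B → EuclideanSpace ℂ (Fin Nr)) ×
      (ℕ × Fin Nt → EuclideanSpace ℂ (Fin Nr)) =>
      f (X ω) (‖P y.1‖ ^ 2) (fun p => inner ℂ (V y.1) (y.2 p)) :=
    hf1.comp (measurable_prodMk_left (x := X ω))
  rw [(indepFun_iff_map_prod_eq_prod_map_map hN.aemeasurable hR.aemeasurable).1 hNR, hRlaw,
    lintegral_prod _ hf4.aemeasurable]
  have hf2 : ∀ u, Measurable fun w => f (X ω) u w := fun u => hf.comp
    (f := fun w : ℕ × Fin Nt → ℂ => (X ω, u, w)) (by fun_prop)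
  have hf3 : Measurable fun q : ℝ × (ℕ × Fin Nt → ℂ) => f (X ω) q.1 q.2 := hf.comp
    (f := fun q : ℝ × (ℕ × Fin Nt → ℂ) => (X ω, q.1, q.2)) (by fun_prop)
  calc ∫⁻ x, ∫⁻ y, f (X ω) (‖P x‖ ^ 2) (fun p => inner ℂ (V x) (y p))
        ∂(Measure.infinitePi fun _ => complexGaussianVector Nr) ∂(μ.map N)
      = ∫⁻ x, ∫⁻ w, f (X ω) (‖P x‖ ^ 2) w
        ∂(Measure.infinitePi fun _ => complexGaussian) ∂(μ.map N) := by
        -- rotation invariance: the outputs of the far channels have the same law for every filter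
        refine lintegral_congr_ae ?_
        filter_upwards [hunit] with x hx
        have h2 := Measure.infinitePi_map_pi (μ := fun _ : ℕ × Fin Nt => complexGaussianVector Nr)
          (f := fun _ y => inner ℂ (V x) y) (by fun_prop)
        simp_rw [map_inner_unit_complexGaussianVector hx] at h2
        rw [← h2, lintegral_map (hf2 _) (by fun_prop)]
    _ = ∫⁻ w, ∫⁻ x, f (X ω) (‖P x‖ ^ 2) w ∂(μ.map N)
        ∂(Measure.infinitePi fun _ => complexGaussian) := by
        refine lintegral_lintegral_swap ?_
        exact (hf3.comp (f := fun q : (B → EuclideanSpace ℂ (Fin Nr)) × (ℕ × Fin Nt → ℂ) =>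
            (‖P q.1‖ ^ 2, q.2))
          (by fun_prop)).aemeasurable
    _ = _ := by
        refine lintegral_congr fun w => ?_
        exact hSlaw (fun u => f (X ω) u w) (hf3.comp (f := fun u : ℝ => (u, w)) (by fun_prop))

end Receiver

/-! ### The Laplace transform of the residual interference -/

/-- The residual interference as a function of the distances `ρ i` of the base stations and of the
receiver outputs `w (j, q)` caused by the streams of the base station at distance `ρ (m + j)`. -/
noncomputable def shotNoise {Nt : ℕ} (α : ℝ) (m : ℕ) (ρ : ℕ → ℝ) (w : ℕ × Fin Nt → ℂ) : ℝ≥0∞ :=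
  ∑' j : ℕ, ENNReal.ofReal (ρ (m + j) ^ (-α) * ∑ q, ‖w (j, q)‖ ^ 2)

lemma measurable_shotNoise {Nt : ℕ} (α : ℝ) (m : ℕ) :
    Measurable fun p : (ℕ → ℝ) × (ℕ × Fin Nt → ℂ) => shotNoise α m p.1 p.2 := by
  unfold shotNoise
  fun_prop

lemma lintegral_complexGaussian_exp {c : ℝ} (hc : 0 ≤ c) :
    ∫⁻ z, ENNReal.ofReal (Real.exp (-(c * ‖z‖ ^ 2))) ∂complexGaussian =
      ENNReal.ofReal (1 + c)⁻¹ := by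
  rw [lintegral_complexGaussian_norm_sq (F := fun u => ENNReal.ofReal (Real.exp (-(c * u))))
    (by fun_prop), lintegral_expMeasure_one (by fun_prop)]
  have h1 : ∀ t : ℝ, ENNReal.ofReal (Real.exp (-t)) * ENNReal.ofReal (Real.exp (-(c * t))) =
      ENNReal.ofReal (Real.exp (-(1 + c) * t)) := by
    intro t
    rw [← ENNReal.ofReal_mul (Real.exp_pos _).le, ← Real.exp_add]
    congr 2
    ring
  simp_rw [h1]
  have hc' : -(1 + c) < 0 := by linarith
  rw [← ofReal_integral_eq_lintegral_ofReal (integrableOn_exp_mul_Ioi hc' 0)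
    (Eventually.of_forall fun _ => (Real.exp_pos _).le), integral_exp_mul_Ioi hc']
  congr 1
  simp only [mul_zero, Real.exp_zero]
  rw [neg_div_neg_eq, one_div]

/-- Each of the `Nt` streams of an interferer contributes an independent exponential variable to the
received power. -/
lemma lintegral_infinitePi_exp_sum {Nt : ℕ} {c : ℕ → ℝ} (hc : ∀ j, 0 ≤ c j) (n : ℕ) :
    ∫⁻ w, ENNReal.ofReal (Real.exp (-∑ j ∈ Finset.range n, c j * ∑ q, ‖w (j, q)‖ ^ 2))
        ∂(Measure.infinitePi fun _ : ℕ × Fin Nt => complexGaussian) =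
      ∏ j ∈ Finset.range n, ENNReal.ofReal (((1 + c j)⁻¹) ^ Nt) := by
  have h1 := iIndepFun_infinitePi (P := fun _ : ℕ × Fin Nt => complexGaussian)
    (X := fun p z => ENNReal.ofReal (Real.exp (-(c p.1 * ‖z‖ ^ 2)))) (by fun_prop)
  have h2 := lintegral_prod_eq_prod_lintegral_of_indepFun (Finset.range n ×ˢ Finset.univ) _ h1
    (by fun_prop)
  have h3 : ∀ p : ℕ × Fin Nt, ∫⁻ w, ENNReal.ofReal (Real.exp (-(c p.1 * ‖w p‖ ^ 2)))
      ∂(Measure.infinitePi fun _ : ℕ × Fin Nt => complexGaussian) =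
      ENNReal.ofReal (1 + c p.1)⁻¹ := by
    intro p
    have h4 := lintegral_map (μ := Measure.infinitePi fun _ : ℕ × Fin Nt => complexGaussian)
      (f := fun z : ℂ => ENNReal.ofReal (Real.exp (-(c p.1 * ‖z‖ ^ 2))))
      (g := fun w : ℕ × Fin Nt → ℂ => w p) (by fun_prop) (by fun_prop)
    rw [Measure.infinitePi_map_eval, lintegral_complexGaussian_exp (hc p.1)] at h4
    exact h4.symm
  calc ∫⁻ w, ENNReal.ofReal (Real.exp (-∑ j ∈ Finset.range n, c j * ∑ q, ‖w (j, q)‖ ^ 2))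
        ∂(Measure.infinitePi fun _ : ℕ × Fin Nt => complexGaussian)
      = ∫⁻ w, ∏ p ∈ Finset.range n ×ˢ Finset.univ,
          ENNReal.ofReal (Real.exp (-(c p.1 * ‖w p‖ ^ 2)))
          ∂(Measure.infinitePi fun _ : ℕ × Fin Nt => complexGaussian) := by
        refine lintegral_congr fun w => ?_
        rw [← ENNReal.ofReal_prod_of_nonneg (fun _ _ => (Real.exp_pos _).le), ← Real.exp_sum,
          Finset.sum_neg_distrib, Finset.sum_product]
        simp_rw [Finset.mul_sum]
    _ = ∏ p ∈ Finset.range n ×ˢ (Finset.univ : Finset (Fin Nt)), ENNReal.ofReal (1 + c p.1)⁻¹ := by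
        rw [h2]
        exact Finset.prod_congr rfl fun p _ => h3 p
    _ = _ := by
        rw [Finset.prod_product]
        refine Finset.prod_congr rfl fun j _ => ?_
        have : 0 ≤ (1 + c j)⁻¹ := inv_nonneg.2 (by linarith [hc j])
        dsimp only
        rw [Finset.prod_const, Finset.card_univ, Fintype.card_fin, ENNReal.ofReal_pow this]

section

variable {Nt : ℕ} {α : ℝ} {m : ℕ} {ρ : ℕ → ℝ} {w : ℕ × Fin Nt → ℂ}

/-- The contribution of the first `n` interferers that are not cancelled. -/
noncomputable def partialShotNoise (α : ℝ) (m : ℕ) (ρ : ℕ → ℝ) (w : ℕ × Fin Nt → ℂ) (n : ℕ) : ℝ :=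
  ∑ j ∈ Finset.range n, ρ (m + j) ^ (-α) * ∑ q, ‖w (j, q)‖ ^ 2

lemma measurable_partialShotNoise (n : ℕ) : Measurable fun p : (ℕ → ℝ) × (ℕ × Fin Nt → ℂ) =>
    partialShotNoise α m p.1 p.2 n := by
  unfold partialShotNoise
  fun_prop

lemma partialShotNoise_nonneg (hρ : ∀ i, 0 ≤ ρ i) (n : ℕ) : 0 ≤ partialShotNoise α m ρ w n :=
  Finset.sum_nonneg fun _ _ => mul_nonneg (Real.rpow_nonneg (hρ _) _)
    (Finset.sum_nonneg fun _ _ => sq_nonneg _)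

lemma tendsto_ofReal_partialShotNoise (hρ : ∀ i, 0 ≤ ρ i) :
    Tendsto (fun n => ENNReal.ofReal (partialShotNoise α m ρ w n)) atTop
      (𝓝 (shotNoise α m ρ w)) := by
  have h1 := (ENNReal.summable (f := fun j : ℕ =>
    ENNReal.ofReal (ρ (m + j) ^ (-α) * ∑ q, ‖w (j, q)‖ ^ 2))).hasSum.tendsto_sum_nat
  refine h1.congr fun n => ?_
  rw [partialShotNoise, ENNReal.ofReal_sum_of_nonneg]
  exact fun _ _ => mul_nonneg (Real.rpow_nonneg (hρ _) _) (Finset.sum_nonneg fun _ _ => sq_nonneg _)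

/-- For `s > 0` the limit is `0` where the shot noise is infinite, while `toReal` would turn an
infinite shot noise into `exp 0 = 1`. -/
lemma tendsto_exp_partialShotNoise (hρ : ∀ i, 0 ≤ ρ i) {s : ℝ} (hs : 0 < s) :
    Tendsto (fun n => Real.exp (-(s * partialShotNoise α m ρ w n))) atTop
      (𝓝 (if shotNoise α m ρ w = ∞ then 0 else Real.exp (-(s * (shotNoise α m ρ w).toReal)))) := by
  have h1 := tendsto_ofReal_partialShotNoise (α := α) (m := m) (w := w) hρ
  split_ifs with h
  · rw [h] at h1
    refine Real.tendsto_exp_neg_atTop_nhds_zero.comp (Tendsto.const_mul_atTop hs ?_)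
    refine tendsto_atTop.2 fun b => ?_
    filter_upwards [(tendsto_order.1 h1).1 (ENNReal.ofReal b) ENNReal.ofReal_lt_top] with n hn
    exact (ENNReal.ofReal_lt_ofReal_iff'.1 hn).1.le
  · have h2 := (ENNReal.tendsto_toReal h).comp h1
    have h3 : Tendsto (fun n => partialShotNoise α m ρ w n) atTop
        (𝓝 (shotNoise α m ρ w).toReal) :=
      h2.congr fun n => ENNReal.toReal_ofReal (partialShotNoise_nonneg hρ n)
    exact (Real.continuous_exp.tendsto _).comp (h3.const_mul s).neg

lemma lintegral_exp_partialShotNoise {lam s : ℝ} (hlam : 0 < lam) (hs : 0 ≤ s)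
    (hρ : ∀ i, 0 ≤ ρ i) (n : ℕ) :
    ∫⁻ w, ENNReal.ofReal (Real.exp (-(s * partialShotNoise α m ρ w n)))
        ∂(Measure.infinitePi fun _ : ℕ × Fin Nt => complexGaussian) =
      ∏ j ∈ Finset.range n,
        ENNReal.ofReal (fadingFactor lam α Nt s (lam * Real.pi * ρ (m + j) ^ 2)) := by
  have h1 := lintegral_infinitePi_exp_sum (Nt := Nt) (c := fun j => s * ρ (m + j) ^ (-α))
    (fun j => mul_nonneg hs (Real.rpow_nonneg (hρ _) _)) n
  have hc : lam * Real.pi ≠ 0 := by positivity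
  have h2 : ∀ j, fadingFactor lam α Nt s (lam * Real.pi * ρ (m + j) ^ 2) =
      ((1 + s * ρ (m + j) ^ (-α))⁻¹) ^ Nt := by
    intro j
    rw [fadingFactor, mul_div_cancel_left₀ _ hc, ← Real.rpow_natCast_mul (hρ _)]
    congr 5
    push_cast
    ring
  simp_rw [h2]
  rw [← h1]
  refine lintegral_congr fun w => ?_
  rw [partialShotNoise, Finset.mul_sum]
  simp_rw [mul_assoc]

end

section

variable {Ω : Type*} [MeasurableSpace Ω] {C : Set ℝ → Ω → ℕ∞} {μ : Measure Ω}
  [IsProbabilityMeasure μ] {ρ : ℕ → Ω → ℝ} {lam α : ℝ} {Nt m : ℕ}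

/-- The martingale of the Laplace functional, with the fading factors written as the means over the
fading. The weight `Ψ` runs over the functions of the conditioning variables `(r, R)`. -/
lemma lintegral_exp_partialShotNoise_mul_tailLaplace (hlam : 0 < lam) (hα : 2 < α) (hN : 1 ≤ Nt)
    (hm : 1 ≤ m) (hρm : ∀ i, Measurable (ρ i)) (hρ : ∀ i ω, 0 ≤ ρ i ω)
    (h : IsPoissonArrivals (fun i ω => lam * Real.pi * ρ i ω ^ 2) C μ) {s : ℝ} (hs : 0 ≤ s)
    {Ψ : ℝ → ℝ → ℝ≥0∞} (hΨ : Measurable (Function.uncurry Ψ)) (n : ℕ) :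
    ∫⁻ p, Ψ (ρ 0 p.1) (ρ (m - 1) p.1) *
        (ENNReal.ofReal (Real.exp (-(s * partialShotNoise α m (fun i => ρ i p.1) p.2 n))) *
          ENNReal.ofReal (tailLaplace lam α Nt s (lam * Real.pi * ρ (m - 1 + n) p.1 ^ 2)))
        ∂(μ.prod (Measure.infinitePi fun _ : ℕ × Fin Nt => complexGaussian)) =
      ∫⁻ ω, Ψ (ρ 0 ω) (ρ (m - 1) ω) *
        ENNReal.ofReal (interferenceLaplace lam α Nt (ρ (m - 1) ω) s) ∂μ := by
  have hc : 0 < lam * Real.pi := by positivity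
  have hroot : ∀ x : ℝ, 0 ≤ x → Real.sqrt (lam * Real.pi * x ^ 2 / (lam * Real.pi)) = x := by
    intro x hx
    rw [mul_div_cancel_left₀ _ hc.ne', Real.sqrt_sq hx]
  have htm := measurable_tailLaplace (N := Nt) hlam hα hN hs
  have hΨ' : Measurable (Function.uncurry fun a b => Ψ (Real.sqrt (a / (lam * Real.pi)))
      (Real.sqrt (b / (lam * Real.pi)))) := hΨ.comp (f := fun q : ℝ × ℝ =>
      (Real.sqrt (q.1 / (lam * Real.pi)), Real.sqrt (q.2 / (lam * Real.pi)))) (by fun_prop)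
  have h1 := h.lintegral_mul_prod_fadingFactor hlam hα hN hs hΨ' (m - 1) n
  simp only [hroot _ (hρ _ _), tailLaplace] at h1
  have hpm : Measurable fun p : Ω × (ℕ × Fin Nt → ℂ) =>
      partialShotNoise α m (fun i => ρ i p.1) p.2 n :=
    (measurable_partialShotNoise n).comp (f := fun p : Ω × (ℕ × Fin Nt → ℂ) =>
      ((fun i => ρ i p.1), p.2)) (by fun_prop)
  have hΨm : Measurable fun p : Ω × (ℕ × Fin Nt → ℂ) => Ψ (ρ 0 p.1) (ρ (m - 1) p.1) :=
    hΨ.comp (f := fun p : Ω × (ℕ × Fin Nt → ℂ) => (ρ 0 p.1, ρ (m - 1) p.1)) (by fun_prop)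
  rw [lintegral_prod _ (by fun_prop), ← h1]
  refine lintegral_congr fun ω => ?_
  have hpm' : Measurable fun w : ℕ × Fin Nt → ℂ =>
      partialShotNoise α m (fun i => ρ i ω) w n := hpm.comp measurable_prodMk_left
  simp only
  rw [lintegral_const_mul _ (by fun_prop), lintegral_mul_const _ (by fun_prop),
    lintegral_exp_partialShotNoise hlam hs (fun i => hρ i ω), ← Fin.prod_univ_eq_prod_range
      (fun j => ENNReal.ofReal (fadingFactor lam α Nt s (lam * Real.pi * ρ (m + j) ω ^ 2)))]
  rw [tailLaplace, hroot _ (hρ _ _), show m - 1 + 1 = m by omega]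

end

section

variable {Ω : Type*} [MeasurableSpace Ω] {C : Set ℝ → Ω → ℕ∞} {μ : Measure Ω}
  [IsProbabilityMeasure μ] {ρ : ℕ → Ω → ℝ} {lam α : ℝ} {Nt m : ℕ}

lemma tailLaplace_area (hlam : 0 < lam) {s R : ℝ} (hR : 0 ≤ R) :
    tailLaplace lam α Nt s (lam * Real.pi * R ^ 2) = interferenceLaplace lam α Nt R s := by
  rw [tailLaplace, mul_div_cancel_left₀ _ (by positivity), Real.sqrt_sq hR]

lemma interferenceLaplace_mem (hlam : 0 < lam) (hα : 2 < α) (hN : 1 ≤ Nt) {s R : ℝ} (hs : 0 ≤ s)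
    (hR : 0 < R) : 0 < interferenceLaplace lam α Nt R s ∧ interferenceLaplace lam α Nt R s ≤ 1 := by
  rw [← tailLaplace_area hlam hR.le]
  exact tailLaplace_mem hlam hα hN hs (by positivity)

lemma interferenceLaplace_zero (hlam : 0 < lam) (hα : 2 < α) (hN : 1 ≤ Nt) {R : ℝ}
    (hR : 0 < R) : interferenceLaplace lam α Nt R 0 = 1 := by
  rw [← tailLaplace_area hlam hR.le]
  exact tailLaplace_zero_right hlam hα hN (by positivity)

lemma measurable_interferenceLaplace_comp (hlam : 0 < lam) (hα : 2 < α) (hN : 1 ≤ Nt) {s : ℝ}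
    (hs : 0 ≤ s) {A : Type*} [MeasurableSpace A] {R : A → ℝ} (hRm : Measurable R)
    (hR : ∀ a, 0 ≤ R a) : Measurable fun a => interferenceLaplace lam α Nt (R a) s := by
  have : (fun a => interferenceLaplace lam α Nt (R a) s) =
      fun a => tailLaplace lam α Nt s (lam * Real.pi * R a ^ 2) :=
    funext fun a => (tailLaplace_area hlam (hR a)).symm
  rw [this]
  have := measurable_tailLaplace (N := Nt) hlam hα hN hs
  fun_prop

lemma ae_forall_dist_pos (hρ : ∀ i ω, 0 ≤ ρ i ω)
    (h : IsPoissonArrivals (fun i ω => lam * Real.pi * ρ i ω ^ 2) C μ) :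
    ∀ᵐ ω ∂μ, ∀ i, 0 < ρ i ω := by
  filter_upwards [h.ae_forall_pos] with ω hω i
  refine (hρ i ω).lt_of_ne fun h0 => ?_
  have := hω i
  simp [← h0] at this

/-- The limit of the martingale as `n → ∞`, where the Laplace functional of the remaining points
tends to `1`. The shot noise may be infinite here, with `exp (-s * ∞) = 0`. -/
lemma lintegral_exp_shotNoise_of_pos (hlam : 0 < lam) (hα : 2 < α) (hN : 1 ≤ Nt)
    (hm : 1 ≤ m) (hρm : ∀ i, Measurable (ρ i)) (hρ : ∀ i ω, 0 ≤ ρ i ω)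
    (h : IsPoissonArrivals (fun i ω => lam * Real.pi * ρ i ω ^ 2) C μ) {s : ℝ} (hs : 0 < s)
    {Ψ : ℝ → ℝ → ℝ≥0∞} (hΨ : Measurable (Function.uncurry Ψ)) (hΨ1 : ∀ a b, Ψ a b ≤ 1) :
    ∫⁻ p, Ψ (ρ 0 p.1) (ρ (m - 1) p.1) *
        ENNReal.ofReal (if shotNoise α m (fun i => ρ i p.1) p.2 = ∞ then 0 else
          Real.exp (-(s * (shotNoise α m (fun i => ρ i p.1) p.2).toReal)))
        ∂(μ.prod (Measure.infinitePi fun _ : ℕ × Fin Nt => complexGaussian)) =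
      ∫⁻ ω, Ψ (ρ 0 ω) (ρ (m - 1) ω) *
        ENNReal.ofReal (interferenceLaplace lam α Nt (ρ (m - 1) ω) s) ∂μ := by
  set ν := μ.prod (Measure.infinitePi fun _ : ℕ × Fin Nt => complexGaussian) with hν
  have htm := measurable_tailLaplace (N := Nt) hlam hα hN hs.le
  have hpm : ∀ n, Measurable fun p : Ω × (ℕ × Fin Nt → ℂ) =>
      partialShotNoise α m (fun i => ρ i p.1) p.2 n := fun n =>
    (measurable_partialShotNoise n).comp (f := fun p : Ω × (ℕ × Fin Nt → ℂ) =>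
      ((fun i => ρ i p.1), p.2)) (by fun_prop)
  have hΨm : Measurable fun p : Ω × (ℕ × Fin Nt → ℂ) => Ψ (ρ 0 p.1) (ρ (m - 1) p.1) :=
    hΨ.comp (f := fun p : Ω × (ℕ × Fin Nt → ℂ) => (ρ 0 p.1, ρ (m - 1) p.1)) (by fun_prop)
  have hfst : Tendsto (Prod.fst : Ω × (ℕ × Fin Nt → ℂ) → Ω) (ae ν) (ae μ) :=
    Measure.quasiMeasurePreserving_fst.tendsto_ae
  have hlim := tendsto_lintegral_of_dominated_convergence (μ := ν)
    (F := fun n p => Ψ (ρ 0 p.1) (ρ (m - 1) p.1) *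
        (ENNReal.ofReal (Real.exp (-(s * partialShotNoise α m (fun i => ρ i p.1) p.2 n))) *
          ENNReal.ofReal (tailLaplace lam α Nt s (lam * Real.pi * ρ (m - 1 + n) p.1 ^ 2))))
    (f := fun p => Ψ (ρ 0 p.1) (ρ (m - 1) p.1) *
        ENNReal.ofReal (if shotNoise α m (fun i => ρ i p.1) p.2 = ∞ then 0 else
          Real.exp (-(s * (shotNoise α m (fun i => ρ i p.1) p.2).toReal))))
    (fun _ => 1) (fun n => by have := hpm n; fun_prop) ?_ (by simp) ?_
  · exact tendsto_nhds_unique (hlim.congr fun n =>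
      lintegral_exp_partialShotNoise_mul_tailLaplace hlam hα hN hm hρm hρ h hs.le hΨ n)
      tendsto_const_nhds
  · intro n
    filter_upwards [hfst.eventually (ae_forall_dist_pos hρ h)] with p hp
    have h1 := hp (m - 1 + n)
    refine mul_le_one' (hΨ1 _ _) (mul_le_one' ?_ ?_)
    · refine ENNReal.ofReal_le_one.2 (Real.exp_le_one_iff.2 (neg_nonpos.2 ?_))
      exact mul_nonneg hs.le (partialShotNoise_nonneg (fun i => hρ i p.1) n)
    · exact ENNReal.ofReal_le_one.2 (tailLaplace_mem hlam hα hN hs.le (by positivity)).2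
  · filter_upwards [hfst.eventually h.ae_tendsto_atTop] with p hp
    refine ENNReal.Tendsto.const_mul ?_ (Or.inr ((hΨ1 _ _).trans_lt ENNReal.one_lt_top).ne)
    have h1 := tendsto_exp_partialShotNoise (α := α) (m := m) (w := p.2) (fun i => hρ i p.1) hs
    have h2 : Tendsto (fun n => tailLaplace lam α Nt s (lam * Real.pi * ρ (m - 1 + n) p.1 ^ 2))
        atTop (𝓝 1) := (tendsto_tailLaplace hlam hα hN hs.le).comp
      (hp.comp (tendsto_atTop_mono (fun n => Nat.le_add_left n (m - 1)) tendsto_id))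
    have h3 := ENNReal.Tendsto.mul (ENNReal.tendsto_ofReal h1) (Or.inr ENNReal.ofReal_ne_top)
      (ENNReal.tendsto_ofReal h2) (Or.inr ENNReal.ofReal_ne_top)
    rwa [ENNReal.ofReal_one, mul_one] at h3

/-- The mean of `exp (-s * I)` is at most the probability of `I < ∞`, and it tends to `1` as `s → 0`
since `interferenceLaplace` is continuous at `s = 0`. -/
lemma ae_shotNoise_ne_top (hlam : 0 < lam) (hα : 2 < α) (hN : 1 ≤ Nt)
    (hm : 1 ≤ m) (hρm : ∀ i, Measurable (ρ i)) (hρ : ∀ i ω, 0 ≤ ρ i ω)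
    (h : IsPoissonArrivals (fun i ω => lam * Real.pi * ρ i ω ^ 2) C μ) :
    ∀ᵐ p ∂(μ.prod (Measure.infinitePi fun _ : ℕ × Fin Nt => complexGaussian)),
      shotNoise α m (fun i => ρ i p.1) p.2 ≠ ∞ := by
  set ν := μ.prod (Measure.infinitePi fun _ : ℕ × Fin Nt => complexGaussian) with hν
  have hIm : Measurable fun p : Ω × (ℕ × Fin Nt → ℂ) => shotNoise α m (fun i => ρ i p.1) p.2 :=
    (measurable_shotNoise α m).comp (f := fun p : Ω × (ℕ × Fin Nt → ℂ) =>
      ((fun i => ρ i p.1), p.2)) (by fun_prop)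
  have hset : MeasurableSet {p : Ω × (ℕ × Fin Nt → ℂ) |
      shotNoise α m (fun i => ρ i p.1) p.2 ≠ ∞} := (hIm (measurableSet_singleton ∞)).compl
  let s : ℕ → ℝ := fun l => 1 / ((l : ℝ) + 1)
  have hs : ∀ l, 0 < s l := fun l => by positivity
  have hle : ∀ l, ∫⁻ ω, ENNReal.ofReal (interferenceLaplace lam α Nt (ρ (m - 1) ω) (s l)) ∂μ ≤
      ν {p | shotNoise α m (fun i => ρ i p.1) p.2 ≠ ∞} := by
    intro l
    have h1 := lintegral_exp_shotNoise_of_pos hlam hα hN hm hρm hρ h (hs l)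
      (Ψ := fun _ _ => 1) measurable_const (fun _ _ => le_rfl)
    simp only [one_mul] at h1
    rw [← h1, ← lintegral_indicator_one hset]
    refine lintegral_mono fun p => ?_
    by_cases hp : shotNoise α m (fun i => ρ i p.1) p.2 = ∞
    · simp [hp]
    · rw [if_neg hp, indicator_of_mem (by exact hp), Pi.one_apply, ENNReal.ofReal_le_one,
        Real.exp_le_one_iff, neg_nonpos]
      exact mul_nonneg (hs l).le ENNReal.toReal_nonneg
  have hlim := tendsto_lintegral_of_dominated_convergence (μ := μ)
    (F := fun l ω => ENNReal.ofReal (interferenceLaplace lam α Nt (ρ (m - 1) ω) (s l)))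
    (f := fun _ => 1) (fun _ => 1)
    (fun l => (measurable_interferenceLaplace_comp hlam hα hN (hs l).le (hρm _)
      (hρ _)).ennreal_ofReal) ?_ (by simp) ?_
  · have h2 := le_of_tendsto' hlim hle
    rw [lintegral_one, measure_univ] at h2
    exact (mem_ae_iff_prob_eq_one hset).2 (le_antisymm prob_le_one h2)
  · intro l
    filter_upwards [ae_forall_dist_pos hρ h] with ω hω
    exact ENNReal.ofReal_le_one.2 (interferenceLaplace_mem hlam hα hN (hs l).le (hω _)).2
  · filter_upwards [ae_forall_dist_pos hρ h] with ω hω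
    have h1 := (analyticAt_interferenceLaplace lam hα hN (hω (m - 1)) le_rfl).continuousAt
    have h2 := ENNReal.tendsto_ofReal (h1.tendsto.comp tendsto_one_div_add_atTop_nhds_zero_nat)
    rwa [interferenceLaplace_zero hlam hα hN (hω _), ENNReal.ofReal_one] at h2

/-- The Laplace transform of the residual interference given `(r, R)`, tested against weights
`Ψ r R`. -/
lemma lintegral_exp_shotNoise (hlam : 0 < lam) (hα : 2 < α) (hN : 1 ≤ Nt)
    (hm : 1 ≤ m) (hρm : ∀ i, Measurable (ρ i)) (hρ : ∀ i ω, 0 ≤ ρ i ω)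
    (h : IsPoissonArrivals (fun i ω => lam * Real.pi * ρ i ω ^ 2) C μ) {s : ℝ} (hs : 0 ≤ s)
    {Ψ : ℝ → ℝ → ℝ≥0∞} (hΨ : Measurable (Function.uncurry Ψ)) (hΨ1 : ∀ a b, Ψ a b ≤ 1) :
    ∫⁻ p, Ψ (ρ 0 p.1) (ρ (m - 1) p.1) *
        ENNReal.ofReal (Real.exp (-s * (shotNoise α m (fun i => ρ i p.1) p.2).toReal))
        ∂(μ.prod (Measure.infinitePi fun _ : ℕ × Fin Nt => complexGaussian)) =
      ∫⁻ ω, Ψ (ρ 0 ω) (ρ (m - 1) ω) *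
        ENNReal.ofReal (interferenceLaplace lam α Nt (ρ (m - 1) ω) s) ∂μ := by
  rcases hs.eq_or_lt with rfl | hs
  · have hΨm : Measurable fun ω => Ψ (ρ 0 ω) (ρ (m - 1) ω) :=
      hΨ.comp (f := fun ω => (ρ 0 ω, ρ (m - 1) ω)) (by fun_prop)
    have h1 : ∀ᵐ ω ∂μ, Ψ (ρ 0 ω) (ρ (m - 1) ω) *
        ENNReal.ofReal (interferenceLaplace lam α Nt (ρ (m - 1) ω) 0) =
        Ψ (ρ 0 ω) (ρ (m - 1) ω) := by
      filter_upwards [ae_forall_dist_pos hρ h] with ω hω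
      rw [interferenceLaplace_zero hlam hα hN (hω _), ENNReal.ofReal_one, mul_one]
    rw [lintegral_congr_ae h1]
    simp only [neg_zero, zero_mul, Real.exp_zero, ENNReal.ofReal_one, mul_one]
    exact (lintegral_prod (fun p : Ω × (ℕ × Fin Nt → ℂ) => Ψ (ρ 0 p.1) (ρ (m - 1) p.1))
      (hΨm.comp measurable_fst).aemeasurable).trans (by simp)
  · rw [← lintegral_exp_shotNoise_of_pos hlam hα hN hm hρm hρ h hs hΨ hΨ1]
    refine lintegral_congr_ae ?_
    filter_upwards [ae_shotNoise_ne_top hlam hα hN hm hρm hρ h] with p hp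
    rw [if_neg hp, neg_mul]

end

/-! ### The tail of the Erlang law and derivatives of Laplace transforms -/

/-- The probability that a sum of `n + 1` standard exponential variables exceeds `t`, for `t ≥ 0`. -/
noncomputable def erlangTail (n : ℕ) (t : ℝ) : ℝ :=
  ∑ k ∈ Finset.range (n + 1), t ^ k / k.factorial * Real.exp (-t)

lemma continuous_erlangTail (n : ℕ) : Continuous (erlangTail n) := by
  unfold erlangTail
  fun_prop

lemma erlangTail_nonneg (n : ℕ) {t : ℝ} (ht : 0 ≤ t) : 0 ≤ erlangTail n t :=
  Finset.sum_nonneg fun _ _ => by positivity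

lemma erlangTail_le_one (n : ℕ) {t : ℝ} (ht : 0 ≤ t) : erlangTail n t ≤ 1 := by
  have h1 : ENNReal.ofReal (erlangTail n t) ≤ 1 := (erlangMeasure_Ioi n ht).symm.trans_le prob_le_one
  exact ENNReal.ofReal_le_one.1 h1

lemma erlangTail_zero (n : ℕ) : erlangTail n 0 = 1 := by
  simp [erlangTail, Finset.sum_range_succ']

section Laplace

variable {ν : Measure ℝ} [IsProbabilityMeasure ν]

lemma integrable_exp_neg_mul (hν : ∀ᵐ x ∂ν, 0 ≤ x) {s : ℝ} (hs : 0 ≤ s) :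
    Integrable (fun x => Real.exp (-s * x)) ν := by
  refine Integrable.of_bound (by fun_prop) 1 ?_
  filter_upwards [hν] with x hx
  rw [Real.norm_eq_abs, Real.abs_exp, Real.exp_le_one_iff, neg_mul, neg_nonpos]
  positivity

lemma continuousOn_integral_exp_neg_mul (hν : ∀ᵐ x ∂ν, 0 ≤ x) :
    ContinuousOn (fun s => ∫ x, Real.exp (-s * x) ∂ν) (Ici 0) := by
  refine continuousOn_of_dominated (bound := fun _ => 1) (fun s _ => by fun_prop) (fun s hs => ?_)
    (integrable_const 1) (Eventually.of_forall fun x => by fun_prop)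
  filter_upwards [hν] with x hx
  have hs' : (0 : ℝ) ≤ s := hs
  rw [Real.norm_eq_abs, Real.abs_exp, Real.exp_le_one_iff, neg_mul, neg_nonpos]
  positivity

/-- For a nonnegative variable with Laplace transform `φ`, the mean of the Erlang tail at `t x` is
read off the first `n` derivatives of `φ` at `t`. -/
lemma integral_erlangTail_mul (hν : ∀ᵐ x ∂ν, 0 ≤ x) {φ : ℝ → ℝ}
    (hφ : ∀ s, 0 ≤ s → ∫ x, Real.exp (-s * x) ∂ν = φ s) (n : ℕ) {t : ℝ} (ht : 0 ≤ t) :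
    ∫ x, erlangTail n (t * x) ∂ν =
      ∑ k ∈ Finset.range (n + 1), (-t) ^ k / (k.factorial : ℝ) * iteratedDeriv k φ t := by
  rcases ht.eq_or_lt with rfl | ht
  -- at `t = 0`, where `φ` is constrained on one side only, the terms with `k ≥ 1` vanish
  · have h0 := hφ 0 le_rfl
    simp only [neg_zero, zero_mul, Real.exp_zero, integral_const, probReal_univ, smul_eq_mul,
      mul_one] at h0
    simp [erlangTail_zero, Finset.sum_range_succ', ← h0]
  have hsub : Iio (0 : ℝ) ⊆ interior (integrableExpSet id ν) := by
    refine interior_maximal (fun s hs => ?_) isOpen_Iio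
    have hs' : s < 0 := hs
    have := integrable_exp_neg_mul hν (s := -s) (by linarith)
    simpa [integrableExpSet] using this
  have hmem : -t ∈ interior (integrableExpSet id ν) := hsub (by simpa using ht)
  have heq : φ =ᶠ[𝓝 t] fun s => mgf id ν (-s) := by
    filter_upwards [lt_mem_nhds ht] with s hs
    rw [← hφ s hs.le, mgf]
    rfl
  have hderiv : ∀ k, iteratedDeriv k φ t = (-1) ^ k * ∫ x, x ^ k * Real.exp (-t * x) ∂ν := by
    intro k
    rw [heq.iteratedDeriv_eq k, iteratedDeriv_comp_neg, iteratedDeriv_mgf hmem, smul_eq_mul]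
    rfl
  have hint : ∀ k, Integrable (fun x => x ^ k * Real.exp (-t * x)) ν := fun k =>
    integrable_pow_mul_exp_of_mem_interior_integrableExpSet hmem k
  have hterm : ∀ x, erlangTail n (t * x) = ∑ k ∈ Finset.range (n + 1),
      t ^ k / (k.factorial : ℝ) * (x ^ k * Real.exp (-t * x)) := by
    intro x
    refine Finset.sum_congr rfl fun k _ => ?_
    rw [mul_pow, neg_mul]
    ring
  simp_rw [hterm]
  rw [integral_finsetSum _ fun k _ => (hint k).const_mul _]
  refine Finset.sum_congr rfl fun k _ => ?_
  rw [integral_const_mul, hderiv, ← mul_assoc, neg_pow t k]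
  congr 1
  have : ((-1 : ℝ) ^ k) * (-1) ^ k = 1 := by rw [← mul_pow]; simp
  linear_combination (-(t ^ k / (k.factorial : ℝ))) * this

end Laplace

/-! ### Conditional Laplace transforms -/

section Conditional

variable {Ω B : Type*} [MeasurableSpace Ω] [MeasurableSpace B] {μ : Measure Ω}
  [IsProbabilityMeasure μ] {Y : Ω → B} {J : Ω → ℝ}

lemma ae_condDistrib_nonneg (hJ : Measurable J) (hJ0 : ∀ ω, 0 ≤ J ω) (hY : Measurable Y) :
    ∀ᵐ y ∂(μ.map Y), ∀ᵐ x ∂(condDistrib J Y μ y), 0 ≤ x := by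
  have hm : MeasurableSet {p : B × ℝ | 0 ≤ p.2} := measurableSet_le measurable_const measurable_snd
  have h1 : ∀ᵐ p ∂((μ.map Y) ⊗ₘ condDistrib J Y μ), 0 ≤ p.2 := by
    rw [compProd_map_condDistrib hJ.aemeasurable, ae_map_iff (hY.prodMk hJ).aemeasurable hm]
    exact Eventually.of_forall hJ0
  exact Measure.ae_ae_of_ae_compProd h1

lemma lintegral_condDistrib (hJ : Measurable J) (hY : Measurable Y) {f : B → ℝ → ℝ≥0∞}
    (hf : Measurable (Function.uncurry f)) :
    ∫⁻ ω, f (Y ω) (J ω) ∂μ = ∫⁻ y, ∫⁻ x, f y x ∂(condDistrib J Y μ y) ∂(μ.map Y) := by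
  have h1 := Measure.lintegral_compProd (μ := μ.map Y) (κ := condDistrib J Y μ) hf
  rw [compProd_map_condDistrib hJ.aemeasurable, lintegral_map hf (hY.prodMk hJ)] at h1
  exact h1

/-- The conditional law of a nonnegative variable has the expected Laplace transform, at all points
simultaneously. -/
lemma ae_integral_exp_condDistrib (hJ : Measurable J) (hJ0 : ∀ ω, 0 ≤ J ω) (hY : Measurable Y)
    {L : B → ℝ → ℝ} (hLm : ∀ s, 0 ≤ s → Measurable fun y => L y s)
    (hL : ∀ᵐ y ∂(μ.map Y), (∀ s, 0 ≤ s → 0 ≤ L y s) ∧ ContinuousOn (L y) (Ici 0))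
    (hJL : ∀ s, 0 ≤ s → ∀ S : Set B, MeasurableSet S →
      ∫⁻ ω, S.indicator 1 (Y ω) * ENNReal.ofReal (Real.exp (-s * J ω)) ∂μ =
        ∫⁻ ω, S.indicator 1 (Y ω) * ENNReal.ofReal (L (Y ω) s) ∂μ) :
    ∀ᵐ y ∂(μ.map Y), ∀ s, 0 ≤ s → ∫ x, Real.exp (-s * x) ∂(condDistrib J Y μ y) = L y s := by
  have := Measure.isProbabilityMeasure_map (μ := μ) hY.aemeasurable
  have h1 : ∀ s, 0 ≤ s → ∀ᵐ y ∂(μ.map Y),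
      ∫⁻ x, ENNReal.ofReal (Real.exp (-s * x)) ∂(condDistrib J Y μ y) =
        ENNReal.ofReal (L y s) := by
    intro s hs
    have hm : Measurable fun y =>
        ∫⁻ x, ENNReal.ofReal (Real.exp (-s * x)) ∂(condDistrib J Y μ y) :=
      Measurable.lintegral_kernel (by fun_prop)
    refine ae_eq_of_forall_setLIntegral_eq_of_sigmaFinite hm (hLm s hs).ennreal_ofReal
      fun S hS _ => ?_
    have h2 := hJL s hs S hS
    rw [lintegral_condDistrib hJ hY (f := fun y x => S.indicator 1 y *
      ENNReal.ofReal (Real.exp (-s * x))) (by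
        exact ((measurable_one.indicator hS).comp measurable_fst).mul (by fun_prop)),
      ← lintegral_map (μ := μ) (g := Y)
        (f := fun y => S.indicator 1 y * ENNReal.ofReal (L y s))
        ((measurable_one.indicator hS).mul (hLm s hs).ennreal_ofReal) hY] at h2
    rw [← lintegral_indicator hS, ← lintegral_indicator hS]
    refine Eq.trans (lintegral_congr fun y => ?_) (h2.trans (lintegral_congr fun y => ?_))
    · by_cases hy : y ∈ S <;> simp [hy]
    · by_cases hy : y ∈ S <;> simp [hy]
  have h3 : ∀ᵐ y ∂(μ.map Y), ∀ q : ℕ × ℕ,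
      ∫⁻ x, ENNReal.ofReal (Real.exp (-((q.1 : ℝ) / q.2) * x)) ∂(condDistrib J Y μ y) =
        ENNReal.ofReal (L y ((q.1 : ℝ) / q.2)) := ae_all_iff.2 fun q => h1 _ (by positivity)
  filter_upwards [h3, hL, ae_condDistrib_nonneg hJ hJ0 hY] with y hq hLy hy s hs
  have h4 : ∀ q : ℕ × ℕ, ∫ x, Real.exp (-((q.1 : ℝ) / q.2) * x) ∂(condDistrib J Y μ y) =
      L y ((q.1 : ℝ) / q.2) := by
    intro q
    have hq0 : (0 : ℝ) ≤ (q.1 : ℝ) / q.2 := by positivity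
    have h5 := hq q
    rw [← ofReal_integral_eq_lintegral_ofReal (integrable_exp_neg_mul hy hq0)
      (Eventually.of_forall fun _ => (Real.exp_pos _).le)] at h5
    exact (ENNReal.ofReal_eq_ofReal_iff (integral_nonneg fun _ => (Real.exp_pos _).le)
      (hLy.1 _ hq0)).1 h5
  -- the rational points `⌈s n⌉ / n` tend to `s`
  have hlim : Tendsto (fun n : ℕ => (⌈s * (n : ℝ)⌉₊ : ℝ) / (n : ℝ)) atTop (𝓝[Ici 0] s) :=
    tendsto_nhdsWithin_iff.2 ⟨(tendsto_nat_ceil_mul_div_atTop hs).comp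
      tendsto_natCast_atTop_atTop, Eventually.of_forall fun n => by simp only [mem_Ici]; positivity⟩
  have h5 := (continuousOn_integral_exp_neg_mul hy s hs).tendsto.comp hlim
  have h6 := (hLy.2 s hs).tendsto.comp hlim
  exact tendsto_nhds_unique h5 (h6.congr fun n => (h4 (_, n)).symm)

end Conditional

/-! ### Signal and interference -/

/-- The joint law of the signal power `S` and the interference `I` when the base stations are at
the distances `ρ i`: given the distances, `S` has an Erlang law with `δ + 1` stages and is
independent of `I`, and `I` is the shot noise of standard complex Gaussian receiver outputs. -/
structure HasReceiverLaw {Ω : Type*} [MeasurableSpace Ω] (α : ℝ) (m Nt δ : ℕ) (ρ : ℕ → Ω → ℝ)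
    (S : Ω → ℝ) (I : Ω → ℝ≥0∞) (μ : Measure Ω) : Prop where
  measurable_dist : ∀ i, Measurable (ρ i)
  dist_nonneg : ∀ i ω, 0 ≤ ρ i ω
  measurable_signal : Measurable S
  measurable_interference : Measurable I
  lintegral_eq : ∀ f : (ℕ → ℝ) → ℝ → ℝ≥0∞ → ℝ≥0∞,
    (Measurable fun p : (ℕ → ℝ) × ℝ × ℝ≥0∞ => f p.1 p.2.1 p.2.2) →
    ∫⁻ ω, f (fun i => ρ i ω) (S ω) (I ω) ∂μ =
      ∫⁻ p, ∫⁻ u, f (fun i => ρ i p.1) u (shotNoise α m (fun i => ρ i p.1) p.2)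
        ∂(erlangMeasure δ) ∂(μ.prod (Measure.infinitePi fun _ : ℕ × Fin Nt => complexGaussian))

namespace HasReceiverLaw

variable {Ω : Type*} [MeasurableSpace Ω] {μ : Measure Ω} {lam α : ℝ} {m Nt δ : ℕ}
  {ρ : ℕ → Ω → ℝ} {S : Ω → ℝ} {I : Ω → ℝ≥0∞} {C : Set ℝ → Ω → ℕ∞}

lemma lintegral_eq_of_interference (H : HasReceiverLaw α m Nt δ ρ S I μ)
    {f : (ℕ → ℝ) → ℝ≥0∞ → ℝ≥0∞} (hf : Measurable (Function.uncurry f)) :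
    ∫⁻ ω, f (fun i => ρ i ω) (I ω) ∂μ =
      ∫⁻ p, f (fun i => ρ i p.1) (shotNoise α m (fun i => ρ i p.1) p.2)
        ∂(μ.prod (Measure.infinitePi fun _ : ℕ × Fin Nt => complexGaussian)) := by
  have h1 := H.lintegral_eq (fun x _ t => f x t)
    (hf.comp (f := fun p : (ℕ → ℝ) × ℝ × ℝ≥0∞ => (p.1, p.2.2)) (by fun_prop))
  simpa using h1

/-- Given the interference, the signal power exceeds a threshold with the probability given by the
tail of its Erlang law. -/
lemma measure_lt_signal (H : HasReceiverLaw α m Nt δ ρ S I μ) {z c : ℝ} (hz : 0 ≤ z)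
    (hc : 0 ≤ c) :
    μ {ω | z * ρ 0 ω ^ α * (c + (I ω).toReal) < S ω} =
      ∫⁻ ω, ENNReal.ofReal (erlangTail δ (z * ρ 0 ω ^ α * (c + (I ω).toReal))) ∂μ := by
  have hρ0 := H.measurable_dist 0
  have hI := H.measurable_interference
  have hS := H.measurable_signal
  have het := (continuous_erlangTail δ).measurable
  have hset : MeasurableSet {q : (ℕ → ℝ) × ℝ × ℝ≥0∞ |
      z * q.1 0 ^ α * (c + q.2.2.toReal) < q.2.1} :=
    measurableSet_lt (by fun_prop) (by fun_prop)
  have h1 := H.lintegral_eq (fun x u t => {q : (ℕ → ℝ) × ℝ × ℝ≥0∞ |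
      z * q.1 0 ^ α * (c + q.2.2.toReal) < q.2.1}.indicator 1 (x, u, t))
    ((measurable_one.indicator hset).comp (by fun_prop))
  have h2 := H.lintegral_eq_of_interference (f := fun x t =>
    ENNReal.ofReal (erlangTail δ (z * x 0 ^ α * (c + t.toReal)))) (by
      simp only [Function.uncurry_def]; fun_prop)
  rw [h2, ← lintegral_indicator_one (measurableSet_lt (by fun_prop) hS)]
  refine Eq.trans ?_ (h1.trans (lintegral_congr fun p => ?_))
  · rfl
  · rw [erlangTail, ← erlangMeasure_Ioi, ← lintegral_indicator_one measurableSet_Ioi]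
    · rfl
    · exact mul_nonneg (mul_nonneg hz (Real.rpow_nonneg (H.dist_nonneg _ _) _))
        (add_nonneg hc ENNReal.toReal_nonneg)

variable [IsProbabilityMeasure μ]

lemma ae_interference_ne_top (H : HasReceiverLaw α m Nt δ ρ S I μ) (hlam : 0 < lam) (hα : 2 < α)
    (hN : 1 ≤ Nt) (hm : 1 ≤ m)
    (h : IsPoissonArrivals (fun i ω => lam * Real.pi * ρ i ω ^ 2) C μ) : ∀ᵐ ω ∂μ, I ω ≠ ∞ := by
  have hmeas : Measurable (({∞} : Set ℝ≥0∞).indicator (1 : ℝ≥0∞ → ℝ≥0∞)) :=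
    measurable_one.indicator (measurableSet_singleton _)
  have h1 := H.lintegral_eq_of_interference (f := fun _ t => ({∞} : Set ℝ≥0∞).indicator 1 t)
    (hmeas.comp measurable_snd)
  have h2 : ∫⁻ p, ({∞} : Set ℝ≥0∞).indicator (1 : ℝ≥0∞ → ℝ≥0∞)
      (shotNoise α m (fun i => ρ i p.1) p.2)
        ∂(μ.prod (Measure.infinitePi fun _ : ℕ × Fin Nt => complexGaussian)) = 0 := by
    refine (lintegral_congr_ae ?_).trans lintegral_zero
    filter_upwards [ae_shotNoise_ne_top hlam hα hN hm H.measurable_dist H.dist_nonneg h] with p hp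
    simp [hp]
  rw [h2] at h1
  filter_upwards [(lintegral_eq_zero_iff (hmeas.comp H.measurable_interference)).1 h1] with ω hω h0
  simp [h0] at hω

lemma lintegral_exp_interference (H : HasReceiverLaw α m Nt δ ρ S I μ) (hlam : 0 < lam)
    (hα : 2 < α) (hN : 1 ≤ Nt) (hm : 1 ≤ m)
    (h : IsPoissonArrivals (fun i ω => lam * Real.pi * ρ i ω ^ 2) C μ) {s : ℝ} (hs : 0 ≤ s)
    {Ψ : ℝ → ℝ → ℝ≥0∞} (hΨ : Measurable (Function.uncurry Ψ)) (hΨ1 : ∀ a b, Ψ a b ≤ 1) :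
    ∫⁻ ω, Ψ (ρ 0 ω) (ρ (m - 1) ω) * ENNReal.ofReal (Real.exp (-s * (I ω).toReal)) ∂μ =
      ∫⁻ ω, Ψ (ρ 0 ω) (ρ (m - 1) ω) *
        ENNReal.ofReal (interferenceLaplace lam α Nt (ρ (m - 1) ω) s) ∂μ := by
  rw [← lintegral_exp_shotNoise hlam hα hN hm H.measurable_dist H.dist_nonneg h hs hΨ hΨ1]
  refine H.lintegral_eq_of_interference (f := fun x t => Ψ (x 0) (x (m - 1)) *
    ENNReal.ofReal (Real.exp (-s * t.toReal))) ?_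
  have h1 : Measurable fun p : (ℕ → ℝ) × ℝ≥0∞ => Ψ (p.1 0) (p.1 (m - 1)) :=
    hΨ.comp (f := fun p : (ℕ → ℝ) × ℝ≥0∞ => (p.1 0, p.1 (m - 1))) (by fun_prop)
  exact h1.mul (by fun_prop)

lemma ae_integral_exp_condDistrib (H : HasReceiverLaw α m Nt δ ρ S I μ) (hlam : 0 < lam)
    (hα : 2 < α) (hN : 1 ≤ Nt) (hm : 1 ≤ m)
    (h : IsPoissonArrivals (fun i ω => lam * Real.pi * ρ i ω ^ 2) C μ) :
    ∀ᵐ y ∂(μ.map fun ω => (ρ 0 ω, ρ (m - 1) ω)), ∀ s, 0 ≤ s →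
      ∫ x, Real.exp (-s * x)
        ∂(condDistrib (fun ω => (I ω).toReal) (fun ω => (ρ 0 ω, ρ (m - 1) ω)) μ y) =
      interferenceLaplace lam α Nt y.2 s := by
  have hρ0 := H.measurable_dist 0
  have hρm := H.measurable_dist (m - 1)
  have hI := H.measurable_interference
  have hpos : ∀ᵐ y ∂(μ.map fun ω => (ρ 0 ω, ρ (m - 1) ω)), 0 < y.2 := by
    rw [ae_map_iff (by fun_prop) (measurableSet_lt measurable_const measurable_snd)]
    filter_upwards [ae_forall_dist_pos H.dist_nonneg h] with ω hω using hω _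
  -- the absolute value makes `L` measurable on all of `ℝ × ℝ`; distances are nonnegative
  have key := _root_.ae_integral_exp_condDistrib (μ := μ) (J := fun ω => (I ω).toReal)
    (Y := fun ω => (ρ 0 ω, ρ (m - 1) ω)) (by fun_prop) (fun _ => ENNReal.toReal_nonneg)
    (by fun_prop) (L := fun y s => interferenceLaplace lam α Nt |y.2| s)
    (fun s hs => measurable_interferenceLaplace_comp hlam hα hN hs (by fun_prop)
      (fun _ => abs_nonneg _)) ?_ ?_
  · filter_upwards [key, hpos] with y hy hy0 s hs
    rw [hy s hs, abs_of_pos hy0]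
  · filter_upwards [hpos] with y hy
    rw [abs_of_pos hy]
    exact ⟨fun s hs => (interferenceLaplace_mem hlam hα hN hs hy).1.le, fun s hs =>
      (analyticAt_interferenceLaplace lam hα hN hy hs).continuousAt.continuousWithinAt⟩
  · intro s hs A hA
    have h1 := H.lintegral_exp_interference hlam hα hN hm h hs
      (Ψ := fun a b => A.indicator 1 (a, b)) ((measurable_one.indicator hA).comp (by fun_prop))
      (fun a b => indicator_le_self' (fun _ _ => zero_le) _)
    simp only [abs_of_nonneg (H.dist_nonneg _ _)]
    exact h1

lemma condExp_exp_interference (H : HasReceiverLaw α m Nt δ ρ S I μ) (hlam : 0 < lam)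
    (hα : 2 < α) (hN : 1 ≤ Nt) (hm : 1 ≤ m)
    (h : IsPoissonArrivals (fun i ω => lam * Real.pi * ρ i ω ^ 2) C μ) {s : ℝ} (hs : 0 ≤ s) :
    μ[fun ω => Real.exp (-s * (I ω).toReal) |
      MeasurableSpace.comap (fun ω => (ρ 0 ω, ρ (m - 1) ω)) inferInstance] =ᵐ[μ]
      fun ω => interferenceLaplace lam α Nt (ρ (m - 1) ω) s := by
  have hρ0 := H.measurable_dist 0
  have hρm := H.measurable_dist (m - 1)
  have hI := H.measurable_interference
  have hY : Measurable fun ω => (ρ 0 ω, ρ (m - 1) ω) := by fun_prop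
  have h1 := condExp_ae_eq_integral_condDistrib (μ := μ) hY (Y := fun ω => (I ω).toReal)
    (by fun_prop) (f := fun x => Real.exp (-s * x)) (by fun_prop) (by
      refine Integrable.of_bound (Measurable.aestronglyMeasurable (by fun_prop)) 1
        (Eventually.of_forall fun ω => ?_)
      rw [Real.norm_eq_abs, Real.abs_exp, Real.exp_le_one_iff, neg_mul, neg_nonpos]
      exact mul_nonneg hs ENNReal.toReal_nonneg)
  filter_upwards [h1, ae_of_ae_map hY.aemeasurable (H.ae_integral_exp_condDistrib hlam hα hN hm h)]
    with ω hω1 hω2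
  rw [hω1, hω2 s hs]

/-- The coverage probability as an average over the two distances. The integrand `G` is the
conditional coverage probability, in a version that is measurable by construction; it agrees with
`conditionalCoverage`, whose measurability is not obvious, almost everywhere. -/
lemma exists_coverage (H : HasReceiverLaw α m Nt δ ρ S I μ) (hlam : 0 < lam)
    (hα : 2 < α) (hN : 1 ≤ Nt) (hm : 1 ≤ m)
    (h : IsPoissonArrivals (fun i ω => lam * Real.pi * ρ i ω ^ 2) C μ) {z : ℝ} (hz : 0 ≤ z)
    (σ : ℝ) :
    ∃ G : ℝ × ℝ → ℝ≥0∞, Measurable G ∧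
      μ {ω | z * ρ 0 ω ^ α * (Nt * σ ^ 2 + (I ω).toReal) < S ω} =
        ∫⁻ ω, G (ρ 0 ω, ρ (m - 1) ω) ∂μ ∧
      ∀ᵐ y ∂(μ.map fun ω => (ρ 0 ω, ρ (m - 1) ω)),
        G y = ENNReal.ofReal (conditionalCoverage lam α σ z Nt δ y.1 y.2) ∧
        0 ≤ conditionalCoverage lam α σ z Nt δ y.1 y.2 := by
  have hρ0 := H.measurable_dist 0
  have hρm := H.measurable_dist (m - 1)
  have hI := H.measurable_interference
  have het := (continuous_erlangTail δ).measurable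
  set Y : Ω → ℝ × ℝ := fun ω => (ρ 0 ω, ρ (m - 1) ω) with hYdef
  set J : Ω → ℝ := fun ω => (I ω).toReal with hJdef
  have hY : Measurable Y := by fun_prop
  have hJ : Measurable J := by fun_prop
  set c : ℝ := Nt * σ ^ 2 with hcdef
  have hc : 0 ≤ c := by positivity
  let f : ℝ × ℝ → ℝ → ℝ≥0∞ := fun y x =>
    ENNReal.ofReal (erlangTail δ (z * y.1 ^ α * (c + x)))
  have hf : Measurable (Function.uncurry f) := by
    simp only [Function.uncurry_def, f]
    fun_prop
  have hG : Measurable fun y => ∫⁻ x, f y x ∂(condDistrib J Y μ y) :=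
    Measurable.lintegral_kernel_prod_right' hf
  refine ⟨fun y => ∫⁻ x, f y x ∂(condDistrib J Y μ y), hG, ?_, ?_⟩
  · rw [H.measure_lt_signal hz hc]
    refine (lintegral_condDistrib hJ hY hf).trans ?_
    exact lintegral_map hG hY
  have hpos : ∀ᵐ y ∂(μ.map Y), 0 ≤ y.1 := by
    rw [ae_map_iff (by fun_prop) (measurableSet_le measurable_const measurable_fst)]
    exact Eventually.of_forall fun ω => H.dist_nonneg _ _
  filter_upwards [H.ae_integral_exp_condDistrib hlam hα hN hm h, hpos,
    ae_condDistrib_nonneg hJ (fun _ => ENNReal.toReal_nonneg) hY] with y hL hy0 hx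
  -- the conditional law of noise plus interference
  set ν := (condDistrib J Y μ y).map (fun x => c + x) with hν
  have hmc : Measurable fun x : ℝ => c + x := by fun_prop
  have hprob : IsProbabilityMeasure ν := Measure.isProbabilityMeasure_map hmc.aemeasurable
  have hν0 : ∀ᵐ x ∂ν, 0 ≤ x := by
    rw [hν, ae_map_iff hmc.aemeasurable (by exact measurableSet_le measurable_const measurable_id)]
    filter_upwards [hx] with x hx
    positivity
  have hφ : ∀ s, 0 ≤ s → ∫ x, Real.exp (-s * x) ∂ν = totalLaplace lam α σ Nt y.2 s := by
    intro s hs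
    rw [hν, integral_map hmc.aemeasurable (by fun_prop), totalLaplace, ← hL s hs,
      ← integral_mul_const]
    refine integral_congr_ae (Eventually.of_forall fun x => ?_)
    simp only
    rw [← Real.exp_add]
    congr 1
    rw [hcdef]
    ring
  have ht : 0 ≤ z * y.1 ^ α := mul_nonneg hz (Real.rpow_nonneg hy0 _)
  have h1 := integral_erlangTail_mul hν0 hφ δ ht
  have h2 : ∫ x, erlangTail δ (z * y.1 ^ α * x) ∂ν =
      conditionalCoverage lam α σ z Nt δ y.1 y.2 := h1
  have hbound : ∀ᵐ x ∂ν, 0 ≤ erlangTail δ (z * y.1 ^ α * x) := by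
    filter_upwards [hν0] with x hx using erlangTail_nonneg δ (mul_nonneg ht hx)
  have hint : Integrable (fun x => erlangTail δ (z * y.1 ^ α * x)) ν := by
    refine Integrable.of_bound (Measurable.aestronglyMeasurable (by fun_prop)) 1 ?_
    filter_upwards [hν0] with x hx
    rw [Real.norm_eq_abs, abs_of_nonneg (erlangTail_nonneg δ (mul_nonneg ht hx))]
    exact erlangTail_le_one δ (mul_nonneg ht hx)
  rw [← h2]
  refine ⟨?_, integral_nonneg_of_ae hbound⟩
  rw [ofReal_integral_eq_lintegral_ofReal hint hbound, hν, lintegral_map (by fun_prop) hmc]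

end HasReceiverLaw

/-! ### The signal, the interference and the coverage event of the receiver -/

lemma measurable_pzfFilter {Nt Nr m : ℕ} (hm : 1 ≤ m) (k : Fin Nt) :
    Measurable fun g : ℕ → Fin Nt → EuclideanSpace ℂ (Fin Nr) => pzfFilter m k g := by
  have h1 := (measurable_zeroForcingResidual (n := Nr)
    ((Finset.range m ×ˢ Finset.univ).erase (0, k)) (0, k)).comp
    (f := fun (g : ℕ → Fin Nt → EuclideanSpace ℂ (Fin Nr)) (p : ℕ × Fin Nt) => g p.1 p.2)
    (by fun_prop)
  have h2 : (fun g : ℕ → Fin Nt → EuclideanSpace ℂ (Fin Nr) => pzfFilter m k g) = _ :=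
    funext fun g => pzfFilter_eq hm k g
  rw [h2]
  simp only [Function.comp_def] at h1
  fun_prop

lemma hasReceiverLaw_pzf {Ω : Type*} [MeasurableSpace Ω] {μ : Measure Ω} [IsProbabilityMeasure μ]
    {Nt Nr m δ : ℕ} (α : ℝ) (hm : 1 ≤ m) (hNr : Nr = m * Nt + δ) (k : Fin Nt)
    {X : ℕ → Ω → EuclideanSpace ℝ (Fin 2)} (hX : ∀ i, Measurable (X i))
    {h : ℕ → Fin Nt → Ω → EuclideanSpace ℂ (Fin Nr)} (hh : ∀ i q, Measurable (h i q))
    (hlaw : ∀ i q, HasLaw (h i q) (complexGaussianVector Nr) μ)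
    (hindep : iIndepFun (fun p : ℕ × Fin Nt => h p.1 p.2) μ)
    (hXh : IndepFun (fun ω (i : ℕ) => X i ω) (fun ω (i : ℕ) (q : Fin Nt) => h i q ω) μ) :
    HasReceiverLaw α m Nt δ (fun i ω => ‖X i ω‖)
      (fun ω => ‖inner ℂ (pzfFilter m k fun i q => h i q ω) (h 0 k ω)‖ ^ 2)
      (fun ω => pzfInterference α m k (fun i => X i ω) (fun i q => h i q ω)) μ := by
  have hv : Measurable fun ω => pzfFilter m k fun i q => h i q ω :=
    (measurable_pzfFilter hm k).comp (f := fun ω i q => h i q ω) (by fun_prop)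
  have hW : Measurable fun ω => ((fun i => ‖X i ω‖), fun p : ℕ × Fin Nt =>
      inner ℂ (pzfFilter m k fun i q => h i q ω) (h (m + p.1) p.2 ω)) := by fun_prop
  refine ⟨fun i => (hX i).norm, fun _ _ => norm_nonneg _, by fun_prop,
    (measurable_shotNoise α m).comp hW, fun f hf => ?_⟩
  have hsn := measurable_shotNoise (Nt := Nt) α m
  have hf' : Measurable fun p : (ℕ → ℝ) × ℝ × (ℕ × Fin Nt → ℂ) =>
      f p.1 p.2.1 (shotNoise α m p.1 p.2.2) := by
    have h1 : Measurable fun p : (ℕ → ℝ) × ℝ × (ℕ × Fin Nt → ℂ) => shotNoise α m p.1 p.2.2 :=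
      hsn.comp (f := fun p : (ℕ → ℝ) × ℝ × (ℕ × Fin Nt → ℂ) => (p.1, p.2.2)) (by fun_prop)
    exact hf.comp (f := fun p : (ℕ → ℝ) × ℝ × (ℕ × Fin Nt → ℂ) =>
      (p.1, p.2.1, shotNoise α m p.1 p.2.2)) (by fun_prop)
  have hρ : Measurable fun ω i => ‖X i ω‖ := by fun_prop
  have h1 := lintegral_pzf_outputs hm hNr k hρ hh hlaw hindep
    (hXh.comp (φ := fun x i => ‖x i‖) (by fun_prop) measurable_id)
    (f := fun x u w => f x u (shotNoise α m x w)) hf'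
  refine h1.trans ?_
  have h2 : Measurable fun q : (Ω × (ℕ × Fin Nt → ℂ)) × ℝ =>
      f (fun i => ‖X i q.1.1‖) q.2 (shotNoise α m (fun i => ‖X i q.1.1‖) q.1.2) :=
    hf'.comp (f := fun q : (Ω × (ℕ × Fin Nt → ℂ)) × ℝ =>
      ((fun i => ‖X i q.1.1‖), q.2, q.1.2)) (by fun_prop)
  exact (lintegral_prod (fun p : Ω × (ℕ × Fin Nt → ℂ) => ∫⁻ u,
    f (fun i => ‖X i p.1‖) u (shotNoise α m (fun i => ‖X i p.1‖) p.2) ∂(erlangMeasure δ))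
    (h2.lintegral_prod_right').aemeasurable).symm

/-- The event of coverage, cleared of denominators. It covers a vanishing noise plus interference
too: the quotient is then `∞` or `0` according to whether the signal power is positive. -/
lemma lt_pzfSINR_iff {Nt Nr m : ℕ} {α σ z : ℝ} (hz : 0 ≤ z) {k : Fin Nt}
    {x : ℕ → EuclideanSpace ℝ (Fin 2)} {g : ℕ → Fin Nt → EuclideanSpace ℂ (Fin Nr)}
    (hx : 0 < ‖x 0‖) (hI : pzfInterference α m k x g ≠ ∞) :
    ENNReal.ofReal z < pzfSINR α σ m k x g ↔
      z * ‖x 0‖ ^ α * (Nt * σ ^ 2 + (pzfInterference α m k x g).toReal) <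
        ‖inner ℂ (pzfFilter m k g) (g 0 k)‖ ^ 2 := by
  have hr : 0 < ‖x 0‖ ^ α := Real.rpow_pos_of_pos hx α
  rw [pzfSINR, ENNReal.lt_div_iff_mul_lt (Or.inr ENNReal.ofReal_ne_top)
    (Or.inl (ENNReal.add_ne_top.2 ⟨ENNReal.ofReal_ne_top, hI⟩))]
  conv_lhs => rw [← ENNReal.ofReal_toReal hI]
  rw [← ENNReal.ofReal_add (by positivity) ENNReal.toReal_nonneg, ← ENNReal.ofReal_mul hz,
    ENNReal.ofReal_lt_ofReal_iff_of_nonneg (by positivity), Real.rpow_neg hx.le,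
    ← div_eq_mul_inv, lt_div_iff₀ hr]
  rw [mul_right_comm]

/-! ### The densities of the distances -/

lemma measurable_nearestDensity (lam : ℝ) : Measurable (nearestDensity lam) := by
  unfold nearestDensity
  fun_prop

lemma nearestDensity_pos {lam r : ℝ} (hlam : 0 < lam) (hr : 0 < r) : 0 < nearestDensity lam r := by
  unfold nearestDensity
  positivity

lemma interfererDensity_pos {lam r R : ℝ} (hlam : 0 < lam) (m : ℕ) (hr : 0 < r) (hR : r < R) :
    0 < interfererDensity lam m r R := by
  have h1 : 0 < R ^ 2 - r ^ 2 := by nlinarith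
  have h2 : 0 < R := hr.trans hR
  unfold interfererDensity
  positivity

lemma measurable_interfererDensity (lam : ℝ) (m : ℕ) :
    Measurable fun p : ℝ × ℝ => interfererDensity lam m p.1 p.2 := by
  unfold interfererDensity
  fun_prop

/-- A bounded function known almost everywhere for a probability measure with a positive density
is integrable against the density. -/
lemma integrable_mul_density {B : Type*} [MeasurableSpace B] {β M : Measure B}
    [IsProbabilityMeasure M] {d : B → ℝ} (hd : Measurable d) (hd0 : ∀ᵐ y ∂β, 0 < d y)
    (hM : M = β.withDensity fun y => ENNReal.ofReal (d y)) {G : B → ℝ≥0∞} (hG : Measurable G)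
    {c : B → ℝ} (hGc : ∀ᵐ y ∂M, G y = ENNReal.ofReal (c y) ∧ 0 ≤ c y)
    (hGM : ∫⁻ y, G y ∂M ≠ ∞) :
    Integrable (fun y => c y * d y) β ∧ (∫⁻ y, G y ∂M).toReal = ∫ y, c y * d y ∂β := by
  have h1 : ∀ᵐ y ∂β, G y = ENNReal.ofReal (c y) ∧ 0 ≤ c y := by
    rw [hM, ae_withDensity_iff hd.ennreal_ofReal] at hGc
    filter_upwards [hGc, hd0] with y hy hy0
    exact hy (by simpa using hy0)
  have h2 : (fun y => c y * d y) =ᵐ[β] fun y => (G y).toReal * d y := by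
    filter_upwards [h1] with y hy
    rw [hy.1, ENNReal.toReal_ofReal hy.2]
  have hm : AEStronglyMeasurable (fun y => c y * d y) β :=
    (Measurable.aestronglyMeasurable (by fun_prop)).congr h2.symm
  have hnn : 0 ≤ᵐ[β] fun y => c y * d y := by
    filter_upwards [h1, hd0] with y hy hy0 using mul_nonneg hy.2 hy0.le
  have h3 : ∫⁻ y, G y ∂M = ∫⁻ y, ENNReal.ofReal (c y * d y) ∂β := by
    rw [hM, lintegral_withDensity_eq_lintegral_mul _ hd.ennreal_ofReal hG]
    refine lintegral_congr_ae ?_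
    filter_upwards [h1] with y hy
    rw [Pi.mul_apply, hy.1, mul_comm, ENNReal.ofReal_mul hy.2]
  refine ⟨⟨hm, ?_⟩, ?_⟩
  · rw [hasFiniteIntegral_iff_ofReal hnn, ← h3]
    exact hGM.lt_top
  · rw [h3, integral_eq_lintegral_of_nonneg_ae hnn hm]

namespace IsPoissonArrivals

variable {Ω : Type*} [MeasurableSpace Ω] {C : Set ℝ → Ω → ℕ∞} {μ : Measure Ω}
  [IsProbabilityMeasure μ] {ρ : ℕ → Ω → ℝ} {lam : ℝ}

lemma map_nearest (hlam : 0 < lam) (hρm : ∀ i, Measurable (ρ i)) (hρ : ∀ i ω, 0 ≤ ρ i ω)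
    (h : IsPoissonArrivals (fun i ω => lam * Real.pi * ρ i ω ^ 2) C μ) :
    μ.map (ρ 0) = (volume.restrict (Ioi 0)).withDensity
      fun r => ENNReal.ofReal (nearestDensity lam r) := by
  refine Measure.ext fun A hA => ?_
  have hind : Measurable (A.indicator (1 : ℝ → ℝ≥0∞)) := measurable_one.indicator hA
  have hd := measurable_nearestDensity lam
  rw [← lintegral_indicator_one hA, ← lintegral_indicator_one hA,
    lintegral_withDensity_eq_lintegral_mul _ hd.ennreal_ofReal hind, lintegral_map hind (hρm 0),
    lintegral_nearest hlam hρ h hind]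
  rfl

lemma map_nearest_interferer (hlam : 0 < lam) (hρm : ∀ i, Measurable (ρ i))
    (hρ : ∀ i ω, 0 ≤ ρ i ω) (h : IsPoissonArrivals (fun i ω => lam * Real.pi * ρ i ω ^ 2) C μ)
    {m : ℕ} (hm : 2 ≤ m) :
    μ.map (fun ω => (ρ 0 ω, ρ (m - 1) ω)) =
      (volume.restrict {p : ℝ × ℝ | 0 < p.1 ∧ p.1 < p.2}).withDensity
        fun p => ENNReal.ofReal (interfererDensity lam m p.1 p.2 * nearestDensity lam p.1) := by
  refine Measure.ext fun A hA => ?_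
  have hind : Measurable (A.indicator (1 : ℝ × ℝ → ℝ≥0∞)) := measurable_one.indicator hA
  have hd := measurable_nearestDensity lam
  have hd' := measurable_interfererDensity lam m
  have hreg : MeasurableSet {p : ℝ × ℝ | 0 < p.1 ∧ p.1 < p.2} :=
    (measurableSet_lt measurable_const measurable_fst).inter
      (measurableSet_lt measurable_fst measurable_snd)
  have hD : Measurable fun p : ℝ × ℝ =>
      ENNReal.ofReal (interfererDensity lam m p.1 p.2 * nearestDensity lam p.1) := by fun_prop
  have hρ0 := hρm 0
  have hρ1 := hρm (m - 1)
  rw [← lintegral_indicator_one hA, ← lintegral_indicator_one hA,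
    lintegral_withDensity_eq_lintegral_mul _ hD hind, lintegral_map hind (by fun_prop),
    lintegral_nearest_interferer hlam hρ h hm (F := fun a b => A.indicator 1 (a, b)) hind,
    ← lintegral_indicator hreg, Measure.volume_eq_prod,
    lintegral_prod _ ((hD.mul hind).indicator hreg).aemeasurable,
    ← lintegral_indicator measurableSet_Ioi]
  refine lintegral_congr fun r => ?_
  by_cases hr : 0 < r
  · rw [indicator_of_mem (by exact hr), ← lintegral_indicator measurableSet_Ioi]
    refine lintegral_congr fun R => ?_
    by_cases hR : r < R
    · rw [indicator_of_mem (by exact hR),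
        indicator_of_mem (s := {p : ℝ × ℝ | 0 < p.1 ∧ p.1 < p.2}) (by exact ⟨hr, hR⟩)]
      rfl
    · rw [indicator_of_notMem (by exact hR),
        indicator_of_notMem (s := {p : ℝ × ℝ | 0 < p.1 ∧ p.1 < p.2}) (fun h => hR h.2)]
  · rw [indicator_of_notMem (by exact hr)]
    symm
    refine (lintegral_congr fun R => ?_).trans lintegral_zero
    rw [indicator_of_notMem (fun h => hr h.1)]

end IsPoissonArrivals

/-! ### The coverage formula -/

lemma setIntegral_region {f : ℝ × ℝ → ℝ}
    (hf : IntegrableOn f {p : ℝ × ℝ | 0 < p.1 ∧ p.1 < p.2}) :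
    ∫ p in {p : ℝ × ℝ | 0 < p.1 ∧ p.1 < p.2}, f p =
      ∫ r in Ioi (0 : ℝ), ∫ R in Ioi r, f (r, R) := by
  have hreg : MeasurableSet {p : ℝ × ℝ | 0 < p.1 ∧ p.1 < p.2} :=
    (measurableSet_lt measurable_const measurable_fst).inter
      (measurableSet_lt measurable_fst measurable_snd)
  rw [← integral_indicator hreg, Measure.volume_eq_prod,
    integral_prod _ ((integrable_indicator_iff hreg).2 hf), ← integral_indicator measurableSet_Ioi]
  refine integral_congr_ae (Eventually.of_forall fun r => ?_)
  simp only
  by_cases hr : 0 < r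
  · rw [indicator_of_mem (by exact hr), ← integral_indicator measurableSet_Ioi]
    refine integral_congr_ae (Eventually.of_forall fun R => ?_)
    simp only
    by_cases hR : r < R
    · rw [indicator_of_mem (s := Ioi r) (by exact hR), indicator_of_mem (by exact ⟨hr, hR⟩)]
    · rw [indicator_of_notMem (s := Ioi r) (by exact hR), indicator_of_notMem (fun h => hR h.2)]
  · rw [indicator_of_notMem (by exact hr)]
    refine (integral_congr_ae (Eventually.of_forall fun R => ?_)).trans (integral_zero _ _)
    rw [indicator_of_notMem (fun h => hr h.1)]

theorem theorem1 {Ω : Type*} [MeasurableSpace Ω] (μ : Measure Ω) [IsProbabilityMeasure μ]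
    (lam α σ z : ℝ) (hlam : 0 < lam) (hα : 2 < α) (hz : 0 ≤ z)
    (Nt Nr m δ : ℕ) (hm : 1 ≤ m) (hNr : Nr = m * Nt + δ) (k : Fin Nt)
    -- the base stations and their enumeration by distance from the user at the origin
    (Φ : Ω → Set (EuclideanSpace ℝ (Fin 2)))
    (hΦ : IsPoissonPointProcess (ENNReal.ofReal lam • volume) Φ μ)
    (X : ℕ → Ω → EuclideanSpace ℝ (Fin 2)) (hX : ∀ i, Measurable (X i))
    (hXΦ : ∀ᵐ ω ∂μ, IsDistanceOrdering (Φ ω) fun i => X i ω)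
    -- Rayleigh fading, independent of the base stations
    (h : ℕ → Fin Nt → Ω → EuclideanSpace ℂ (Fin Nr)) (hh : ∀ i q, Measurable (h i q))
    (hlaw : ∀ i q, HasLaw (h i q) (complexGaussianVector Nr) μ)
    (hindep : iIndepFun (fun p : ℕ × Fin Nt => h p.1 p.2) μ)
    (hXh : IndepFun (fun ω (i : ℕ) => X i ω) (fun ω (i : ℕ) (q : Fin Nt) => h i q ω) μ) :
    -- the residual interference is finite, with the stated conditional Laplace transform
    ((∀ᵐ ω ∂μ, pzfInterference α m k (fun i => X i ω) (fun i q => h i q ω) ≠ ∞) ∧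
      ∀ s : ℝ, 0 ≤ s →
        μ[fun ω => Real.exp
            (-s * (pzfInterference α m k (fun i => X i ω) (fun i q => h i q ω)).toReal) |
          MeasurableSpace.comap (fun ω => (‖X 0 ω‖, ‖X (m - 1) ω‖)) inferInstance]
        =ᵐ[μ] fun ω => interferenceLaplace lam α Nt ‖X (m - 1) ω‖ s) ∧
    -- the derivatives in the formula exist
    (∀ R s : ℝ, 0 < R → 0 ≤ s → ContDiffAt ℝ δ (totalLaplace lam α σ Nt R) s) ∧
    -- the coverage probability, when at least one interfering base station is cancelled
    (2 ≤ m →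
      IntegrableOn
        (fun p : ℝ × ℝ => conditionalCoverage lam α σ z Nt δ p.1 p.2 *
          interfererDensity lam m p.1 p.2 * nearestDensity lam p.1)
        {p | 0 < p.1 ∧ p.1 < p.2} ∧
      μ.real {ω | ENNReal.ofReal z < pzfSINR α σ m k (fun i => X i ω) (fun i q => h i q ω)} =
        ∫ r in Ioi (0 : ℝ), ∫ R in Ioi r,
          conditionalCoverage lam α σ z Nt δ r R * interfererDensity lam m r R *
            nearestDensity lam r) ∧
    -- the case `m = 1`, where `R = r`
    (m = 1 →
      IntegrableOn
        (fun r : ℝ => conditionalCoverage lam α σ z Nt δ r r * nearestDensity lam r) (Ioi 0) ∧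
      μ.real {ω | ENNReal.ofReal z < pzfSINR α σ m k (fun i => X i ω) (fun i q => h i q ω)} =
        ∫ r in Ioi (0 : ℝ), conditionalCoverage lam α σ z Nt δ r r * nearestDensity lam r) := by
  have hN : 1 ≤ Nt := k.pos
  have H := hasReceiverLaw_pzf α hm hNr k hX hh hlaw hindep hXh
  have hU := hΦ.isPoissonArrivals hlam hX hXΦ
  have hρm : ∀ i, Measurable fun ω => ‖X i ω‖ := fun i => (hX i).norm
  have hρ : ∀ i ω, 0 ≤ ‖X i ω‖ := fun _ _ => norm_nonneg _
  have hfin := H.ae_interference_ne_top hlam hα hN hm hU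
  obtain ⟨G, hG, hGP, hGC⟩ := H.exists_coverage hlam hα hN hm hU hz σ
  have hP : μ {ω | ENNReal.ofReal z < pzfSINR α σ m k (fun i => X i ω) (fun i q => h i q ω)} =
      ∫⁻ ω, G (‖X 0 ω‖, ‖X (m - 1) ω‖) ∂μ := by
    rw [← hGP]
    refine measure_congr ?_
    filter_upwards [hfin, ae_forall_dist_pos hρ hU] with ω hω hω0
    exact propext (lt_pzfSINR_iff hz (hω0 0) hω)
  refine ⟨⟨hfin, fun s hs => H.condExp_exp_interference hlam hα hN hm hU hs⟩,
    fun R s hR hs => (analyticAt_totalLaplace lam σ hα hN hR hs).contDiffAt, fun hm2 => ?_,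
    fun hm1 => ?_⟩
  · have hY : Measurable fun ω => (‖X 0 ω‖, ‖X (m - 1) ω‖) := (hρm 0).prodMk (hρm (m - 1))
    have hprob := Measure.isProbabilityMeasure_map (μ := μ) hY.aemeasurable
    rw [← lintegral_map hG hY] at hP
    have hreg : MeasurableSet {p : ℝ × ℝ | 0 < p.1 ∧ p.1 < p.2} :=
      (measurableSet_lt measurable_const measurable_fst).inter
        (measurableSet_lt measurable_fst measurable_snd)
    have hd := measurable_nearestDensity lam
    have hd' := measurable_interfererDensity lam m
    have key := integrable_mul_density (by fun_prop)
      (ae_restrict_of_forall_mem hreg fun p hp =>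
        mul_pos (interfererDensity_pos hlam m hp.1 hp.2) (nearestDensity_pos hlam hp.1))
      (hU.map_nearest_interferer hlam hρm hρ hm2) hG hGC (hP ▸ measure_ne_top _ _)
    simp only [← mul_assoc] at key
    refine ⟨key.1, ?_⟩
    rw [measureReal_def, hP, key.2, setIntegral_region key.1]
  -- for `m = 1` the law of `(r, R)` is carried by the diagonal
  · subst hm1
    have hY := hρm 0
    have hprob := Measure.isProbabilityMeasure_map (μ := μ) hY.aemeasurable
    have hdiag : Measurable fun r : ℝ => (r, r) := by fun_prop
    have hG' : Measurable fun r => G (r, r) := hG.comp hdiag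
    have hP' : μ {ω | ENNReal.ofReal z <
        pzfSINR α σ 1 k (fun i => X i ω) (fun i q => h i q ω)} =
        ∫⁻ r, G (r, r) ∂(μ.map fun ω => ‖X 0 ω‖) := hP.trans (lintegral_map hG' hY).symm
    have hmap : (μ.map fun ω => ‖X 0 ω‖).map (fun r => (r, r)) =
        μ.map fun ω => (‖X 0 ω‖, ‖X (1 - 1) ω‖) := Measure.map_map hdiag hY
    rw [← hmap] at hGC
    have key := integrable_mul_density (measurable_nearestDensity lam)
      (ae_restrict_of_forall_mem measurableSet_Ioi fun r hr => nearestDensity_pos hlam hr)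
      (hU.map_nearest hlam hρm hρ) hG' (ae_of_ae_map hdiag.aemeasurable hGC)
      (hP' ▸ measure_ne_top _ _)
    refine ⟨key.1, ?_⟩
    rw [measureReal_def, hP', key.2]
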